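/- For $n\ge 2$ and $p>1$ let $\gamma(p,n)=2+(n+1)p-(n-1)p^2$, and let $p_S(n)=\frac{n+1+\sqrt{n^2+10n-7}}{2(n-1)}$ be the positive root of $\gamma(\cdot,n)$, so that $p_S(5)=\frac{3+\sqrt{17}}4$. Let $1<p\le p_S(5)$, and let $f\in C_0^3(\mathbb{R}^3)$ and $g\in C_0^2(\mathbb{R}^3)$ be real-valued functions with compact support. For $\varepsilon>0$ let $u^0\in C^2(\mathbb{R}^3\times[0,\infty))$ be the classical solution of $$u^0_{tt}-\Delta u^0=0,\qquad u^0(x,0)=\varepsilon f(x),\qquad u^0_t(x,0)=\varepsilon\{f(x)+g(x)\},$$ and consider the integral equation $$u(x,t)=u^0(x,t)+L[|u|^p](x,t),\qquad L[w](x,t)=\frac1{4\pi}\int_0^t(t-s)\int_{|\eta|=1}(1+s)^{-(p-1)}w(x+(t-s)\eta,s)\,d\omega_\eta\,ds .\qquad(*)$$ The lifespan $T(\varepsilon)\in[0,\infty]$ is the supremum of all $T\in[0,\infty)$ such that $(*)$ has a unique solution $u\in C^1(\mathbb{R}^3\times[0,T))$. Then there exist positive constants $A$ and $\varepsilon_0$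 (depending only on $p,f,g$) such that, for every $0<\varepsilon\le\varepsilon_0$, equation $(*)$ has a unique solution $u\in C^1(\mathbb{R}^3\times[0,T))$ for every $T>0$ with $$T\le\begin{cases}A\,\varepsilon^{-2p(p-1)/\gamma(p,5)}&(1<p<p_S(5)),\\ \exp\bigl(A\,\varepsilon^{-p(p-1)}\bigr)&(p=p_S(5)).\end{cases}$$ Consequently $T(\varepsilon)$ is at least the right-hand side for $0<\varepsilon\le\varepsilon_0$. -/

import Mathlib

open MeasureTheory Set

namespace DampedWave

noncomputable section

/-- Three dimensional Euclidean space. -/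
abbrev Space : Type := EuclideanSpace ℝ (Fin 3)

/-- The quadratic polynomial `γ(p, n) = 2 + (n + 1) p - (n - 1) p ^ 2`. -/
def gam (p n : ℝ) : ℝ := 2 + (n + 1) * p - (n - 1) * p ^ 2

/-- The Strauss exponent `p_S(n)`, the positive root of `γ(p, n) = 0` (for `n ≥ 2`). -/
def strauss (n : ℝ) : ℝ := (n + 1 + √(n ^ 2 + 10 * n - 7)) / (2 * (n - 1))

/-- The integral operator
`L[w](x, t) = (4π)⁻¹ ∫₀ᵗ (t - s) ∫_{|η| = 1} (1 + s)^{-(p - 1)} w(x + (t - s) η, s) dω_η ds`.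
Here `volume.toSphere` is the surface measure of the unit sphere (total mass `4π`). -/
def opL (p : ℝ) (w : Space → ℝ → ℝ) (x : Space) (t : ℝ) : ℝ :=
  1 / (4 * Real.pi) * ∫ s in (0 : ℝ)..t, (t - s) *
    ∫ η : Metric.sphere (0 : Space) 1,
      (1 + s) ^ (-(p - 1)) * w (x + (t - s) • (η : Space)) s
        ∂((volume : Measure Space).toSphere)

/-- `u₀ ∈ C²(ℝ³ × [0, ∞))` is a classical solution of the linear wave equation
`u_tt - Δu = 0` with `u(x, 0) = ε f(x)`, `u_t(x, 0) = ε (f(x) + g(x))`.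
Time derivatives are one-sided at `t = 0`. -/
structure IsFreeWave (f g : Space → ℝ) (ε : ℝ) (u₀ : Space → ℝ → ℝ) : Prop where
  contDiffOn : ContDiffOn ℝ 2 (fun z : Space × ℝ => u₀ z.1 z.2) (univ ×ˢ Ici (0 : ℝ))
  wave : ∀ (x : Space) (t : ℝ), 0 ≤ t →
    iteratedDerivWithin 2 (u₀ x) (Ici 0) t - Laplacian.laplacian (fun y => u₀ y t) x = 0
  init : ∀ x : Space, u₀ x 0 = ε * f x
  init_deriv : ∀ x : Space, derivWithin (u₀ x) (Ici 0) 0 = ε * (f x + g x)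

/-- `u ∈ C¹(ℝ³ × [0, T))` is a solution of the integral equation `u = u₀ + L[|u|^p]` in
`ℝ³ × [0, T)`, where `u₀` is the solution of the linear wave equation with data
`(ε f, ε (f + g))`. -/
structure IsSolution (p : ℝ) (f g : Space → ℝ) (ε T : ℝ) (u : Space → ℝ → ℝ) : Prop where
  contDiffOn : ContDiffOn ℝ 1 (fun z : Space × ℝ => u z.1 z.2) (univ ×ˢ Ico 0 T)
  eqn : ∃ u₀ : Space → ℝ → ℝ, IsFreeWave f g ε u₀ ∧
    ∀ (x : Space) (t : ℝ), 0 ≤ t → t < T →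
      u x t = u₀ x t + opL p (fun y s => |u y s| ^ p) x t

/-- There is a unique `C¹` solution on `ℝ³ × [0, T)`; two solutions are identified when they
agree on `ℝ³ × [0, T)`. -/
def UniquelySolvable (p : ℝ) (f g : Space → ℝ) (ε T : ℝ) : Prop :=
  ∃ u : Space → ℝ → ℝ, IsSolution p f g ε T u ∧
    ∀ v : Space → ℝ → ℝ, IsSolution p f g ε T v →
      ∀ (x : Space) (t : ℝ), 0 ≤ t → t < T → v x t = u x t

/-- The lifespan `T(ε) ∈ [0, ∞]`: the supremum of all `T ∈ [0, ∞)` such that there is a unique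
`C¹` solution on `ℝ³ × [0, T)`. -/
def lifespan (p : ℝ) (f g : Space → ℝ) (ε : ℝ) : ENNReal :=
  sSup (ENNReal.ofReal '' {T : ℝ | 0 ≤ T ∧ UniquelySolvable p f g ε T})

/-- `A ε^{-2p(p-1)/γ(p,5)}` if `p < p_S(5)`, and `exp(A ε^{-p(p-1)})` otherwise (it is used for
`p ≤ p_S(5)`, where the second case is `p = p_S(5)`). -/
def lowerBound (p A ε : ℝ) : ℝ :=
  if p < strauss 5 then A * ε ^ (-(2 * p * (p - 1) / gam p 5))
  else Real.exp (A * ε ^ (-(p * (p - 1))))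

end

end DampedWave

/-! The proof is John's iteration in a weighted space. By Kirchhoff's formula
(`IsFreeWave.eq_kirchhoff`) and the strong Huygens principle, the free wave lives in `|t - |x|| ≤ k`
and has size `Cε / (1 + t)` (`exists_kirchhoff_bound`). The perturbation `u - u₀` is measured
against the profile `(1 + t + r)^(a-1) (1 + |t - r|)^(-b)`, with `r = |x|` and `b = a + 2p - 3`.

The analytic core is `abs_retard_radial_le`. Suppose a source is supported in `|y| ≤ s + k` and
dominated by `(1 + s)^(-(p-1)) (1 + s + |y|)^(-p) h(s - |y|)`. John's formula
`lintegral_sphere_radial` reduces its potential to `1/r` times a double integral in `(s, l)`. In the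
characteristic variables `α = s + l`, `β = s - l` this decouples into `∫ (1 + α)^(2-2p) dα` over
`[|t - r|, t + r]`, times `∫ h(β) dβ`. The first factor reproduces the profile, with a factor `r`
that cancels `1/r`; hence the potential is at most a constant times `∫ h` times the profile.

For the power nonlinearity, `h` has two parts. The free wave contributes `E^p` on `[-k, k]`, where
`E` is proportional to `ε`. A perturbation of weighted size `M` contributes `M^p (1 + 2T + k)^(pa)
(1 + |β|)^(-pb)`. Since the first part alone produces a perturbation of order `E^p`, the iteration
closes with `M = D E^p`, and the requirement becomes `ε^(p(p-1)) (1 + 2T + k)^(pa) J ≤ c`, where `J`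
bounds `∫ (1 + |β|)^(-pb)` over `[-k, T]` (`exists_uniquelySolvable_of_small`). In the subcritical
case one takes `pb < 1`, so `J` grows like `T^(1-pb)` and the total power of `T` is `pa + 1 - pb = 1
- p(2p-3) = γ(p,5)/2`. In the critical case `a = 0` and `pb = 1`, so `J` is logarithmic and the time
is exponential.

Regularity is separated from size. The nonlinearity is first replaced by `truncPow`, equal to
`|v|^p` on `[-1, 1]` and affine on each side beyond it, and the free wave is cut off in time. The
Picard iterates then converge globally in `C¹` thanks to exponential time weights
(`Admissible.exists_solution`). The weighted bounds, passed to the limit of the same iterates, give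
`|u| ≤ 1` on `[0, T]`, where the truncation is therefore invisible. Uniqueness (`IsSolution.eq`) is
a contraction on backward light cones and uses no smallness.

The facts on spherical means all come from rotation invariance: infinitesimal rotations integrate to
zero over the sphere (`integral_fderiv_wedge`). This yields the Darboux identity, and so Kirchhoff's
formula, and also Archimedes' hat-box theorem, and so John's formula. -/

namespace DampedWave

noncomputable section

open Filter Topology Pointwise

universe v

/-! ### Differentiation of parametric integrals -/

section Parametric

variable {X : Type*} [TopologicalSpace X] [CompactSpace X] [SecondCountableTopology X]
  [MeasurableSpace X] [OpensMeasurableSpace X] {μ : Measure X} [IsFiniteMeasure μ]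

theorem integrable_of_continuous {F : Type*} [NormedAddCommGroup F] {G : X → F}
    (hG : Continuous G) : Integrable G μ := by
  obtain ⟨C, hC⟩ := isCompact_univ.exists_bound_of_continuousOn hG.continuousOn
  exact Integrable.of_bound hG.aestronglyMeasurable C (ae_of_all _ fun x => hC x (mem_univ x))

/-- Differentiation under the integral sign over a compact space. -/
theorem hasFDerivAt_integral_of_continuousOn {E F : Type*} [NormedAddCommGroup E]
    [NormedSpace ℝ E] [NormedAddCommGroup F] [NormedSpace ℝ F] {U : Set E} (hU : IsOpen U)
    {G : E → X → F} {G' : E → X → E →L[ℝ] F} (hG : ∀ z ∈ U, Continuous (G z))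
    (hG' : ContinuousOn (Function.uncurry G') (U ×ˢ univ))
    (hd : ∀ z ∈ U, ∀ ξ, HasFDerivAt (fun y => G y ξ) (G' z ξ) z) {z : E} (hz : z ∈ U) :
    HasFDerivAt (fun y => ∫ ξ, G y ξ ∂μ) (∫ ξ, G' z ξ ∂μ) z := by
  have hcz : Continuous (G' z) := by
    have : ContinuousOn (fun ξ : X => Function.uncurry G' (z, ξ)) univ :=
      hG'.comp (by fun_prop) (fun ξ _ => ⟨hz, mem_univ ξ⟩)
    exact continuousOn_univ.1 this
  obtain ⟨C, hC⟩ := isCompact_univ.exists_bound_of_continuousOn hcz.continuousOn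
  -- Compactness of `X` turns joint continuity into one bound on a whole neighbourhood of `z`; that
  -- constant is the dominating function.
  have hev : ∀ᶠ y in 𝓝 z, ∀ ξ ∈ (univ : Set X), ‖G' y ξ‖ ≤ C + 1 := by
    refine isCompact_univ.eventually_forall_of_forall_eventually fun ξ hξ => ?_
    have h1 : ContinuousAt (Function.uncurry G') (z, ξ) :=
      hG'.continuousAt ((hU.prod isOpen_univ).mem_nhds ⟨hz, mem_univ ξ⟩)
    have h2 : ‖Function.uncurry G' (z, ξ)‖ < C + 1 := (hC ξ hξ).trans_lt (by linarith)
    filter_upwards [h1.norm.eventually_lt continuousAt_const h2] with q hq using hq.le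
  have hUz := hU.mem_nhds hz
  refine hasFDerivAt_integral_of_dominated_of_fderiv_le (bound := fun _ => C + 1)
    (s := {y | y ∈ U ∧ ∀ ξ ∈ (univ : Set X), ‖G' y ξ‖ ≤ C + 1})
    (by filter_upwards [hUz, hev] with y h1 h2 using ⟨h1, h2⟩) ?_ ?_ ?_ ?_ ?_ ?_
  · filter_upwards [hUz] with y hy using (hG y hy).aestronglyMeasurable
  · exact integrable_of_continuous (hG z hz)
  · exact hcz.aestronglyMeasurable
  · exact ae_of_all _ fun ξ y hy => hy.2 ξ (mem_univ ξ)
  · exact integrable_const _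
  · exact ae_of_all _ fun ξ y hy => hd y hy.1 ξ

theorem continuous_integral_of_continuous {Y F : Type*} [TopologicalSpace Y]
    [FirstCountableTopology Y] [NormedAddCommGroup F] [NormedSpace ℝ F] {G : Y → X → F}
    (hG : Continuous (Function.uncurry G)) : Continuous fun y => ∫ ξ, G y ξ ∂μ := by
  refine continuous_iff_continuousAt.2 fun z => ?_
  have hc : ∀ y, Continuous (G y) := fun y => hG.comp (by fun_prop : Continuous fun ξ => (y, ξ))
  obtain ⟨C, hC⟩ := isCompact_univ.exists_bound_of_continuousOn (hc z).continuousOn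
  have hev : ∀ᶠ y in 𝓝 z, ∀ ξ ∈ (univ : Set X), ‖G y ξ‖ ≤ C + 1 := by
    refine isCompact_univ.eventually_forall_of_forall_eventually fun ξ hξ => ?_
    have h2 : ‖Function.uncurry G (z, ξ)‖ < C + 1 := (hC ξ hξ).trans_lt (by linarith)
    filter_upwards [hG.continuousAt.norm.eventually_lt continuousAt_const h2] with q hq using hq.le
  refine tendsto_integral_filter_of_dominated_convergence (fun _ => C + 1)
    (Eventually.of_forall fun y => (hc y).aestronglyMeasurable) ?_ (integrable_const _) ?_
  · filter_upwards [hev] with y hy using ae_of_all _ fun ξ => hy ξ (mem_univ ξ)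
  · exact ae_of_all _ fun ξ =>
      (hG.comp (by fun_prop : Continuous fun y => (y, ξ))).continuousAt

theorem hasFDerivAt_integral_comp_clm {E E' F H : Type*} [NormedAddCommGroup E]
    [NormedSpace ℝ E] [NormedAddCommGroup E'] [NormedSpace ℝ E'] [NormedAddCommGroup F]
    [NormedSpace ℝ F] [NormedAddCommGroup H] [NormedSpace ℝ H]
    {A : X → E →L[ℝ] E'} (hA : Continuous A) {B : X → F →L[ℝ] H} (hB : Continuous B)
    {w : E' → F} (hw : ContDiff ℝ 1 w) (z : E) :
    HasFDerivAt (fun z => ∫ ξ, B ξ (w (A ξ z)) ∂μ)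
      (∫ ξ, (B ξ).comp ((fderiv ℝ w (A ξ z)).comp (A ξ)) ∂μ) z := by
  have hw' : Continuous (fderiv ℝ w) := hw.continuous_fderiv one_ne_zero
  refine hasFDerivAt_integral_of_continuousOn (U := univ) isOpen_univ
    (G := fun z ξ => B ξ (w (A ξ z)))
    (G' := fun z ξ => (B ξ).comp ((fderiv ℝ w (A ξ z)).comp (A ξ))) ?_ ?_ ?_ (mem_univ z)
  · intro z _
    exact hB.clm_apply (hw.continuous.comp (hA.clm_apply continuous_const))
  · refine Continuous.continuousOn ?_
    refine (hB.comp continuous_snd).clm_comp (Continuous.clm_comp (hw'.comp ?_)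
      (hA.comp continuous_snd))
    exact (hA.comp continuous_snd).clm_apply continuous_fst
  · intro z _ ξ
    have h1 : HasFDerivAt w (fderiv ℝ w (A ξ z)) (A ξ z) :=
      (hw.differentiable one_ne_zero).differentiableAt.hasFDerivAt
    exact (B ξ).hasFDerivAt.comp z (h1.comp z (A ξ).hasFDerivAt)

/-- The derivative of such an integral is again of this form, with `fderiv ℝ w` for `w` and an
operator-valued `B`. The spaces `F` and `H` therefore change along the induction and are quantified
inside it; a common universe keeps the spaces of operators within its range. -/
theorem contDiff_integral_comp_clm {E E' : Type v} [NormedAddCommGroup E]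
    [NormedSpace ℝ E] [NormedAddCommGroup E'] [NormedSpace ℝ E']
    {A : X → E →L[ℝ] E'} (hA : Continuous A) (n : ℕ) :
    ∀ {F H : Type v} [NormedAddCommGroup F]
    [NormedSpace ℝ F] [NormedAddCommGroup H] [NormedSpace ℝ H]
    {B : X → F →L[ℝ] H} (_ : Continuous B)
    {w : E' → F} (_ : ContDiff ℝ n w), ContDiff ℝ n (fun z => ∫ ξ, B ξ (w (A ξ z)) ∂μ) := by
  induction n with
  | zero =>
    intro F H _ _ _ _ B hB w hw
    refine contDiff_zero.2 (continuous_integral_of_continuous ?_)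
    exact (hB.comp continuous_snd).clm_apply
      (hw.continuous.comp ((hA.comp continuous_snd).clm_apply continuous_fst))
  | succ n ih =>
    intro F H _ _ _ _ B hB w hw
    have hw1 : ContDiff ℝ 1 w := hw.of_le (by norm_cast; omega)
    rw [show ((n + 1 : ℕ) : WithTop ℕ∞) = (n : WithTop ℕ∞) + 1 by norm_cast]
    refine (contDiff_succ_iff_fderiv (n := n)).2 ⟨fun z =>
      (hasFDerivAt_integral_comp_clm hA hB hw1 z).differentiableAt, by simp, ?_⟩
    have hfd : (fderiv ℝ fun z => ∫ ξ, B ξ (w (A ξ z)) ∂μ) = fun z => ∫ ξ,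
        ((ContinuousLinearMap.compL ℝ E F H (B ξ)).comp
          ((ContinuousLinearMap.compL ℝ E E' F).flip (A ξ))) (fderiv ℝ w (A ξ z)) ∂μ :=
      funext fun z => (hasFDerivAt_integral_comp_clm hA hB hw1 z).fderiv
    rw [hfd]
    refine ih (B := fun ξ => (ContinuousLinearMap.compL ℝ E F H (B ξ)).comp
          ((ContinuousLinearMap.compL ℝ E E' F).flip (A ξ))) ?_ ?_
    · exact ((ContinuousLinearMap.continuous _).comp hB).clm_comp
        ((ContinuousLinearMap.continuous _).comp hA)
    · refine hw.fderiv_right ?_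
      norm_cast

end Parametric

/-! ### Surface integrals on the unit sphere -/

/-- The unit sphere of `ℝ³`. -/
abbrev Sph : Type := Metric.sphere (0 : Space) 1

/-- The surface measure of the unit sphere of `ℝ³`. -/
abbrev surf : Measure Sph := (volume : Measure Space).toSphere

theorem norm_coe_sph (η : Sph) : ‖(η : Space)‖ = 1 := by simp

theorem surf_real_univ : surf.real univ = 4 * Real.pi := by
  rw [Measure.toSphere_real_apply_univ, Measure.real, EuclideanSpace.volume_ball_fin_three]
  simp only [finrank_euclideanSpace, Fintype.card_fin]
  rw [ENNReal.toReal_mul]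
  rw [ENNReal.toReal_ofReal (by positivity)]
  simp
  ring

theorem measurePreserving_surf (R : Space ≃ₗᵢ[ℝ] Space) :
    MeasurePreserving (fun η : Sph => (⟨R η, by simp⟩ : Sph)) surf surf := by
  have hm : Measurable (fun η : Sph => (⟨R η, by simp⟩ : Sph)) := by
    exact (R.continuous.comp continuous_subtype_val).measurable.subtype_mk
  refine ⟨hm, ?_⟩
  ext s hs
  rw [Measure.map_apply hm hs, Measure.toSphere_apply' _ (hm hs), Measure.toSphere_apply' _ hs]
  -- `toSphere` measures a set by the volume of the open cone over it, so invariance of the volume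
  -- under `R` is all that is needed.
  congr 1
  have hset : Ioo (0 : ℝ) 1 • ((↑) '' ((fun η : Sph => (⟨R η, by simp⟩ : Sph)) ⁻¹' s) : Set Space)
      = R ⁻¹' (Ioo (0 : ℝ) 1 • ((↑) '' s : Set Space)) := by
    ext y
    simp only [Set.mem_smul, mem_image, mem_preimage]
    constructor
    · rintro ⟨c, hc, _, ⟨η, hη, rfl⟩, rfl⟩
      exact ⟨c, hc, _, ⟨_, hη, rfl⟩, by simp⟩
    · rintro ⟨c, hc, _, ⟨η, hη, rfl⟩, h⟩
      refine ⟨c, hc, R.symm η, ⟨⟨R.symm η, by simp⟩, by simpa using hη, rfl⟩, ?_⟩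
      rw [← map_smul, h, R.symm_apply_apply]
  rw [hset]
  exact R.measurePreserving.measure_preimage_emb R.toHomeomorph.measurableEmbedding _

theorem integral_surf_comp_isometry {F : Type*} [NormedAddCommGroup F] [NormedSpace ℝ F]
    (R : Space ≃ₗᵢ[ℝ] Space) {φ : Space → F} (hφ : Continuous φ) :
    ∫ η : Sph, φ (R η) ∂surf = ∫ η : Sph, φ η ∂surf := by
  have h := measurePreserving_surf R
  have hc : Continuous fun η : Sph => φ η := hφ.comp continuous_subtype_val
  conv_rhs => rw [← h.map_eq]
  rw [integral_map h.measurable.aemeasurable hc.aestronglyMeasurable]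

/-- The skew-symmetric operator `η ↦ ⟪a, η⟫ b - ⟪b, η⟫ a`. -/
def wedge (a b : Space) : Space →L[ℝ] Space :=
  (innerSL ℝ a).smulRight b - (innerSL ℝ b).smulRight a

theorem wedge_apply (a b η : Space) : wedge a b η = inner ℝ a η • b - inner ℝ b η • a := rfl

theorem wedge_mem_skewAdjoint (a b : Space) : wedge a b ∈ skewAdjoint (Space →L[ℝ] Space) := by
  rw [skewAdjoint.mem_iff, ContinuousLinearMap.star_eq_adjoint, eq_comm,
    ContinuousLinearMap.eq_adjoint_iff]
  intro x y
  simp only [neg_apply, wedge_apply, inner_neg_left, inner_sub_left,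
    inner_sub_right, inner_smul_left, inner_smul_right, real_inner_comm]
  simp
  ring

/-- The integral over the sphere of an infinitesimal rotation of a function vanishes. -/
theorem integral_fderiv_wedge {φ : Space → ℝ} (hφ : ContDiff ℝ 1 φ) (a b : Space) :
    ∫ η : Sph, fderiv ℝ φ η (wedge a b η) ∂surf = 0 := by
  set A := wedge a b with hA
  let _ : NormedAlgebra ℚ (Space →L[ℝ] Space) := NormedAlgebra.restrictScalars ℚ ℝ _
  let R : ℝ → Space →L[ℝ] Space := fun θ => NormedSpace.exp (θ • A)
  have hR : ∀ θ, HasDerivAt R (R θ * A) θ := fun θ => hasDerivAt_exp_smul_const A θ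
  have hRc : Continuous R := continuous_iff_continuousAt.2 fun θ => (hR θ).continuousAt
  have hconst : ∀ θ, ∫ η : Sph, φ (R θ η) ∂surf = ∫ η : Sph, φ η ∂surf := by
    -- The exponential of a skew-adjoint operator is unitary, so this is invariance under a
    -- rotation; differentiating at `θ = 0` gives the claim.
    intro θ
    have hu : R θ ∈ unitary (Space →L[ℝ] Space) :=
      NormedSpace.exp_mem_unitary_of_mem_skewAdjoint
        (skewAdjoint.smul_mem θ (wedge_mem_skewAdjoint a b))
    exact integral_surf_comp_isometry (Unitary.linearIsometryEquiv ⟨R θ, hu⟩) hφ.continuous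
  have hφ' : Continuous (fderiv ℝ φ) := hφ.continuous_fderiv one_ne_zero
  have hd : HasFDerivAt (fun θ : ℝ => ∫ η : Sph, φ (R θ η) ∂surf)
      (∫ η : Sph, ContinuousLinearMap.toSpanSingleton ℝ
        (fderiv ℝ φ (R 0 η) ((R 0 * A) η)) ∂surf) 0 := by
    refine hasFDerivAt_integral_of_continuousOn (U := univ) isOpen_univ
      (G := fun (θ : ℝ) (η : Sph) => φ (R θ η))
      (G' := fun (θ : ℝ) (η : Sph) => ContinuousLinearMap.toSpanSingleton ℝ
        (fderiv ℝ φ (R θ η) ((R θ * A) η))) ?_ ?_ ?_ (mem_univ _)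
    · intro θ _
      exact hφ.continuous.comp ((R θ).continuous.comp continuous_subtype_val)
    · refine Continuous.continuousOn ?_
      have h1 : Continuous fun q : ℝ × Sph => R q.1 (q.2 : Space) :=
        (hRc.comp continuous_fst).clm_apply (by fun_prop)
      have h2 : Continuous fun q : ℝ × Sph => (R q.1 * A) (q.2 : Space) :=
        ((hRc.comp continuous_fst).mul continuous_const).clm_apply (by fun_prop)
      have h3 := (hφ'.comp h1).clm_apply h2
      exact (ContinuousLinearMap.toSpanSingletonCLE (𝕜 := ℝ) (E := ℝ)).continuous.comp h3
    · intro θ _ η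
      have h1 : HasDerivAt (fun θ => R θ (η : Space)) ((R θ * A) η) θ := by
        have := (hR θ).clm_apply (hasDerivAt_const θ (η : Space))
        simpa using this
      have h2 : HasFDerivAt φ (fderiv ℝ φ (R θ η)) (R θ η) :=
        (hφ.differentiable one_ne_zero).differentiableAt.hasFDerivAt
      exact (h2.comp_hasDerivAt θ h1).hasFDerivAt
  have hz : HasFDerivAt (fun θ : ℝ => ∫ η : Sph, φ (R θ η) ∂surf) (0 : ℝ →L[ℝ] ℝ) 0 := by
    simp_rw [hconst]
    exact hasFDerivAt_const _ _
  have := congrArg (fun T : ℝ →L[ℝ] ℝ => T 1) (hd.unique hz)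
  simp only [zero_apply] at this
  rw [ContinuousLinearMap.integral_apply] at this
  · have h0 : R 0 = 1 := by
      change NormedSpace.exp ((0 : ℝ) • A) = 1
      rw [show (0 : ℝ) • A = 0 from zero_smul ℝ A]
      exact NormedSpace.exp_zero
    simpa [h0] using this
  · refine integrable_of_continuous ?_
    have h3 : Continuous fun η : Sph => fderiv ℝ φ (R 0 η) ((R 0 * A) η) :=
      (hφ'.comp (by fun_prop)).clm_apply (by fun_prop)
    exact (ContinuousLinearMap.toSpanSingletonCLE (𝕜 := ℝ) (E := ℝ)).continuous.comp h3

/-! ### Spherical means and the Darboux equation -/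

/-- The standard basis of `ℝ³`. -/
def bas (i : Fin 3) : Space := EuclideanSpace.single i 1

theorem sum_smul_bas (v : Space) : v = ∑ i, v i • bas i := by
  ext j
  simp [bas, Fin.sum_univ_three]
  fin_cases j <;> simp

theorem inner_bas (i : Fin 3) (v : Space) : inner ℝ (bas i) v = v i := by
  simp [bas, EuclideanSpace.inner_single_left]

theorem clm_eq_sum (ℓ : Space →L[ℝ] ℝ) (v : Space) : ℓ v = ∑ i, v i * ℓ (bas i) := by
  conv_lhs => rw [sum_smul_bas v]
  simp

theorem bilin_eq_sum (B : Space →L[ℝ] Space →L[ℝ] ℝ) (u v : Space) :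
    B u v = ∑ i, ∑ j, u i * v j * B (bas i) (bas j) := by
  conv_lhs => rw [sum_smul_bas u]
  simp only [map_sum, map_smul, sum_apply, smul_apply,
    smul_eq_mul]
  refine Finset.sum_congr rfl fun i _ => ?_
  rw [clm_eq_sum, Finset.mul_sum]
  exact Finset.sum_congr rfl fun j _ => by ring

theorem sum_sq_sph (η : Sph) : (η : Space) 0 ^ 2 + (η : Space) 1 ^ 2 + (η : Space) 2 ^ 2 = 1 := by
  have h := EuclideanSpace.norm_sq_eq (η : Space)
  rw [norm_coe_sph, Fin.sum_univ_three] at h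
  simp only [Real.norm_eq_abs, sq_abs] at h
  linarith

/-- With `A` running over the three coordinate rotation generators (indices cyclic in `Fin 3`), `∑
A² = -2` and `∑ Aη ⊗ Aη = |η|² - η ⊗ η`. Thus the squares of the rotation fields add up to the
Laplace–Beltrami operator of the sphere, written in ambient derivatives. -/
theorem wedge_identity (B : Space →L[ℝ] Space →L[ℝ] ℝ) (ℓ : Space →L[ℝ] ℝ) (η : Sph) :
    ∑ i, (B (wedge (bas i) (bas (i + 1)) η) (wedge (bas i) (bas (i + 1)) η)
      + ℓ (wedge (bas i) (bas (i + 1)) (wedge (bas i) (bas (i + 1)) η)))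
    = ∑ i, B (bas i) (bas i) - B η η - 2 * ℓ η := by
  have hs := sum_sq_sph η
  have hB := bilin_eq_sum B η η
  have hl := clm_eq_sum ℓ η
  have b0 : (∀ i j : Fin 3, bas i j = if j = i then 1 else 0) := by
    intro i j; simp [bas]
  rw [hB, hl]
  have i1 : (1 + 1 : Fin 3) = 2 := rfl
  have i2 : (2 + 1 : Fin 3) = 0 := rfl
  simp only [Fin.sum_univ_three, wedge_apply, inner_bas, map_sub, map_smul,
    sub_apply, smul_apply, smul_eq_mul, b0, i1, i2]
  norm_num [Fin.ext_iff]
  linear_combination (B (bas 0) (bas 0) + B (bas 1) (bas 1) + B (bas 2) (bas 2)) * hs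

theorem contDiff_fderiv_apply {φ : Space → ℝ} (hφ : ContDiff ℝ 2 φ) (A : Space →L[ℝ] Space) :
    ContDiff ℝ 1 fun y => fderiv ℝ φ y (A y) :=
  (hφ.fderiv_right (m := 1) (by norm_num)).clm_apply A.contDiff

theorem integral_sphere_laplace {φ : Space → ℝ} (hφ : ContDiff ℝ 2 φ) :
    ∫ η : Sph, (∑ i, fderiv ℝ (fderiv ℝ φ) η (bas i) (bas i) - fderiv ℝ (fderiv ℝ φ) η η η
      - 2 * fderiv ℝ φ η η) ∂surf = 0 := by
  have h1 : ContDiff ℝ 1 (fderiv ℝ φ) := hφ.fderiv_right (m := 1) (by norm_num)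
  have hint : ∀ i : Fin 3, Integrable (fun η : Sph =>
      fderiv ℝ (fun y => fderiv ℝ φ y (wedge (bas i) (bas (i + 1)) y)) η
        (wedge (bas i) (bas (i + 1)) η)) surf := by
    intro i
    refine integrable_of_continuous (Continuous.clm_apply ?_ (by fun_prop))
    exact ((contDiff_fderiv_apply hφ _).continuous_fderiv one_ne_zero).comp continuous_subtype_val
  have h0 : ∫ η : Sph, ∑ i : Fin 3,
      fderiv ℝ (fun y => fderiv ℝ φ y (wedge (bas i) (bas (i + 1)) y)) η
        (wedge (bas i) (bas (i + 1)) η) ∂surf = 0 := by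
    rw [integral_finsetSum _ fun i _ => hint i]
    exact Finset.sum_eq_zero fun i _ =>
      integral_fderiv_wedge (contDiff_fderiv_apply hφ _) (bas i) (bas (i + 1))
  rw [← h0]
  congr 1
  ext η
  -- Differentiating `Dφ(y)(Ay)` along `Ay` gives `D²φ(Ay, Ay) + Dφ(A²y)`, the summand of
  -- `wedge_identity`.
  rw [← wedge_identity]
  refine Finset.sum_congr rfl fun i _ => ?_
  have hd : HasFDerivAt (fderiv ℝ φ) (fderiv ℝ (fderiv ℝ φ) η) (η : Space) :=
    (h1.differentiable one_ne_zero).differentiableAt.hasFDerivAt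
  rw [(hd.clm_apply (wedge (bas i) (bas (i + 1))).hasFDerivAt).fderiv]
  simp [add_comm]

/-- The Euler–Poisson–Darboux identity in integrated form. -/
theorem integral_sphere_darboux {h : Space → ℝ} (hh : ContDiff ℝ 2 h) (x : Space) (t : ℝ) :
    ∫ η : Sph, (t ^ 2 * ∑ i, fderiv ℝ (fderiv ℝ h) (x + t • (η : Space)) (bas i) (bas i)
      - t ^ 2 * fderiv ℝ (fderiv ℝ h) (x + t • (η : Space)) η η
      - 2 * t * fderiv ℝ h (x + t • (η : Space)) η) ∂surf = 0 := by
  have hφ : ContDiff ℝ 2 fun y => h (x + t • y) := by fun_prop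
  have hL : ∀ y : Space, HasFDerivAt (fun y : Space => x + t • y)
      (t • ContinuousLinearMap.id ℝ Space) y := fun y =>
    ((hasFDerivAt_id y).const_smul t).const_add x
  have h1 : ContDiff ℝ 1 (fderiv ℝ h) := hh.fderiv_right (m := 1) (by norm_num)
  have e1 : (fderiv ℝ fun y => h (x + t • y)) = fun y => t • fderiv ℝ h (x + t • y) := by
    ext1 y
    have := ((hh.differentiable two_ne_zero).differentiableAt.hasFDerivAt (x := x + t • y)).comp y
      (hL y)
    refine (HasFDerivAt.fderiv this).trans ?_
    ext v; simp
  have e2 : ∀ y, fderiv ℝ (fun y => t • fderiv ℝ h (x + t • y)) y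
      = t ^ 2 • fderiv ℝ (fderiv ℝ h) (x + t • y) := by
    intro y
    have := (((h1.differentiable one_ne_zero).differentiableAt.hasFDerivAt
      (x := x + t • y)).comp y (hL y)).const_smul t
    refine (HasFDerivAt.fderiv this).trans ?_
    ext u v; simp; ring
  have := integral_sphere_laplace hφ
  rw [e1] at this
  simp only [e2] at this
  rw [← this]
  congr 1
  ext η
  simp [Finset.mul_sum]
  ring

/-! ### Spherical means of radial functions -/

theorem abs_inner_sph_le {e : Space} (he : ‖e‖ = 1) (η : Sph) : |inner ℝ e (η : Space)| ≤ 1 := by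
  simpa [he, norm_coe_sph] using abs_real_inner_le_norm e (η : Space)

/-- Rotate `⟨e, y⟩^n y_i` in the plane of `bas i` and `e`, and sum over `i`. With `z = ⟨e, η⟩` and
`|η| = 1` the derivatives add up to `n z^(n-1) (1 - z²) - 2 z^(n+1)`. -/
theorem integral_inner_pow_rec {e : Space} (he : ‖e‖ = 1) (n : ℕ) :
    ∫ η : Sph, (n * inner ℝ e (η : Space) ^ (n - 1)
      - (n + 2) * inner ℝ e (η : Space) ^ (n + 1)) ∂surf = 0 := by
  have hC : ∀ i : Fin 3, ContDiff ℝ 1 fun y : Space => inner ℝ e y ^ n * inner ℝ (bas i) y := by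
    intro i
    exact ((innerSL ℝ e).contDiff.pow n).mul (innerSL ℝ (bas i)).contDiff
  have hsum : ∫ η : Sph, ∑ i : Fin 3,
      fderiv ℝ (fun y : Space => inner ℝ e y ^ n * inner ℝ (bas i) y) η (wedge (bas i) e η) ∂surf
      = 0 := by
    rw [integral_finsetSum]
    · exact Finset.sum_eq_zero fun i _ => integral_fderiv_wedge (hC i) (bas i) e
    · intro i _
      refine integrable_of_continuous (Continuous.clm_apply ?_ (by fun_prop))
      exact ((hC i).continuous_fderiv one_ne_zero).comp continuous_subtype_val
  rw [← hsum]
  congr 1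
  ext η
  have hd : ∀ i : Fin 3, HasFDerivAt (fun y : Space => inner ℝ e y ^ n * inner ℝ (bas i) y) _
      (η : Space) := fun i =>
    (((innerSL ℝ e).hasFDerivAt (x := (η : Space))).pow n).mul
      ((innerSL ℝ (bas i)).hasFDerivAt (x := (η : Space)))
  simp_rw [fun i => (hd i).fderiv]
  have hz : inner ℝ e (η : Space) = e 0 * (η : Space) 0 + e 1 * (η : Space) 1
      + e 2 * (η : Space) 2 := by
    simp [PiLp.inner_apply, Fin.sum_univ_three, mul_comm]
  have he' : inner ℝ e e = 1 := by rw [real_inner_self_eq_norm_sq, he]; norm_num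
  have hs := sum_sq_sph η
  have hb : ∀ i, inner ℝ e (bas i) = e i := fun i => by rw [real_inner_comm, inner_bas]
  have hbb : ∀ i j : Fin 3, bas i j = if j = i then 1 else 0 := by
    intro i j; simp [bas]
  simp only [innerSL_apply_apply, add_apply, smul_apply, wedge_apply, inner_sub_right,
    inner_smul_right, inner_bas, hb, hbb, he', Fin.sum_univ_three, smul_eq_mul]
  rcases n with _ | n
  · simp
    linear_combination (1 : ℝ) * hz
  · push_cast
    simp
    set z := inner ℝ e (η : Space)
    linear_combination (-(n + 1) * z ^ n) * hs + (n * z ^ (n + 1)) * (- hz)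

/-- Both sides satisfy the same two-step recursion, so the zeroth and first moments decide. -/
theorem integral_inner_pow {e : Space} (he : ‖e‖ = 1) : ∀ n : ℕ,
    ∫ η : Sph, inner ℝ e (η : Space) ^ n ∂surf = 2 * Real.pi * ∫ z in (-1 : ℝ)..1, z ^ n
  | 0 => by
    have := surf_real_univ
    simp [this]; ring
  | 1 => by
    have h := integral_inner_pow_rec he 0
    simp only [Nat.cast_zero, zero_mul, zero_sub, zero_add, integral_neg, integral_const_mul] at h
    simp at h ⊢
    exact h
  | n + 2 => by
    have h := integral_inner_pow_rec he (n + 1)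
    have hi : ∀ m : ℕ, ∀ c : ℝ, Integrable (fun η : Sph => c * inner ℝ e (η : Space) ^ m) surf :=
      fun m c => integrable_of_continuous (by fun_prop)
    rw [integral_sub (hi _ _) (hi _ _), integral_const_mul, integral_const_mul,
      Nat.add_sub_cancel, integral_inner_pow he n] at h
    rw [integral_pow] at h ⊢
    have h3 : ((n + 1 : ℕ) + 2 : ℝ) ≠ 0 := by positivity
    have h1 : (n + 1 : ℝ) ≠ 0 := by positivity
    refine mul_left_cancel₀ h3 ?_
    rw [← sub_eq_zero.1 h]
    push_cast
    have h4 : ((n : ℝ) + 2 + 1) ≠ 0 := by positivity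
    field_simp
    ring

theorem integral_inner_polynomial {e : Space} (he : ‖e‖ = 1) (P : Polynomial ℝ) :
    ∫ η : Sph, P.eval (inner ℝ e (η : Space)) ∂surf
      = 2 * Real.pi * ∫ z in (-1 : ℝ)..1, P.eval z := by
  induction P using Polynomial.induction_on' with
  | add P Q hP hQ =>
    simp only [Polynomial.eval_add]
    rw [integral_add, intervalIntegral.integral_add, hP, hQ]
    · ring
    · exact P.continuous.intervalIntegrable _ _
    · exact Q.continuous.intervalIntegrable _ _
    · exact integrable_of_continuous (by fun_prop)
    · exact integrable_of_continuous (by fun_prop)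
  | monomial n a =>
    simp only [Polynomial.eval_monomial]
    rw [integral_const_mul, intervalIntegral.integral_const_mul, integral_inner_pow he]
    ring

/-- Archimedes' hat-box theorem for continuous functions. -/
theorem integral_inner_continuous {e : Space} (he : ‖e‖ = 1) {φ : ℝ → ℝ} (hφ : Continuous φ) :
    ∫ η : Sph, φ (inner ℝ e (η : Space)) ∂surf = 2 * Real.pi * ∫ z in (-1 : ℝ)..1, φ z := by
  -- Weierstrass approximation within `δ`: the sphere costs `4πδ` and the interval `2π · 2δ`.
  have key : ∀ δ : ℝ, 0 < δ → |∫ η : Sph, φ (inner ℝ e (η : Space)) ∂surf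
      - 2 * Real.pi * ∫ z in (-1 : ℝ)..1, φ z| ≤ 8 * Real.pi * δ := by
    intro δ hδ
    obtain ⟨P, hP⟩ := exists_polynomial_near_of_continuousOn (-1) 1 φ hφ.continuousOn δ hδ
    have e1 : |∫ η : Sph, φ (inner ℝ e (η : Space)) ∂surf
        - ∫ η : Sph, P.eval (inner ℝ e (η : Space)) ∂surf| ≤ 4 * Real.pi * δ := by
      rw [← integral_sub (integrable_of_continuous (by fun_prop))
        (integrable_of_continuous (by fun_prop)), ← Real.norm_eq_abs]
      refine (norm_integral_le_of_norm_le_const (C := δ) (ae_of_all _ fun η => ?_)).trans ?_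
      · rw [Real.norm_eq_abs, abs_sub_comm]
        exact (hP _ (by simpa [abs_le] using abs_inner_sph_le he η)).le
      · rw [surf_real_univ]; linarith
    have e2 : |(∫ z in (-1 : ℝ)..1, φ z) - ∫ z in (-1 : ℝ)..1, P.eval z| ≤ 2 * δ := by
      rw [← intervalIntegral.integral_sub (hφ.intervalIntegrable _ _)
        (P.continuous.intervalIntegrable _ _), ← Real.norm_eq_abs]
      refine (intervalIntegral.norm_integral_le_of_norm_le_const (C := δ) fun z hz => ?_).trans ?_
      · rw [uIoc_of_le (by norm_num)] at hz
        rw [Real.norm_eq_abs, abs_sub_comm]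
        exact (hP _ ⟨hz.1.le, hz.2⟩).le
      · norm_num; linarith
    rw [integral_inner_polynomial he] at e1
    have hpi := Real.pi_pos
    have e3 : |2 * Real.pi * ((∫ z in (-1 : ℝ)..1, P.eval z) - ∫ z in (-1 : ℝ)..1, φ z)|
        ≤ 2 * Real.pi * (2 * δ) := by
      rw [abs_mul, abs_of_pos (by positivity : 0 < 2 * Real.pi), abs_sub_comm]
      exact mul_le_mul_of_nonneg_left e2 (by positivity)
    have := abs_add_le (∫ η : Sph, φ (inner ℝ e (η : Space)) ∂surf
        - 2 * Real.pi * ∫ z in (-1 : ℝ)..1, P.eval z)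
      (2 * Real.pi * ((∫ z in (-1 : ℝ)..1, P.eval z) - ∫ z in (-1 : ℝ)..1, φ z))
    refine (le_of_eq ?_).trans (this.trans ((add_le_add e1 e3).trans (by linarith)))
    congr 1; ring
  refine eq_of_abs_sub_nonpos (le_of_forall_pos_le_add fun δ hδ => ?_)
  have hpi := Real.pi_pos
  refine (key (δ / (8 * Real.pi)) (by positivity)).trans (le_of_eq ?_)
  field_simp
  ring

/-- Finite measures are determined by integrals of bounded continuous functions. Stated for
measures, the hat-box theorem becomes available for all nonnegative measurable functions. -/
theorem map_inner_surf {e : Space} (he : ‖e‖ = 1) :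
    Measure.map (fun η : Sph => inner ℝ e (η : Space)) surf
      = ENNReal.ofReal (2 * Real.pi) • volume.restrict (Icc (-1 : ℝ) 1) := by
  have hc : Continuous fun η : Sph => inner ℝ e (η : Space) := by fun_prop
  have : IsFiniteMeasure (ENNReal.ofReal (2 * Real.pi) • volume.restrict (Icc (-1 : ℝ) 1)) :=
    Measure.smul_finite _ ENNReal.ofReal_ne_top
  refine ext_of_forall_integral_eq_of_IsFiniteMeasure fun φ => ?_
  rw [integral_map hc.measurable.aemeasurable φ.continuous.aestronglyMeasurable,
    integral_inner_continuous he φ.continuous, integral_smul_measure,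
    intervalIntegral.integral_of_le (by norm_num), integral_Icc_eq_integral_Ioc,
    ENNReal.toReal_ofReal (by positivity), smul_eq_mul]

theorem lintegral_inner {e : Space} (he : ‖e‖ = 1) {φ : ℝ → ENNReal} (hφ : Measurable φ) :
    ∫⁻ η : Sph, φ (inner ℝ e (η : Space)) ∂surf
      = ENNReal.ofReal (2 * Real.pi) * ∫⁻ z in Icc (-1 : ℝ) 1, φ z := by
  have hc : Continuous fun η : Sph => inner ℝ e (η : Space) := by fun_prop
  rw [← lintegral_map hφ hc.measurable, map_inner_surf he, lintegral_smul_measure, smul_eq_mul]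

/-- John's formula for the spherical mean of a radial function. -/
theorem lintegral_sphere_radial {x : Space} (hx : x ≠ 0) {τ : ℝ} (hτ : 0 < τ)
    {W : ℝ → ENNReal} (hW : Measurable W) :
    ∫⁻ η : Sph, W ‖x + τ • (η : Space)‖ ∂surf
      = ENNReal.ofReal (2 * Real.pi / (‖x‖ * τ)) *
        ∫⁻ l in Icc |‖x‖ - τ| (‖x‖ + τ), ENNReal.ofReal l * W l := by
  set r := ‖x‖ with hr
  have hr0 : 0 < r := norm_pos_iff.2 hx
  set e : Space := r⁻¹ • x with hedef
  have he : ‖e‖ = 1 := by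
    rw [hedef, norm_smul, norm_inv, norm_norm]
    exact inv_mul_cancel₀ hr0.ne'
  have hxe : x = r • e := by rw [hedef, smul_smul, mul_inv_cancel₀ hr0.ne', one_smul]
  have hn : ∀ η : Sph, ‖x + τ • (η : Space)‖
      = √(r ^ 2 + τ ^ 2 + 2 * (r * τ) * inner ℝ e (η : Space)) := by
    intro η
    have h1 : ‖x + τ • (η : Space)‖ ^ 2 = r ^ 2 + τ ^ 2 + 2 * (r * τ) * inner ℝ e (η : Space) := by
      rw [norm_add_sq_real, inner_smul_right, norm_smul, norm_coe_sph, ← hr]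
      nth_rewrite 1 [hxe]
      rw [real_inner_smul_left, mul_one, Real.norm_eq_abs, sq_abs]
      ring
    rw [← h1, Real.sqrt_sq (norm_nonneg _)]
  simp_rw [hn]
  rw [lintegral_inner he (φ := fun z => W (√(r ^ 2 + τ ^ 2 + 2 * (r * τ) * z)))
    (hW.comp (by fun_prop))]
  -- Law of cosines: `l² = r² + τ² + 2rτz`, so `dz = l dl / (rτ)`, and `z ∈ [-1, 1]` corresponds to
  -- `l ∈ [|r - τ|, r + τ]`.
  have himg : (fun l : ℝ => (l ^ 2 - r ^ 2 - τ ^ 2) / (2 * (r * τ))) '' Icc |r - τ| (r + τ)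
      = Icc (-1) 1 := by
    ext z
    simp only [mem_image, mem_Icc]
    have hp : 0 < 2 * (r * τ) := by positivity
    constructor
    · rintro ⟨l, ⟨h1, h2⟩, rfl⟩
      have h0 : 0 ≤ l := (abs_nonneg _).trans h1
      have h3 : (r - τ) ^ 2 ≤ l ^ 2 := by
        rw [← sq_abs]; exact pow_le_pow_left₀ (abs_nonneg _) h1 2
      have h4 : l ^ 2 ≤ (r + τ) ^ 2 := pow_le_pow_left₀ h0 h2 2
      rw [le_div_iff₀ hp, div_le_iff₀ hp]
      constructor <;> nlinarith
    · rintro ⟨h1, h2⟩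
      have ha : (r - τ) ^ 2 ≤ r ^ 2 + τ ^ 2 + 2 * (r * τ) * z := by nlinarith
      have hb : r ^ 2 + τ ^ 2 + 2 * (r * τ) * z ≤ (r + τ) ^ 2 := by nlinarith
      refine ⟨√(r ^ 2 + τ ^ 2 + 2 * (r * τ) * z), ⟨Real.abs_le_sqrt ha, ?_⟩, ?_⟩
      · exact Real.sqrt_le_iff.2 ⟨by positivity, hb⟩
      · rw [Real.sq_sqrt ((sq_nonneg _).trans ha)]
        field_simp
        ring
  have hpp : 0 < r * τ := by positivity
  rw [← himg, lintegral_image_eq_lintegral_abs_deriv_mul (f' := fun l => l / (r * τ))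
    measurableSet_Icc]
  · rw [← lintegral_const_mul _ (by fun_prop), ← lintegral_const_mul _ (by fun_prop)]
    refine setLIntegral_congr_fun measurableSet_Icc fun l hl => ?_
    have hl0 : 0 ≤ l := (abs_nonneg _).trans hl.1
    have hsq : √(r ^ 2 + τ ^ 2 + 2 * (r * τ) * ((l ^ 2 - r ^ 2 - τ ^ 2) / (2 * (r * τ)))) = l := by
      rw [mul_div_cancel₀ _ (by positivity)]
      rw [show r ^ 2 + τ ^ 2 + (l ^ 2 - r ^ 2 - τ ^ 2) = l ^ 2 by ring, Real.sqrt_sq hl0]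
    simp only [hsq]
    rw [← mul_assoc, ← mul_assoc, ← ENNReal.ofReal_mul (by positivity),
      ← ENNReal.ofReal_mul (by positivity), abs_of_nonneg (by positivity)]
    congr 2
    field_simp
  · intro l _
    have : HasDerivAt (fun l : ℝ => (l ^ 2 - r ^ 2 - τ ^ 2) / (2 * (r * τ)))
        ((2 * l) / (2 * (r * τ))) l := by
      have h := (((hasDerivAt_pow 2 l).sub_const (r ^ 2)).sub_const (τ ^ 2)).div_const
        (2 * (r * τ))
      simpa using h
    rw [mul_div_mul_left _ _ two_ne_zero] at this
    exact this.hasDerivWithinAt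
  · intro a ha b hb hab
    have ha0 : 0 ≤ a := (abs_nonneg _).trans ha.1
    have hb0 : 0 ≤ b := (abs_nonneg _).trans hb.1
    have h2 : a ^ 2 = b ^ 2 := by
      have := (div_left_inj' (by positivity : 2 * (r * τ) ≠ 0)).1 hab
      linarith
    exact (pow_left_inj₀ ha0 hb0 two_ne_zero).1 h2

/-! ### Integration along characteristics -/

section Slices

variable {V W : Type*} [NormedAddCommGroup V] [NormedSpace ℝ V] [NormedAddCommGroup W]
  [NormedSpace ℝ W]

theorem eventually_fderiv_slice {F : W → ℝ} {a : W} {ι : V →L[ℝ] W} {y : V}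
    (hF : ContDiffAt ℝ 2 F (a + ι y)) :
    ∀ᶠ y' in 𝓝 y, HasFDerivAt (fun y => F (a + ι y)) ((fderiv ℝ F (a + ι y')).comp ι) y' := by
  have hc : Tendsto (fun y => a + ι y) (𝓝 y) (𝓝 (a + ι y)) :=
    (by fun_prop : Continuous fun y => a + ι y).tendsto y
  have h1 : ∀ᶠ z in 𝓝 (a + ι y), DifferentiableAt ℝ F z := by
    filter_upwards [hF.eventually (by simp)] with z hz
    exact hz.differentiableAt two_ne_zero
  filter_upwards [hc.eventually h1] with y' hy'
  exact hy'.hasFDerivAt.comp y' (ι.hasFDerivAt.const_add a)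

theorem hasFDerivAt_fderiv_slice {F : W → ℝ} {a : W} {ι : V →L[ℝ] W} {y : V}
    (hF : ContDiffAt ℝ 2 F (a + ι y)) (u v : V) :
    fderiv ℝ (fderiv ℝ fun y => F (a + ι y)) y u v
      = fderiv ℝ (fderiv ℝ F) (a + ι y) (ι u) (ι v) := by
  have hev : (fderiv ℝ fun y => F (a + ι y)) =ᶠ[𝓝 y] fun y' => (fderiv ℝ F (a + ι y')).comp ι := by
    filter_upwards [eventually_fderiv_slice hF] with y' hy' using hy'.fderiv
  rw [hev.fderiv_eq]
  have h1 : DifferentiableAt ℝ (fderiv ℝ F) (a + ι y) :=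
    (hF.fderiv_right (m := 1) (by norm_num)).differentiableAt one_ne_zero
  have h2 : HasFDerivAt (fun y' => fderiv ℝ F (a + ι y'))
      ((fderiv ℝ (fderiv ℝ F) (a + ι y)).comp ι) y :=
    h1.hasFDerivAt.comp y (ι.hasFDerivAt.const_add a)
  rw [(h2.clm_comp (hasFDerivAt_const ι y)).fderiv]
  simp

end Slices

theorem iteratedDeriv_two_time {F : Space × ℝ → ℝ} {x : Space} {t : ℝ}
    (hF : ContDiffAt ℝ 2 F (x, t)) :
    iteratedDeriv 2 (fun s => F (x, s)) t = fderiv ℝ (fderiv ℝ F) (x, t) (0, 1) (0, 1) := by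
  have e : ∀ s : ℝ, ((x, 0) : Space × ℝ) + ContinuousLinearMap.inr ℝ Space ℝ s = (x, s) := by
    intro s; simp
  have h := hasFDerivAt_fderiv_slice (a := ((x, 0) : Space × ℝ))
    (ι := ContinuousLinearMap.inr ℝ Space ℝ) (y := t) (by rw [e]; exact hF) 1 1
  simp only [e] at h
  rw [iteratedDeriv_eq_iteratedFDeriv, iteratedFDeriv_two_apply]
  simpa using h

theorem laplacian_space {F : Space × ℝ → ℝ} {x : Space} {t : ℝ}
    (hF : ContDiffAt ℝ 2 F (x, t)) :
    Laplacian.laplacian (fun y => F (y, t)) x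
      = ∑ i, fderiv ℝ (fderiv ℝ F) (x, t) (bas i, 0) (bas i, 0) := by
  have e : ∀ y : Space, ((0, t) : Space × ℝ) + ContinuousLinearMap.inl ℝ Space ℝ y = (y, t) := by
    intro s; simp
  have h := fun u => hasFDerivAt_fderiv_slice (a := ((0, t) : Space × ℝ))
    (ι := ContinuousLinearMap.inl ℝ Space ℝ) (y := x) (by rw [e]; exact hF) u u
  simp only [e] at h
  rw [InnerProductSpace.laplacian_eq_iteratedFDeriv_orthonormalBasis _
    (EuclideanSpace.basisFun (Fin 3) ℝ)]
  refine Finset.sum_congr rfl fun i _ => ?_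
  rw [iteratedFDeriv_two_apply]
  simpa [bas] using h (bas i)

/-- The closed half space `ℝ³ × [0, ∞)`. -/
abbrev halfSpace : Set (Space × ℝ) := univ ×ˢ Ici (0 : ℝ)

theorem uniqueDiffOn_halfSpace : UniqueDiffOn ℝ halfSpace :=
  uniqueDiffOn_univ.prod (uniqueDiffOn_Ici 0)

theorem halfSpace_mem_nhds {z : Space × ℝ} (hz : 0 < z.2) : halfSpace ∈ 𝓝 z :=
  prod_mem_nhds univ_mem (Ici_mem_nhds hz)

/-- The function whose spherical integral is constant along backward characteristics. -/
def charIntegrand (F : Space × ℝ → ℝ) (x : Space) (T s : ℝ) (η : Sph) : ℝ :=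
  F (x + (T - s) • (η : Space), s)
    + (T - s) * fderivWithin ℝ F halfSpace (x + (T - s) • (η : Space), s) ((η : Space), 1)

/-- Continuity down to `s = 0` is where the derivative within the half space matters: the mean value
theorem can then be applied on the closed interval although the wave equation is differentiated only
for `s > 0`. -/
theorem continuousOn_integral_charIntegrand {F : Space × ℝ → ℝ} (hF : ContDiffOn ℝ 2 F halfSpace)
    (x : Space) (T : ℝ) :
    ContinuousOn (fun s => ∫ η, charIntegrand F x T s η ∂surf) (Ici 0) := by
  rw [continuousOn_iff_continuous_domRestrict]
  refine continuous_integral_of_continuous (G := fun (s : Ici (0 : ℝ)) η =>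
    charIntegrand F x T s η) ?_
  have hz : Continuous fun q : Ici (0 : ℝ) × Sph =>
      ((x + (T - q.1) • (q.2 : Space), (q.1 : ℝ)) : Space × ℝ) := by fun_prop
  have hm : ∀ q : Ici (0 : ℝ) × Sph,
      ((x + (T - q.1) • (q.2 : Space), (q.1 : ℝ)) : Space × ℝ) ∈ halfSpace :=
    fun q => ⟨mem_univ _, q.1.2⟩
  have hD : ContinuousOn (fderivWithin ℝ F halfSpace) halfSpace :=
    hF.continuousOn_fderivWithin uniqueDiffOn_halfSpace (by norm_num)
  refine Continuous.add (hF.continuousOn.comp_continuous hz hm) (Continuous.mul (by fun_prop) ?_)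
  exact (hD.comp_continuous hz hm).clm_apply (by fun_prop)

/-- Once `F_tt` is replaced by `ΔF`, the derivative in `s` of the integrand, multiplied by `T - s`,
is exactly the Darboux integrand on the sphere of radius `T - s`. -/
theorem hasDerivAt_integral_charIntegrand {F : Space × ℝ → ℝ} (hF : ContDiffOn ℝ 2 F halfSpace)
    (hw : ∀ (x : Space) (t : ℝ), 0 < t → fderiv ℝ (fderiv ℝ F) (x, t) (0, 1) (0, 1)
      = ∑ i, fderiv ℝ (fderiv ℝ F) (x, t) (bas i, 0) (bas i, 0))
    (x : Space) {T s : ℝ} (hs : s ∈ Ioo 0 T) :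
    HasDerivAt (fun s => ∫ η, charIntegrand F x T s η ∂surf) 0 s := by
  have hU : IsOpen (univ ×ˢ Ioi 0 : Set (Space × ℝ)) := isOpen_univ.prod isOpen_Ioi
  have hFU : ContDiffOn ℝ 2 F (univ ×ˢ Ioi 0) := hF.mono (prod_mono_right Ioi_subset_Ici_self)
  have hat : ∀ z : Space × ℝ, 0 < z.2 → ContDiffAt ℝ 2 F z := fun z hz =>
    hF.contDiffAt (halfSpace_mem_nhds hz)
  have hDeq : ∀ z : Space × ℝ, 0 < z.2 → fderivWithin ℝ F halfSpace z = fderiv ℝ F z := fun z hz =>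
    fderivWithin_of_mem_nhds (halfSpace_mem_nhds hz)
  have hDC : ContDiffOn ℝ 1 (fderiv ℝ F) (univ ×ˢ Ioi 0) :=
    hFU.fderiv_of_isOpen hU (by norm_num)
  have hD2C : ContinuousOn (fderiv ℝ (fderiv ℝ F)) (univ ×ˢ Ioi 0) :=
    hDC.continuousOn_fderiv_of_isOpen hU le_rfl
  let g' : ℝ → Sph → ℝ := fun s η =>
    fderiv ℝ F (x + (T - s) • (η : Space), s) (-(η : Space), 1)
    + (-1 * fderiv ℝ F (x + (T - s) • (η : Space), s) ((η : Space), 1)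
    + (T - s) * fderiv ℝ (fderiv ℝ F) (x + (T - s) • (η : Space), s) (-(η : Space), 1)
      ((η : Space), 1))
  have hzc : ContinuousOn (fun q : ℝ × Sph => ((x + (T - q.1) • (q.2 : Space), q.1) : Space × ℝ))
      (Ioo 0 T ×ˢ univ) := by
    refine Continuous.continuousOn ?_; fun_prop
  have hzm : MapsTo (fun q : ℝ × Sph => ((x + (T - q.1) • (q.2 : Space), q.1) : Space × ℝ))
      (Ioo 0 T ×ˢ univ) (univ ×ˢ Ioi 0) := fun q hq => ⟨mem_univ _, hq.1.1⟩
  have hg'c : ContinuousOn (Function.uncurry g') (Ioo 0 T ×ˢ univ) := by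
    have c1 := hDC.continuousOn.comp hzc hzm
    have c2 := hD2C.comp hzc hzm
    refine ContinuousOn.add (c1.clm_apply (by fun_prop)) (ContinuousOn.add
      (continuousOn_const.mul (c1.clm_apply (by fun_prop))) (ContinuousOn.mul (by fun_prop) ?_))
    exact (c2.clm_apply (by fun_prop)).clm_apply (by fun_prop)
  have hder := hasFDerivAt_integral_of_continuousOn (μ := surf) isOpen_Ioo
    (G := fun s η => charIntegrand F x T s η)
    (G' := fun s η => ContinuousLinearMap.toSpanSingleton ℝ (g' s η)) ?_ ?_ ?_ hs
  rotate_left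
  · intro s hs
    have hz : Continuous fun η : Sph => ((x + (T - s) • (η : Space), s) : Space × ℝ) := by fun_prop
    refine Continuous.add (hF.continuousOn.comp_continuous hz fun η => ⟨mem_univ _, hs.1.le⟩)
      (Continuous.mul (by fun_prop) ?_)
    have hD : ContinuousOn (fderivWithin ℝ F halfSpace) halfSpace :=
      hF.continuousOn_fderivWithin uniqueDiffOn_halfSpace (by norm_num)
    exact (hD.comp_continuous hz fun η => ⟨mem_univ _, hs.1.le⟩).clm_apply (by fun_prop)
  · exact (ContinuousLinearMap.toSpanSingletonCLE (𝕜 := ℝ) (E := ℝ)).continuous.comp_continuousOn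
      hg'c
  · intro s hs η
    have hpos : 0 < s := hs.1
    refine HasDerivAt.hasFDerivAt (f' := g' s η) ?_
    have hz : HasDerivAt (fun s => ((x + (T - s) • (η : Space), s) : Space × ℝ))
        (-(η : Space), 1) s := by
      have h1 : HasDerivAt (fun s => x + (T - s) • (η : Space)) (-(η : Space)) s := by
        have := (((hasDerivAt_id s).const_sub T).smul_const (η : Space)).const_add x
        simpa using this
      exact h1.prodMk (hasDerivAt_id s)
    have hcong : (fun s => charIntegrand F x T s η) =ᶠ[𝓝 s] fun s =>
        F (x + (T - s) • (η : Space), s)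
          + (T - s) * fderiv ℝ F (x + (T - s) • (η : Space), s) ((η : Space), 1) := by
      filter_upwards [Ioi_mem_nhds hpos] with r hr
      simp only [charIntegrand]
      rw [hDeq (x + (T - r) • (η : Space), r) hr]
    refine HasDerivAt.congr_of_eventuallyEq ?_ hcong
    have d1 : HasFDerivAt F (fderiv ℝ F (x + (T - s) • (η : Space), s))
        (x + (T - s) • (η : Space), s) :=
      ((hat (x + (T - s) • (η : Space), s) hpos).differentiableAt two_ne_zero).hasFDerivAt
    have d2 : HasFDerivAt (fderiv ℝ F) (fderiv ℝ (fderiv ℝ F) (x + (T - s) • (η : Space), s))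
        (x + (T - s) • (η : Space), s) :=
      (((hat (x + (T - s) • (η : Space), s) hpos).fderiv_right (m := 1)
        (by norm_num)).differentiableAt one_ne_zero).hasFDerivAt
    have d3 := (HasFDerivAt.comp_hasDerivAt
      (f := fun s => ((x + (T - s) • (η : Space), s) : Space × ℝ)) s d2 hz).clm_apply (hasDerivAt_const s (((η : Space), 1) : Space × ℝ))
    have d4 := ((hasDerivAt_id s).const_sub T).mul d3
    have d5 := (HasFDerivAt.comp_hasDerivAt
      (f := fun s => ((x + (T - s) • (η : Space), s) : Space × ℝ)) s d1 hz).add d4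
    refine d5.congr_deriv ?_
    simp [g']
  have hzero : ∫ η, g' s η ∂surf = 0 := by
    have hρ : 0 < T - s := sub_pos.2 hs.2
    have hpos := hs.1
    have hslice : ContDiff ℝ 2 fun y : Space => F (y, s) := by
      refine contDiff_iff_contDiffAt.2 fun y => ?_
      exact (hat (y, s) hpos).comp y (by fun_prop)
    have e : ∀ y : Space, ((0, s) : Space × ℝ) + ContinuousLinearMap.inl ℝ Space ℝ y = (y, s) := by
      intro y; simp
    have hdar := integral_sphere_darboux hslice x (T - s)
    have f1 : ∀ y v, fderiv ℝ (fun y : Space => F (y, s)) y v = fderiv ℝ F (y, s) (v, 0) := by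
      intro y v
      have h := (eventually_fderiv_slice (a := ((0, s) : Space × ℝ))
        (ι := ContinuousLinearMap.inl ℝ Space ℝ) (y := y)
        (by rw [e]; exact hat _ hpos)).self_of_nhds
      simp only [e] at h
      rw [h.fderiv]; simp
    have f2 : ∀ y u v, fderiv ℝ (fderiv ℝ fun y : Space => F (y, s)) y u v
        = fderiv ℝ (fderiv ℝ F) (y, s) (u, 0) (v, 0) := by
      intro y u v
      have h := hasFDerivAt_fderiv_slice (a := ((0, s) : Space × ℝ))
        (ι := ContinuousLinearMap.inl ℝ Space ℝ) (y := y) (by rw [e]; exact hat _ hpos) u v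
      simp only [e] at h
      simpa only [ContinuousLinearMap.inl_apply] using h
    simp only [f1, f2] at hdar
    -- The mixed space-time second derivatives cancel by symmetry, and `hw` trades the second time
    -- derivative for the Laplacian.
    have key : ∀ η : Sph, (T - s) * g' s η =
        (T - s) ^ 2 * ∑ i, fderiv ℝ (fderiv ℝ F) (x + (T - s) • (η : Space), s) (bas i, 0) (bas i, 0)
        - (T - s) ^ 2 * fderiv ℝ (fderiv ℝ F) (x + (T - s) • (η : Space), s) (η, 0) (η, 0)
        - 2 * (T - s) * fderiv ℝ F (x + (T - s) • (η : Space), s) (η, 0) := by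
      intro η
      rw [← hw _ _ hpos]
      have hsym : fderiv ℝ (fderiv ℝ F) (x + (T - s) • (η : Space), s) ((η : Space), 0) (0, 1)
          = fderiv ℝ (fderiv ℝ F) (x + (T - s) • (η : Space), s) (0, 1) ((η : Space), 0) :=
        ((hat (x + (T - s) • (η : Space), s) hpos).isSymmSndFDerivAt (by simp)) _ _
      have s1 : ((-(η : Space), 1) : Space × ℝ) = -((η : Space), 0) + (0, 1) := by simp
      have s2 : (((η : Space), 1) : Space × ℝ) = ((η : Space), 0) + (0, 1) := by simp
      simp only [g']
      rw [s1, s2]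
      simp only [map_add, map_neg, add_apply, neg_apply]
      linear_combination (-(T - s) ^ 2) * hsym
    simp only [← key] at hdar
    rw [integral_const_mul] at hdar
    exact (mul_eq_zero.1 hdar).resolve_left hρ.ne'
  have hint : Integrable (fun η => ContinuousLinearMap.toSpanSingleton ℝ (g' s η)) surf := by
    refine integrable_of_continuous ?_
    refine (ContinuousLinearMap.toSpanSingletonCLE (𝕜 := ℝ) (E := ℝ)).continuous.comp ?_
    exact hg'c.comp_continuous (f := fun η : Sph => (s, η)) (by fun_prop)
      fun η => ⟨hs, mem_univ _⟩
  have := hder.hasDerivAt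
  rw [ContinuousLinearMap.integral_apply hint] at this
  simpa [hzero] using this

/-! ### Kirchhoff's formula -/

/-- Kirchhoff's formula for the solution of the wave equation with data `(f, f + g)`. -/
def kirchhoff (f g : Space → ℝ) (z : Space × ℝ) : ℝ :=
  1 / (4 * Real.pi) * ∫ η : Sph, (f (z.1 + z.2 • (η : Space))
    + z.2 * (fderiv ℝ f (z.1 + z.2 • (η : Space)) η
      + (f (z.1 + z.2 • (η : Space)) + g (z.1 + z.2 • (η : Space))))) ∂surf

theorem integral_surf_const (c : ℝ) : ∫ _ : Sph, c ∂surf = 4 * Real.pi * c := by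
  rw [integral_const, surf_real_univ, smul_eq_mul]

/-- The conserved spherical integral equals `4π u₀(x, t)` at the vertex `s = t` and is a Kirchhoff
integral of the data at `s = 0`. Since `IsSolution` allows any free wave with the given data,
uniqueness of the free wave is needed and is contained here. -/
theorem IsFreeWave.eq_kirchhoff {f g : Space → ℝ} (hf : ContDiff ℝ 1 f) {ε : ℝ}
    {u₀ : Space → ℝ → ℝ} (hu : IsFreeWave f g ε u₀) (x : Space) {t : ℝ} (ht : 0 ≤ t) :
    u₀ x t = ε * kirchhoff f g (x, t) := by
  have hpi := Real.pi_pos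
  set F : Space × ℝ → ℝ := fun z => u₀ z.1 z.2 with hFdef
  have hF : ContDiffOn ℝ 2 F halfSpace := hu.contDiffOn
  rcases ht.eq_or_lt with rfl | htpos
  · rw [hu.init]
    simp only [kirchhoff, zero_smul, add_zero, zero_mul]
    rw [integral_surf_const]
    field_simp
  have hw : ∀ (x : Space) (t : ℝ), 0 < t → fderiv ℝ (fderiv ℝ F) (x, t) (0, 1) (0, 1)
      = ∑ i, fderiv ℝ (fderiv ℝ F) (x, t) (bas i, 0) (bas i, 0) := by
    intro x t ht
    have hat : ContDiffAt ℝ 2 F (x, t) := hF.contDiffAt (halfSpace_mem_nhds (z := (x, t)) ht)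
    rw [← iteratedDeriv_two_time hat, ← laplacian_space hat]
    have h := hu.wave x t ht.le
    rw [iteratedDerivWithin_eq_iteratedDeriv (uniqueDiffOn_Ici 0)
      (show ContDiffAt ℝ 2 (u₀ x) t from
        hat.comp t (by fun_prop : ContDiffAt ℝ 2 (fun s => ((x, s) : Space × ℝ)) t)) ht.le] at h
    exact sub_eq_zero.1 h
  have hcont := (continuousOn_integral_charIntegrand hF x t).mono
    (Icc_subset_Ici_self : Icc 0 t ⊆ Ici 0)
  have hconst : (∫ η, charIntegrand F x t t η ∂surf) = ∫ η, charIntegrand F x t 0 η ∂surf := by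
    obtain ⟨c, -, hc⟩ := exists_hasDerivAt_eq_slope
      (fun s => ∫ η, charIntegrand F x t s η ∂surf) (fun _ => 0) htpos hcont
      fun s hs => hasDerivAt_integral_charIntegrand hF hw x hs
    have := (div_eq_zero_iff.1 hc.symm).resolve_right (by linarith)
    linarith
  have hD : ∀ y : Space, HasFDerivWithinAt F (fderivWithin ℝ F halfSpace (y, 0)) halfSpace (y, 0) :=
    fun y => (hF.differentiableOn two_ne_zero (y, 0)
      ⟨mem_univ _, mem_Ici.2 le_rfl⟩).hasFDerivWithinAt
  have h0 : ∀ y : Space, F (y, 0) = ε * f y := fun y => hu.init y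
  have hx : ∀ y v : Space, fderivWithin ℝ F halfSpace (y, 0) (v, 0) = ε * fderiv ℝ f y v := by
    intro y v
    have h1 : HasFDerivAt (fun y => F (y, 0)) ((fderivWithin ℝ F halfSpace (y, 0)).comp
        (ContinuousLinearMap.inl ℝ Space ℝ)) y := by
      rw [← hasFDerivWithinAt_univ]
      exact (hD y).comp y (f := fun y : Space => ((y, 0) : Space × ℝ))
        (hasFDerivAt_prodMk_left y 0).hasFDerivWithinAt
        (fun y _ => ⟨mem_univ _, mem_Ici.2 le_rfl⟩)
    have h2 : HasFDerivAt (fun y => F (y, 0)) (ε • fderiv ℝ f y) y := by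
      simp only [h0]
      exact (hf.differentiable one_ne_zero).differentiableAt.hasFDerivAt.const_mul ε
    have := congrArg (fun T : Space →L[ℝ] ℝ => T v) (h1.unique h2)
    simpa using this
  have hτ : ∀ y : Space, fderivWithin ℝ F halfSpace (y, 0) (0, 1) = ε * (f y + g y) := by
    intro y
    rw [← hu.init_deriv]
    have h1 : HasFDerivWithinAt (fun s => F (y, s)) ((fderivWithin ℝ F halfSpace (y, 0)).comp
        (ContinuousLinearMap.inr ℝ Space ℝ)) (Ici 0) 0 := by
      exact (hD y).comp 0 (f := fun s : ℝ => ((y, s) : Space × ℝ))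
        (hasFDerivAt_prodMk_right y 0).hasFDerivWithinAt
        (fun s hs => ⟨mem_univ _, hs⟩)
    have := h1.hasDerivWithinAt.derivWithin (uniqueDiffOn_Ici (0 : ℝ) 0 (mem_Ici.2 le_rfl))
    rw [this]
    simp
  have e1 : ∀ η : Sph, charIntegrand F x t t η = u₀ x t := by
    intro η; simp [charIntegrand, F]
  have e2 : ∀ η : Sph, charIntegrand F x t 0 η = ε * (f (x + t • (η : Space))
    + t * (fderiv ℝ f (x + t • (η : Space)) η
      + (f (x + t • (η : Space)) + g (x + t • (η : Space))))) := by
    intro η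
    simp only [charIntegrand, sub_zero]
    rw [h0, show (((η : Space), 1) : Space × ℝ) = ((η : Space), 0) + (0, 1) by simp, map_add, hx,
      hτ]
    ring
  simp only [e1, e2] at hconst
  rw [integral_surf_const, integral_const_mul] at hconst
  rw [kirchhoff]
  field_simp
  linarith

/-! ### Spherical integrals as functions of space-time -/

/-- The unit time direction in space-time. -/
def timeDir : Space × ℝ := (0, 1)

/-- The linear map `(x, t) ↦ x + t η`. -/
def sphShift (η : Sph) : Space × ℝ →L[ℝ] Space :=
  ContinuousLinearMap.fst ℝ Space ℝ + (ContinuousLinearMap.snd ℝ Space ℝ).smulRight (η : Space)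

theorem sphShift_apply (η : Sph) (z : Space × ℝ) : sphShift η z = z.1 + z.2 • (η : Space) := rfl

theorem continuous_sphShift : Continuous sphShift := by
  have h : Continuous fun η : Sph =>
      (ContinuousLinearMap.snd ℝ Space ℝ).smulRight (η : Space) :=
    (ContinuousLinearMap.smulRightL ℝ (Space × ℝ) Space
      (ContinuousLinearMap.snd ℝ Space ℝ)).continuous.comp continuous_subtype_val
  exact continuous_const.add h

/-- The integral of `h` over the sphere of radius `t` about `x`, as a function of `(x, t)`. -/
def sphInt {F : Type*} [NormedAddCommGroup F] [NormedSpace ℝ F] (h : Space → F)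
    (z : Space × ℝ) : F := ∫ η : Sph, h (z.1 + z.2 • (η : Space)) ∂surf

theorem contDiff_sphInt {h : Space → ℝ} {n : ℕ} (hh : ContDiff ℝ n h) :
    ContDiff ℝ n (sphInt h) := by
  have := contDiff_integral_comp_clm (μ := surf) continuous_sphShift n
    (B := fun _ => ContinuousLinearMap.id ℝ ℝ) continuous_const hh
  exact this

theorem fderiv_sphInt_apply {h : Space → ℝ} (hh : ContDiff ℝ 1 h) (z v : Space × ℝ) :
    fderiv ℝ (sphInt h) z v
      = ∫ η : Sph, fderiv ℝ h (z.1 + z.2 • (η : Space)) (v.1 + v.2 • (η : Space)) ∂surf := by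
  have := hasFDerivAt_integral_comp_clm (μ := surf) continuous_sphShift
    (B := fun _ => ContinuousLinearMap.id ℝ ℝ) continuous_const hh z
  have h2 : HasFDerivAt (sphInt h) _ z := this
  rw [h2.fderiv, ContinuousLinearMap.integral_apply]
  · simp [sphShift_apply]
  · refine integrable_of_continuous (continuous_const.clm_comp (Continuous.clm_comp ?_
      continuous_sphShift))
    exact (hh.continuous_fderiv one_ne_zero).comp
      (continuous_sphShift.clm_apply continuous_const)

theorem fderiv_fderiv_sphInt_apply {h : Space → ℝ} (hh : ContDiff ℝ 2 h) (z v : Space × ℝ) :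
    fderiv ℝ (fderiv ℝ (sphInt h)) z v v
      = ∫ η : Sph, fderiv ℝ (fderiv ℝ h) (z.1 + z.2 • (η : Space)) (v.1 + v.2 • (η : Space))
        (v.1 + v.2 • (η : Space)) ∂surf := by
  have h1 : ContDiff ℝ 1 (fderiv ℝ h) := hh.fderiv_right (m := 1) (by norm_num)
  have hd : DifferentiableAt ℝ (fderiv ℝ (sphInt h)) z :=
    ((contDiff_sphInt (n := 2) hh).fderiv_right (m := 1) (by norm_num)).differentiable
      one_ne_zero z
  have e1 : fderiv ℝ (fderiv ℝ (sphInt h)) z v v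
      = fderiv ℝ (fun z => fderiv ℝ (sphInt h) z v) z v := by
    rw [(hd.hasFDerivAt.clm_apply (hasFDerivAt_const v z)).fderiv]; simp
  rw [e1]
  have e2 : (fun z => fderiv ℝ (sphInt h) z v) = fun z => ∫ η : Sph,
      ((ContinuousLinearMap.apply ℝ ℝ (sphShift η v)) (fderiv ℝ h (sphShift η z))) ∂surf := by
    ext z
    rw [fderiv_sphInt_apply (hh.of_le (by norm_num))]
    rfl
  rw [e2]
  have hB : Continuous fun η : Sph => ContinuousLinearMap.apply ℝ ℝ (sphShift η v) :=
    (ContinuousLinearMap.apply ℝ ℝ).continuous.comp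
      (continuous_sphShift.clm_apply continuous_const)
  have := hasFDerivAt_integral_comp_clm (μ := surf) continuous_sphShift hB h1 z
  rw [this.fderiv, ContinuousLinearMap.integral_apply]
  · rfl
  · refine integrable_of_continuous (hB.clm_comp (Continuous.clm_comp ?_ continuous_sphShift))
    exact (h1.continuous_fderiv one_ne_zero).comp (continuous_sphShift.clm_apply continuous_const)

theorem integral_surf_clm (ℓ : Space →L[ℝ] ℝ) : ∫ η : Sph, ℓ η ∂surf = 0 := by
  have h := integral_surf_comp_isometry (LinearIsometryEquiv.neg ℝ) ℓ.continuous
  simp only [LinearIsometryEquiv.coe_neg, map_neg, integral_neg] at h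
  linarith

/-- `t` times the spherical integral of `h` solves the wave equation. -/
theorem sphInt_wave {h : Space → ℝ} (hh : ContDiff ℝ 2 h) (z : Space × ℝ) :
    fderiv ℝ (fderiv ℝ fun z => z.2 * sphInt h z) z timeDir timeDir
      = ∑ i, fderiv ℝ (fderiv ℝ fun z => z.2 * sphInt h z) z (bas i, 0) (bas i, 0) := by
  have hM := contDiff_sphInt (n := 2) hh
  have hM1 : ContDiff ℝ 1 (fderiv ℝ (sphInt h)) := hM.fderiv_right (m := 1) (by norm_num)
  have hd1 : ∀ z : Space × ℝ, HasFDerivAt (fun z : Space × ℝ => z.2 * sphInt h z)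
      (z.2 • fderiv ℝ (sphInt h) z + sphInt h z • ContinuousLinearMap.snd ℝ Space ℝ) z := fun z =>
    (hasFDerivAt_snd).mul ((hM.differentiable two_ne_zero z).hasFDerivAt)
  have e1 : (fderiv ℝ fun z : Space × ℝ => z.2 * sphInt h z) = fun z =>
      z.2 • fderiv ℝ (sphInt h) z + sphInt h z • ContinuousLinearMap.snd ℝ Space ℝ :=
    funext fun z => (hd1 z).fderiv
  have e2 : ∀ v : Space × ℝ, fderiv ℝ (fderiv ℝ fun z => z.2 * sphInt h z) z v v
      = z.2 * fderiv ℝ (fderiv ℝ (sphInt h)) z v v + 2 * v.2 * fderiv ℝ (sphInt h) z v := by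
    intro v
    rw [e1]
    have := ((hasFDerivAt_snd (𝕜 := ℝ) (E := Space) (F := ℝ) (p := z)).smul
      (hM1.differentiable one_ne_zero z).hasFDerivAt).add
      (((hM.differentiable two_ne_zero z).hasFDerivAt).smul
        (hasFDerivAt_const (ContinuousLinearMap.snd ℝ Space ℝ) z))
    refine (congrArg (fun T : Space × ℝ →L[ℝ] Space × ℝ →L[ℝ] ℝ => T v v)
      (HasFDerivAt.fderiv this)).trans ?_
    simp
    ring
  simp only [e2]
  simp only [fderiv_fderiv_sphInt_apply hh, fderiv_sphInt_apply (hh.of_le (by norm_num)), timeDir,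
    zero_smul, add_zero, zero_add, one_smul, mul_zero, zero_mul, mul_one]
  -- The Darboux identity carries a factor `t`, to be cancelled. At `t = 0` only the integral of an
  -- odd function remains.
  rcases eq_or_ne z.2 0 with h0 | h0
  · simp [h0, integral_surf_clm]
  have c2 : Continuous (fderiv ℝ (fderiv ℝ h)) :=
    (hh.fderiv_right (m := 1) (by norm_num)).continuous_fderiv one_ne_zero
  have c1 : Continuous (fderiv ℝ h) := hh.continuous_fderiv two_ne_zero
  have i1 : ∀ v : Space, Integrable (fun η : Sph =>
      fderiv ℝ (fderiv ℝ h) (z.1 + z.2 • (η : Space)) v v) surf := fun v =>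
    integrable_of_continuous (((c2.comp (by fun_prop)).clm_apply (by fun_prop)).clm_apply
      (by fun_prop))
  have i2 : Integrable (fun η : Sph =>
      fderiv ℝ (fderiv ℝ h) (z.1 + z.2 • (η : Space)) η η) surf :=
    integrable_of_continuous (((c2.comp (by fun_prop)).clm_apply (by fun_prop)).clm_apply
      (by fun_prop))
  have i3 : Integrable (fun η : Sph => fderiv ℝ h (z.1 + z.2 • (η : Space)) η) surf :=
    integrable_of_continuous ((c1.comp (by fun_prop)).clm_apply (by fun_prop))
  have hdar := integral_sphere_darboux hh z.1 z.2
  rw [integral_sub, integral_sub, integral_const_mul, integral_const_mul, integral_const_mul,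
    integral_finsetSum _ fun i _ => i1 (bas i)] at hdar
  · refine mul_left_cancel₀ h0 ?_
    rw [← Finset.mul_sum]
    linear_combination -hdar
  · exact (integrable_finsetSum _ fun i _ => i1 (bas i)).const_mul _
  · exact i2.const_mul _
  · exact ((integrable_finsetSum _ fun i _ => i1 (bas i)).const_mul _).sub (i2.const_mul _)
  · exact i3.const_mul _

/-- The derivative of a `C³` solution of the wave equation solves the wave equation. -/
theorem wave_fderiv {v : Space × ℝ → ℝ} (hv : ContDiff ℝ 3 v)
    (hw : ∀ z, fderiv ℝ (fderiv ℝ v) z timeDir timeDir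
      = ∑ i, fderiv ℝ (fderiv ℝ v) z (bas i, 0) (bas i, 0)) (b : Space × ℝ) (z : Space × ℝ) :
    fderiv ℝ (fderiv ℝ fun z => fderiv ℝ v z b) z timeDir timeDir
      = ∑ i, fderiv ℝ (fderiv ℝ fun z => fderiv ℝ v z b) z (bas i, 0) (bas i, 0) := by
  have step : ∀ {w : Space × ℝ → ℝ} (_ : ContDiff ℝ 2 w) (a c : Space × ℝ) (z : Space × ℝ),
      fderiv ℝ (fun z => fderiv ℝ w z a) z c = fderiv ℝ (fderiv ℝ w) z c a := by
    intro w hw a c z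
    have hd : DifferentiableAt ℝ (fderiv ℝ w) z :=
      (hw.fderiv_right (m := 1) (by norm_num)).differentiable one_ne_zero z
    rw [(hd.hasFDerivAt.clm_apply (hasFDerivAt_const a z)).fderiv]; simp
  have comm : ∀ {w : Space × ℝ → ℝ} (_ : ContDiff ℝ 2 w) (a c : Space × ℝ) (z : Space × ℝ),
      fderiv ℝ (fun z => fderiv ℝ w z a) z c = fderiv ℝ (fun z => fderiv ℝ w z c) z a := by
    intro w hw a c z
    rw [step hw, step hw]
    exact (hw.contDiffAt.isSymmSndFDerivAt (by simp)) _ _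
  have hC : ∀ a, ContDiff ℝ 2 fun z => fderiv ℝ v z a := fun a =>
    (hv.fderiv_right (m := 2) (by norm_num)).clm_apply contDiff_const
  have hCC : ∀ a, ContDiff ℝ 1 fun z => fderiv ℝ (fderiv ℝ v) z a a := fun a =>
    (((hv.fderiv_right (m := 2) (by norm_num)).fderiv_right (m := 1)
      (by norm_num)).clm_apply contDiff_const).clm_apply contDiff_const
  have h2 : ContDiff ℝ 2 v := hv.of_le (by norm_num)
  have main : ∀ a, fderiv ℝ (fderiv ℝ fun z => fderiv ℝ v z b) z a a
      = fderiv ℝ (fun z => fderiv ℝ (fderiv ℝ v) z a a) z b := by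
    intro a
    rw [← step (hC b)]
    have e1 : (fun z => fderiv ℝ (fun z => fderiv ℝ v z b) z a)
        = fun z => fderiv ℝ (fun z => fderiv ℝ v z a) z b := funext fun z => comm h2 b a z
    rw [e1, comm (hC a) b a z]
    congr 2
    ext z
    rw [step h2]
  simp only [main]
  have e3 : (fun z => fderiv ℝ (fderiv ℝ v) z timeDir timeDir)
      = fun z => ∑ i, fderiv ℝ (fderiv ℝ v) z (bas i, 0) (bas i, 0) := funext hw
  rw [e3, fderiv_fun_sum fun i _ => (hCC _).differentiable one_ne_zero z]
  simp

/-! ### Regularity and decay of the free wave -/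

theorem fderiv_mul_sphInt_timeDir {h : Space → ℝ} (hh : ContDiff ℝ 1 h) (z : Space × ℝ) :
    fderiv ℝ (fun z => z.2 * sphInt h z) z timeDir
      = z.2 * fderiv ℝ (sphInt h) z timeDir + sphInt h z := by
  have hM := contDiff_sphInt (n := 1) hh
  have := (hasFDerivAt_snd (𝕜 := ℝ) (E := Space) (F := ℝ) (p := z)).mul
    ((hM.differentiable one_ne_zero z).hasFDerivAt)
  refine (congrArg (fun T : Space × ℝ →L[ℝ] ℝ => T timeDir) (HasFDerivAt.fderiv this)).trans ?_
  simp [timeDir]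

/-- In the form `∂_t (t M f) + t M (f + g)`, with `M` the spherical integral, both terms visibly
solve the wave equation, and the loss of one derivative on `f` explains the classes `C³` and `C²` of
the data. -/
theorem kirchhoff_eq {f g : Space → ℝ} (hf : ContDiff ℝ 1 f) (hg : Continuous g) :
    kirchhoff f g = fun z => 1 / (4 * Real.pi) * (fderiv ℝ (fun z => z.2 * sphInt f z) z timeDir
      + z.2 * sphInt (f + g) z) := by
  ext z
  have c1 : Continuous (fderiv ℝ f) := hf.continuous_fderiv one_ne_zero
  have c0 := hf.continuous
  have i0 : Integrable (fun η : Sph => f (z.1 + z.2 • (η : Space))) surf :=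
    integrable_of_continuous (by fun_prop)
  have i3 : Integrable (fun η : Sph => fderiv ℝ f (z.1 + z.2 • (η : Space)) η) surf :=
    integrable_of_continuous ((c1.comp (by fun_prop)).clm_apply (by fun_prop))
  have i2 : Integrable (fun η : Sph => f (z.1 + z.2 • (η : Space))
      + g (z.1 + z.2 • (η : Space))) surf := integrable_of_continuous (by fun_prop)
  rw [fderiv_mul_sphInt_timeDir hf, fderiv_sphInt_apply hf, kirchhoff,
    integral_add i0 (Integrable.const_mul (f := fun η : Sph => fderiv ℝ f (z.1 + z.2 • (η : Space)) η
      + (f (z.1 + z.2 • (η : Space)) + g (z.1 + z.2 • (η : Space)))) (i3.add i2) _),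
    integral_const_mul]
  have := integral_add i3 i2
  simp only [timeDir, zero_add, one_smul, sphInt, Pi.add_apply] at this ⊢
  rw [this]
  ring

theorem contDiff_kirchhoff {f g : Space → ℝ} (hf : ContDiff ℝ 3 f) (hg : ContDiff ℝ 2 g) :
    ContDiff ℝ 2 (kirchhoff f g) := by
  rw [kirchhoff_eq (hf.of_le (by norm_num)) hg.continuous]
  have h1 : ContDiff ℝ 3 fun z : Space × ℝ => z.2 * sphInt f z :=
    contDiff_snd.mul (contDiff_sphInt (n := 3) hf)
  have h2 : ContDiff ℝ 2 fun z : Space × ℝ => z.2 * sphInt (f + g) z :=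
    contDiff_snd.mul (contDiff_sphInt (n := 2) ((hf.of_le (by norm_num)).add hg))
  exact contDiff_const.mul (((h1.fderiv_right (m := 2) (by norm_num)).clm_apply
    contDiff_const).add h2)

theorem kirchhoff_zero (f g : Space → ℝ) (x : Space) : kirchhoff f g (x, 0) = f x := by
  have hpi := Real.pi_pos
  simp only [kirchhoff, zero_smul, add_zero, zero_mul]
  rw [integral_surf_const]
  field_simp

theorem kirchhoff_wave {f g : Space → ℝ} (hf : ContDiff ℝ 3 f) (hg : ContDiff ℝ 2 g)
    (z : Space × ℝ) :
    fderiv ℝ (fderiv ℝ (kirchhoff f g)) z timeDir timeDir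
      = ∑ i, fderiv ℝ (fderiv ℝ (kirchhoff f g)) z (bas i, 0) (bas i, 0) := by
  rw [kirchhoff_eq (hf.of_le (by norm_num)) hg.continuous]
  have h1 : ContDiff ℝ 3 fun z : Space × ℝ => z.2 * sphInt f z :=
    contDiff_snd.mul (contDiff_sphInt (n := 3) hf)
  have h1' : ContDiff ℝ 2 fun z => fderiv ℝ (fun z => z.2 * sphInt f z) z timeDir :=
    (h1.fderiv_right (m := 2) (by norm_num)).clm_apply contDiff_const
  have hfg : ContDiff ℝ 2 (f + g) := (hf.of_le (by norm_num)).add hg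
  have h2 : ContDiff ℝ 2 fun z : Space × ℝ => z.2 * sphInt (f + g) z :=
    contDiff_snd.mul (contDiff_sphInt (n := 2) hfg)
  have e1 : (fderiv ℝ fun z => 1 / (4 * Real.pi) *
      (fderiv ℝ (fun z => z.2 * sphInt f z) z timeDir + z.2 * sphInt (f + g) z))
      = fun z => (1 / (4 * Real.pi)) •
      (fderiv ℝ (fun z => fderiv ℝ (fun z => z.2 * sphInt f z) z timeDir) z
      + fderiv ℝ (fun z : Space × ℝ => z.2 * sphInt (f + g) z) z) := by
    ext1 z
    exact (((h1'.differentiable two_ne_zero z).hasFDerivAt.add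
      (h2.differentiable two_ne_zero z).hasFDerivAt).const_mul _).fderiv
  have e2 : fderiv ℝ (fun z => (1 / (4 * Real.pi)) •
      (fderiv ℝ (fun z => fderiv ℝ (fun z => z.2 * sphInt f z) z timeDir) z
      + fderiv ℝ (fun z : Space × ℝ => z.2 * sphInt (f + g) z) z)) z
      = (1 / (4 * Real.pi)) •
      (fderiv ℝ (fderiv ℝ (fun z => fderiv ℝ (fun z => z.2 * sphInt f z) z timeDir)) z
      + fderiv ℝ (fderiv ℝ (fun z : Space × ℝ => z.2 * sphInt (f + g) z)) z) :=
    ((((h1'.fderiv_right (m := 1) (by norm_num)).differentiable one_ne_zero z).hasFDerivAt.add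
      ((h2.fderiv_right (m := 1) (by norm_num)).differentiable
        one_ne_zero z).hasFDerivAt).const_smul (1 / (4 * Real.pi))).fderiv
  rw [e1, e2]
  simp only [smul_apply, add_apply, smul_eq_mul]
  rw [← Finset.mul_sum, Finset.sum_add_distrib, sphInt_wave hfg,
    wave_fderiv h1 (sphInt_wave (hf.of_le (by norm_num)))]

theorem fderiv_sphInt_timeDir_zero {h : Space → ℝ} (hh : ContDiff ℝ 1 h) (x : Space) :
    fderiv ℝ (sphInt h) (x, 0) timeDir = 0 := by
  rw [fderiv_sphInt_apply hh]
  simp [timeDir, integral_surf_clm]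

/-- Writing `∂_t (t M f) = t ∂_t M f + M f`, the time derivative at `t = 0` of the sum is `2 ∂_t M f
+ M (f + g)`, and `∂_t M f` vanishes there by oddness. -/
theorem fderiv_kirchhoff_timeDir_zero {f g : Space → ℝ} (hf : ContDiff ℝ 3 f)
    (hg : ContDiff ℝ 2 g) (x : Space) :
    fderiv ℝ (kirchhoff f g) (x, 0) timeDir = f x + g x := by
  have hpi := Real.pi_pos
  have hf1 : ContDiff ℝ 1 f := hf.of_le (by norm_num)
  have hM : ContDiff ℝ 3 (sphInt f) := contDiff_sphInt (n := 3) hf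
  have hfg : ContDiff ℝ 1 (f + g) := hf1.add (hg.of_le (by norm_num))
  have hC : ContDiff ℝ 2 fun z : Space × ℝ => fderiv ℝ (sphInt f) z timeDir :=
    (hM.fderiv_right (m := 2) (by norm_num)).clm_apply contDiff_const
  have hK : kirchhoff f g = fun z => 1 / (4 * Real.pi) *
      (z.2 * fderiv ℝ (sphInt f) z timeDir + sphInt f z + z.2 * sphInt (f + g) z) := by
    rw [kirchhoff_eq hf1 hg.continuous]
    ext z
    rw [fderiv_mul_sphInt_timeDir hf1]
  have hs := hasFDerivAt_snd (𝕜 := ℝ) (E := Space) (F := ℝ) (p := (x, (0 : ℝ)))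
  have := (((hs.mul (hC.differentiable two_ne_zero (x, 0)).hasFDerivAt).add
    (hM.differentiable three_ne_zero (x, 0)).hasFDerivAt).add
    (hs.mul ((contDiff_sphInt (n := 1) hfg).differentiable one_ne_zero (x, 0)).hasFDerivAt)).const_mul
    (1 / (4 * Real.pi))
  rw [hK]
  refine (congrArg (fun T : Space × ℝ →L[ℝ] ℝ => T timeDir) (HasFDerivAt.fderiv this)).trans ?_
  have h1 : (ContinuousLinearMap.snd ℝ Space ℝ) timeDir = 1 := rfl
  simp only [smul_apply, add_apply, smul_eq_mul, fderiv_sphInt_timeDir_zero hf1, h1, zero_mul,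
    zero_add, add_zero, mul_one]
  simp only [sphInt, zero_smul, add_zero, Pi.add_apply]
  rw [integral_surf_const]
  field_simp

theorem isFreeWave_kirchhoff {f g : Space → ℝ} (hf : ContDiff ℝ 3 f) (hg : ContDiff ℝ 2 g)
    (ε : ℝ) : IsFreeWave f g ε fun x t => ε * kirchhoff f g (x, t) where
  contDiffOn := (contDiff_const.mul (contDiff_kirchhoff hf hg)).contDiffOn
  wave x t ht := by
    have hK := contDiff_kirchhoff hf hg
    have hC : ContDiff ℝ 2 fun z => ε * kirchhoff f g z := contDiff_const.mul hK
    have h1 := iteratedDeriv_two_time (hC.contDiffAt (x := (x, t)))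
    rw [iteratedDerivWithin_eq_iteratedDeriv (uniqueDiffOn_Ici 0)
      (show ContDiffAt ℝ 2 (fun t => ε * kirchhoff f g (x, t)) t from (hC.comp
        (by fun_prop : ContDiff ℝ 2 (fun s : ℝ => ((x, s) : Space × ℝ)))).contDiffAt) ht,
      h1, laplacian_space (hC.contDiffAt (x := (x, t)))]
    have e1 : (fderiv ℝ fun z => ε * kirchhoff f g z) = fun z => ε • fderiv ℝ (kirchhoff f g) z :=
      funext fun z => ((hK.differentiable two_ne_zero z).hasFDerivAt.const_mul ε).fderiv
    have e2 : fderiv ℝ (fun z => ε • fderiv ℝ (kirchhoff f g) z) (x, t)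
        = ε • fderiv ℝ (fderiv ℝ (kirchhoff f g)) (x, t) :=
      (((hK.fderiv_right (m := 1) (by norm_num)).differentiable
        one_ne_zero (x, t)).hasFDerivAt.const_smul ε).fderiv
    rw [e1, e2]
    simp only [smul_apply, smul_eq_mul]
    rw [← Finset.mul_sum, ← kirchhoff_wave hf hg, timeDir, sub_self]
  init x := by rw [kirchhoff_zero]
  init_deriv x := by
    have hK := contDiff_kirchhoff hf hg
    have h1 : HasFDerivAt (fun s : ℝ => kirchhoff f g (x, s))
        ((fderiv ℝ (kirchhoff f g) (x, 0)).comp (ContinuousLinearMap.inr ℝ Space ℝ)) 0 :=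
      (hK.differentiable two_ne_zero (x, 0)).hasFDerivAt.comp (0 : ℝ) (hasFDerivAt_prodMk_right x 0)
    have h2 := (h1.hasDerivAt.const_mul ε).hasDerivWithinAt.derivWithin
      (uniqueDiffOn_Ici (0 : ℝ) 0 (mem_Ici.2 le_rfl))
    rw [h2, ← fderiv_kirchhoff_timeDir_zero hf hg x]
    rfl

/-- The measure of the part of the sphere of radius `t` inside a fixed ball, rescaled. -/
theorem surf_real_cap_le {k : ℝ} (hk : 1 ≤ k) (x : Space) {t : ℝ} (ht : 0 ≤ t) :
    surf.real {η : Sph | ‖x + t • (η : Space)‖ ≤ k} * (1 + t) ^ 2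
      ≤ 4 * Real.pi * (1 + 2 * k) ^ 2 := by
  have hpi := Real.pi_pos
  set S := {η : Sph | ‖x + t • (η : Space)‖ ≤ k} with hS
  have htot : surf.real S ≤ 4 * Real.pi := surf_real_univ ▸ measureReal_mono (subset_univ S)
  -- For bounded times the total area suffices. For `t > 2k` a nonempty cap forces `‖x‖ ≥ t / 2`,
  -- and John's formula for the indicator of `l ≤ k` bounds the cap by a multiple of `k² / t²`.
  rcases le_or_gt t (2 * k) with h | h
  · gcongr
  by_cases hempty : S = ∅
  · rw [hempty]; simp; positivity
  obtain ⟨η₀, hη₀⟩ := nonempty_iff_ne_empty.2 hempty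
  have hxt : t - k ≤ ‖x‖ := by
    have h1 : ‖t • (η₀ : Space)‖ = t := by rw [norm_smul, norm_coe_sph, Real.norm_of_nonneg ht, mul_one]
    have h2 : ‖t • (η₀ : Space)‖ ≤ ‖x + t • (η₀ : Space)‖ + ‖x‖ := by
      have := norm_sub_le (x + t • (η₀ : Space)) x
      simpa using this
    have h3 : ‖x + t • (η₀ : Space)‖ ≤ k := hη₀
    linarith
  have ht0 : 0 < t := by linarith
  have hx : t / 2 ≤ ‖x‖ := by linarith
  have hx0 : x ≠ 0 := norm_pos_iff.1 (by linarith)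
  have hmeas : MeasurableSet S := measurableSet_le (by fun_prop) measurable_const
  have hlin := lintegral_sphere_radial hx0 ht0 (W := (Iic k).indicator 1)
    (measurable_one.indicator measurableSet_Iic)
  have hl : ∫⁻ η : Sph, (Iic k).indicator (1 : ℝ → ENNReal) ‖x + t • (η : Space)‖ ∂surf
      = surf S := by
    rw [← lintegral_indicator_one hmeas]
    rfl
  have hr : ∫⁻ l in Icc |‖x‖ - t| (‖x‖ + t), ENNReal.ofReal l * (Iic k).indicator 1 l
      ≤ ENNReal.ofReal (k * k) := by
    calc _ ≤ ∫⁻ l in Icc |‖x‖ - t| (‖x‖ + t),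
          (Icc 0 k).indicator (fun _ => ENNReal.ofReal k) l := by
          refine setLIntegral_mono ((measurable_const).indicator measurableSet_Icc) fun l hl => ?_
          by_cases hlk : l ≤ k
          · have : l ∈ Icc 0 k := ⟨(abs_nonneg _).trans hl.1, hlk⟩
            simp only [indicator_of_mem this, indicator_of_mem (mem_Iic.2 hlk), Pi.one_apply, mul_one]
            exact ENNReal.ofReal_le_ofReal hlk
          · simp [hlk]
      _ ≤ ∫⁻ l, (Icc 0 k).indicator (fun _ => ENNReal.ofReal k) l := setLIntegral_le_lintegral _ _
      _ = ENNReal.ofReal (k * k) := by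
          rw [lintegral_indicator measurableSet_Icc, setLIntegral_const, Real.volume_Icc, sub_zero,
            ← ENNReal.ofReal_mul (by linarith)]
  have hS2 : surf.real S ≤ 4 * Real.pi * k ^ 2 / t ^ 2 := by
    rw [Measure.real, ← hl, hlin]
    refine ENNReal.toReal_le_of_le_ofReal (by positivity) ?_
    refine (mul_le_mul_right hr _).trans ?_
    rw [← ENNReal.ofReal_mul (by positivity)]
    refine ENNReal.ofReal_le_ofReal ?_
    have : 2 * Real.pi / (‖x‖ * t) ≤ 2 * Real.pi / (t / 2 * t) := by gcongr
    calc 2 * Real.pi / (‖x‖ * t) * (k * k) ≤ 2 * Real.pi / (t / 2 * t) * (k * k) := by gcongr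
      _ = _ := by field_simp; ring
  calc surf.real S * (1 + t) ^ 2 ≤ 4 * Real.pi * k ^ 2 / t ^ 2 * (1 + t) ^ 2 := by gcongr
    _ = 4 * Real.pi * (k * (1 + t) / t) ^ 2 := by field_simp
    _ ≤ 4 * Real.pi * (1 + 2 * k) ^ 2 := by
      gcongr
      rw [div_le_iff₀ ht0]
      nlinarith

/-- Strong Huygens principle: every point of the sphere of radius `|t|` about `x` has norm at least
`|‖x‖ - |t||`, so the sphere misses the ball carrying the data. -/
theorem kirchhoff_eq_zero {f g : Space → ℝ} {k : ℝ} (hfk : ∀ x, k < ‖x‖ → f x = 0)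
    (hfk' : ∀ x, k < ‖x‖ → fderiv ℝ f x = 0)
    (hgk : ∀ x, k < ‖x‖ → g x = 0) {x : Space} {t : ℝ} (h : k < abs (‖x‖ - |t|)) :
    kirchhoff f g (x, t) = 0 := by
  have hz : ∀ η : Sph, k < ‖x + t • (η : Space)‖ := by
    intro η
    refine h.trans_le ?_
    have h1 : ‖t • (η : Space)‖ = |t| := by rw [norm_smul, norm_coe_sph, Real.norm_eq_abs, mul_one]
    rw [← h1, ← norm_neg (t • (η : Space))]
    refine (abs_norm_sub_norm_le _ _).trans (le_of_eq ?_)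
    rw [sub_neg_eq_add]
  simp [kirchhoff, hfk _ (hz _), hfk' _ (hz _), hgk _ (hz _)]

/-- The solution of the free wave equation decays like `1 / (1 + t)`. -/
theorem abs_kirchhoff_le {f g : Space → ℝ} {k C : ℝ} (hk : 1 ≤ k) (hC : 0 ≤ C)
    (hfk : ∀ x, k < ‖x‖ → f x = 0) (hfk' : ∀ x, k < ‖x‖ → fderiv ℝ f x = 0)
    (hgk : ∀ x, k < ‖x‖ → g x = 0) (hfC : ∀ x, |f x| ≤ C) (hfC' : ∀ x, ‖fderiv ℝ f x‖ ≤ C)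
    (hgC : ∀ x, |g x| ≤ C) (x : Space) {t : ℝ} (ht : 0 ≤ t) :
    |kirchhoff f g (x, t)| ≤ 3 * C * (1 + 2 * k) ^ 2 * (1 + t)⁻¹ := by
  have hpi := Real.pi_pos
  set S := {η : Sph | ‖x + t • (η : Space)‖ ≤ k} with hS
  have hmeas : MeasurableSet S := measurableSet_le (by fun_prop) measurable_const
  have hbound : ∀ η : Sph, ‖f (x + t • (η : Space)) + t * (fderiv ℝ f (x + t • (η : Space)) η
      + (f (x + t • (η : Space)) + g (x + t • (η : Space))))‖
      ≤ S.indicator (fun _ => 3 * C * (1 + t)) η := by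
    intro η
    by_cases hη : η ∈ S
    · rw [indicator_of_mem hη, Real.norm_eq_abs]
      set y := x + t • (η : Space)
      have h1 : |fderiv ℝ f y η| ≤ C := by
        have := (fderiv ℝ f y).le_opNorm η
        rw [norm_coe_sph, mul_one] at this
        exact this.trans (hfC' y)
      have h2 := abs_le.1 h1
      have h3 := abs_le.1 (hfC y)
      have h4 := abs_le.1 (hgC y)
      rw [abs_le]
      constructor <;> nlinarith
    · have : k < ‖x + t • (η : Space)‖ := not_le.1 hη
      rw [indicator_of_notMem hη, hfk _ this, hfk' _ this, hgk _ this]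
      simp
  have hI := norm_integral_le_of_norm_le (μ := surf)
    ((integrable_const (3 * C * (1 + t))).indicator hmeas) (ae_of_all _ hbound)
  rw [integral_indicator_const _ hmeas, smul_eq_mul] at hI
  have hcap := surf_real_cap_le hk x ht
  rw [kirchhoff, abs_mul, abs_of_pos (by positivity : 0 < 1 / (4 * Real.pi))]
  calc _ ≤ 1 / (4 * Real.pi) * (surf.real S * (3 * C * (1 + t))) := by gcongr; exact hI
    _ = 3 * C / (4 * Real.pi) * (surf.real S * (1 + t) ^ 2) * (1 + t)⁻¹ := by field_simp
    _ ≤ 3 * C / (4 * Real.pi) * (4 * Real.pi * (1 + 2 * k) ^ 2) * (1 + t)⁻¹ := by gcongr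
    _ = _ := by field_simp

/-! ### The retarded potential -/

/-- Parameters `(σ, η)` of the backward light cone, scaled to unit height. -/
abbrev Cone : Type := unitInterval × Sph

/-- The product measure on the scaled light cone. -/
abbrev coneMeas : Measure Cone := (volume : Measure unitInterval).prod surf

/-- The linear map `(x, t) ↦ (x + t (1 - σ) η, t σ)`. -/
def coneShift (ξ : Cone) : Space × ℝ →L[ℝ] Space × ℝ :=
  ContinuousLinearMap.prod
    (ContinuousLinearMap.fst ℝ Space ℝ
      + (1 - (ξ.1 : ℝ)) • (ContinuousLinearMap.snd ℝ Space ℝ).smulRight (ξ.2 : Space))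
    ((ξ.1 : ℝ) • ContinuousLinearMap.snd ℝ Space ℝ)

theorem coneShift_apply (ξ : Cone) (z : Space × ℝ) :
    coneShift ξ z = (z.1 + (1 - (ξ.1 : ℝ)) • z.2 • (ξ.2 : Space), ξ.1 * z.2) := rfl

theorem continuous_coneShift : Continuous coneShift := by
  have h : Continuous fun ξ : Cone =>
      (ContinuousLinearMap.snd ℝ Space ℝ).smulRight (ξ.2 : Space) :=
    (ContinuousLinearMap.smulRightL ℝ (Space × ℝ) Space
      (ContinuousLinearMap.snd ℝ Space ℝ)).continuous.comp
        (continuous_subtype_val.comp continuous_snd)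
  have h1 : Continuous fun ξ : Cone => ContinuousLinearMap.fst ℝ Space ℝ
      + (1 - (ξ.1 : ℝ)) • (ContinuousLinearMap.snd ℝ Space ℝ).smulRight (ξ.2 : Space) :=
    continuous_const.add ((continuous_const.sub (continuous_subtype_val.comp continuous_fst)).smul h)
  have h2 : Continuous fun ξ : Cone => (ξ.1 : ℝ) • ContinuousLinearMap.snd ℝ Space ℝ := by fun_prop
  exact (ContinuousLinearMap.prodₗᵢ (𝕜 := ℝ) (E := Space × ℝ) (F := Space) (G := ℝ)
    ℝ).continuous.comp (h1.prodMk h2)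

theorem norm_coneShift_le (ξ : Cone) : ‖coneShift ξ‖ ≤ 2 := by
  refine ContinuousLinearMap.opNorm_le_bound _ zero_le_two fun z => ?_
  have h0 := ξ.1.2.1
  have h1 := ξ.1.2.2
  have e1 : ‖z.1‖ ≤ ‖z‖ := norm_fst_le z
  have e2 : |z.2| ≤ ‖z‖ := norm_snd_le z
  rw [coneShift_apply, Prod.norm_def]
  refine max_le ?_ ?_
  · refine (norm_add_le _ _).trans ?_
    rw [norm_smul, norm_smul, norm_coe_sph, mul_one, Real.norm_of_nonneg (sub_nonneg.2 h1),
      Real.norm_eq_abs]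
    nlinarith [abs_nonneg z.2]
  · rw [norm_mul, Real.norm_of_nonneg h0, Real.norm_eq_abs]
    nlinarith [abs_nonneg z.2]

/-- `4π` times the retarded potential of `w`, as an integral over the scaled light cone. -/
def retard (w : Space × ℝ → ℝ) (z : Space × ℝ) : ℝ :=
  z.2 ^ 2 * ∫ ξ : Cone, (1 - (ξ.1 : ℝ)) * w (coneShift ξ z) ∂coneMeas

theorem continuous_comp_coneShift {F : Type*} [TopologicalSpace F] {w : Space × ℝ → F}
    (hw : Continuous w) (z : Space × ℝ) : Continuous fun ξ : Cone => w (coneShift ξ z) :=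
  hw.comp (continuous_coneShift.clm_apply continuous_const)

theorem integral_cone_fst {φ : ℝ → ℝ} (hφ : Continuous φ) :
    ∫ ξ : Cone, φ ξ.1 ∂coneMeas = 4 * Real.pi * ∫ σ in (0 : ℝ)..1, φ σ := by
  rw [integral_prod _ (integrable_of_continuous (by fun_prop))]
  simp only [integral_surf_const]
  rw [integral_const_mul, intervalIntegral.integral_of_le zero_le_one,
    ← integral_Icc_eq_integral_Ioc, ← integral_subtype_comap measurableSet_Icc]
  rfl

/-- Substitution `s = tσ`: one factor `t` comes from `ds` and one from `t - s`. The scaled form has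
a domain of integration independent of `(x, t)`, which makes the potential `C¹` on all of
space-time, negative times included. -/
theorem retard_eq {w : Space × ℝ → ℝ} (hw : Continuous w) (x : Space) (t : ℝ) :
    retard w (x, t) = ∫ s in (0 : ℝ)..t, (t - s) * ∫ η : Sph, w (x + (t - s) • (η : Space), s)
      ∂surf := by
  have hc : Continuous fun ξ : Cone => (1 - (ξ.1 : ℝ)) * w (coneShift ξ (x, t)) :=
    Continuous.mul (by fun_prop) (continuous_comp_coneShift hw _)
  rw [retard, integral_prod _ (integrable_of_continuous hc)]
  have e1 : ∀ σ : unitInterval, (∫ η : Sph, (1 - (σ : ℝ)) * w (coneShift (σ, η) (x, t)) ∂surf)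
      = (fun σ : ℝ => (1 - σ) * ∫ η : Sph, w (x + (t - t * σ) • (η : Space), t * σ) ∂surf) σ := by
    intro σ
    simp only []
    rw [integral_const_mul]
    congr 2
    ext η
    rw [coneShift_apply]
    simp only [smul_smul]
    rw [mul_comm t, show (1 - (σ : ℝ)) * t = t - σ * t by ring]
  simp only [e1]
  have e2 : (∫ σ : unitInterval, (fun σ : ℝ => (1 - σ) *
      ∫ η : Sph, w (x + (t - t * σ) • (η : Space), t * σ) ∂surf) σ)
      = ∫ σ in (0 : ℝ)..1, (1 - σ) *
        ∫ η : Sph, w (x + (t - t * σ) • (η : Space), t * σ) ∂surf := by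
    rw [intervalIntegral.integral_of_le zero_le_one, ← integral_Icc_eq_integral_Ioc,
      ← integral_subtype_comap measurableSet_Icc]
    rfl
  rw [e2]
  have e3 := intervalIntegral.smul_integral_comp_mul_left (a := 0) (b := 1)
    (fun s => (t - s) * ∫ η : Sph, w (x + (t - s) • (η : Space), s) ∂surf) t
  rw [mul_zero, mul_one] at e3
  rw [← e3, smul_eq_mul, pow_two, mul_assoc, ← intervalIntegral.integral_const_mul]
  congr 1
  refine intervalIntegral.integral_congr fun σ _ => ?_
  ring

/-- Only source times in `[0, t]` matter, so the weighted source may be extended to other times in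
any continuous way. -/
theorem opL_eq_retard {p : ℝ} {w : Space → ℝ → ℝ} {W : Space × ℝ → ℝ} (hW : Continuous W)
    {x : Space} {t : ℝ} (ht : 0 ≤ t)
    (h : ∀ y : Space, ∀ s ∈ Icc 0 t, W (y, s) = 1 / (4 * Real.pi) * ((1 + s) ^ (-(p - 1)) * w y s)) :
    opL p w x t = retard W (x, t) := by
  rw [retard_eq hW, opL, ← intervalIntegral.integral_const_mul]
  refine intervalIntegral.integral_congr fun s hs => ?_
  rw [uIcc_of_le ht] at hs
  simp only [h _ s hs, integral_const_mul]
  ring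

theorem contDiff_retard {w : Space × ℝ → ℝ} (hw : ContDiff ℝ 1 w) : ContDiff ℝ 1 (retard w) := by
  have hB : Continuous fun ξ : Cone => (1 - (ξ.1 : ℝ)) • ContinuousLinearMap.id ℝ ℝ := by fun_prop
  have h := contDiff_integral_comp_clm (μ := coneMeas) continuous_coneShift 1 hB hw
  exact (contDiff_snd.pow 2).mul h

theorem retard_sub {v w : Space × ℝ → ℝ} (hv : Continuous v) (hw : Continuous w) (z : Space × ℝ) :
    retard v z - retard w z = retard (fun z => v z - w z) z := by
  simp only [retard, mul_sub]
  rw [integral_sub, mul_sub]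
  · exact integrable_of_continuous (Continuous.mul (by fun_prop) (continuous_comp_coneShift hv z))
  · exact integrable_of_continuous (Continuous.mul (by fun_prop) (continuous_comp_coneShift hw z))

/-- This bound and the next supply the gains `1/l` and `1/l²` of the potential against the weight
`exp(l|t|)`. Large `l` then makes the Picard map contract without restriction on time. -/
theorem integral_exp_le {a l : ℝ} (hl : 0 < l) :
    ∫ ξ : Cone, a * Real.exp (l * (ξ.1 * a)) ∂coneMeas ≤ 4 * Real.pi * (Real.exp (l * a) / l) := by
  rw [integral_cone_fst (φ := fun σ => a * Real.exp (l * (σ * a))) (by fun_prop)]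
  have hd : ∀ σ ∈ uIcc (0 : ℝ) 1, HasDerivAt (fun σ => Real.exp (l * (σ * a)) / l)
      (a * Real.exp (l * (σ * a))) σ := by
    intro σ _
    have := ((((hasDerivAt_id σ).mul_const a).const_mul l).exp).div_const l
    refine this.congr_deriv ?_
    simp only [id]
    field_simp
  rw [intervalIntegral.integral_eq_sub_of_hasDerivAt hd (Continuous.intervalIntegrable
    (by fun_prop) _ _)]
  have hpi := Real.pi_pos
  gcongr
  rw [one_mul, sub_le_self_iff]
  positivity

theorem integral_sq_exp_le {a l : ℝ} (ha : 0 ≤ a) (hl : 0 < l) :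
    ∫ ξ : Cone, a ^ 2 * (1 - (ξ.1 : ℝ)) * Real.exp (l * (ξ.1 * a)) ∂coneMeas
      ≤ 4 * Real.pi * (Real.exp (l * a) / l ^ 2) := by
  rw [integral_cone_fst (φ := fun σ => a ^ 2 * (1 - σ) * Real.exp (l * (σ * a))) (by fun_prop)]
  have hd : ∀ σ ∈ uIcc (0 : ℝ) 1, HasDerivAt
      (fun σ => a * (1 - σ) * (Real.exp (l * (σ * a)) / l) + Real.exp (l * (σ * a)) / l ^ 2)
      (a ^ 2 * (1 - σ) * Real.exp (l * (σ * a))) σ := by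
    intro σ _
    have h1 := (((hasDerivAt_id σ).mul_const a).const_mul l).exp
    have := ((((hasDerivAt_id σ).const_sub 1).const_mul a).mul (h1.div_const l)).add
      (h1.div_const (l ^ 2))
    refine this.congr_deriv ?_
    simp only [id]
    field_simp
    ring
  rw [intervalIntegral.integral_eq_sub_of_hasDerivAt hd (Continuous.intervalIntegrable
    (by fun_prop) _ _)]
  have hpi := Real.pi_pos
  gcongr
  simp only [sub_self, mul_zero, zero_mul, one_mul, zero_add, sub_zero, mul_one]
  rw [sub_le_self_iff]
  positivity

theorem abs_retard_le {w : Space × ℝ → ℝ} {z : Space × ℝ} {B l : ℝ} (hl : 0 < l)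
    (hw : ∀ ξ : Cone, |w (coneShift ξ z)| ≤ B * Real.exp (l * |(coneShift ξ z).2|)) :
    |retard w z| ≤ 4 * Real.pi / l ^ 2 * B * Real.exp (l * |z.2|) := by
  have hb : ∀ ξ : Cone, ‖z.2 ^ 2 * ((1 - (ξ.1 : ℝ)) * w (coneShift ξ z))‖
      ≤ B * (|z.2| ^ 2 * (1 - (ξ.1 : ℝ)) * Real.exp (l * (ξ.1 * |z.2|))) := by
    intro ξ
    have h := hw ξ
    have h0 := ξ.1.2.1
    have h1 := sub_nonneg.2 ξ.1.2.2
    rw [coneShift_apply, abs_mul, abs_of_nonneg h0, ← coneShift_apply] at h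
    rw [Real.norm_eq_abs, abs_mul, abs_mul, abs_of_nonneg h1, abs_pow]
    calc _ ≤ |z.2| ^ 2 * ((1 - (ξ.1 : ℝ)) * (B * Real.exp (l * (ξ.1 * |z.2|)))) := by gcongr
      _ = _ := by ring
  have hB : 0 ≤ B := by
    have := (abs_nonneg _).trans (hw (1, ⟨EuclideanSpace.single 0 1, by simp⟩))
    exact nonneg_of_mul_nonneg_left this (Real.exp_pos _)
  rw [retard, ← integral_const_mul, ← Real.norm_eq_abs]
  refine (norm_integral_le_of_norm_le (integrable_of_continuous (by fun_prop))
    (ae_of_all _ hb)).trans ?_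
  rw [integral_const_mul]
  calc _ ≤ B * (4 * Real.pi * (Real.exp (l * |z.2|) / l ^ 2)) := by
        gcongr; exact integral_sq_exp_le (abs_nonneg _) hl
    _ = _ := by ring

/-- Product rule for `t²` times the cone integral. Differentiating the source keeps `t²` and gains
`1/l²`, with a factor 2 from `norm_coneShift_le`; differentiating `t²` leaves `2t` and gains only
`1/l`. -/
theorem norm_fderiv_retard_le {w : Space × ℝ → ℝ} (hwc : ContDiff ℝ 1 w) {z : Space × ℝ}
    {B B' l : ℝ} (hl : 1 ≤ l)
    (hw : ∀ ξ : Cone, |w (coneShift ξ z)| ≤ B * Real.exp (l * |(coneShift ξ z).2|))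
    (hw' : ∀ ξ : Cone, ‖fderiv ℝ w (coneShift ξ z)‖ ≤ B' * Real.exp (l * |(coneShift ξ z).2|)) :
    ‖fderiv ℝ (retard w) z‖ ≤ 8 * Real.pi / l * (B + B') * Real.exp (l * |z.2|) := by
  have hl0 : 0 < l := by linarith
  have hB : Continuous fun ξ : Cone => (1 - (ξ.1 : ℝ)) • ContinuousLinearMap.id ℝ ℝ := by fun_prop
  have hI := hasFDerivAt_integral_comp_clm (μ := coneMeas) continuous_coneShift hB hwc z
  have hd := (((hasFDerivAt_snd (𝕜 := ℝ) (E := Space) (F := ℝ) (p := z)).pow 2)).mul hI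
  have hd' : HasFDerivAt (retard w) _ z := hd
  rw [hd'.fderiv]
  have h00 : ∀ ξ : Cone, 0 ≤ (ξ.1 : ℝ) := fun ξ => ξ.1.2.1
  have h11 : ∀ ξ : Cone, 0 ≤ 1 - (ξ.1 : ℝ) := fun ξ => sub_nonneg.2 ξ.1.2.2
  have hs2 : ∀ ξ : Cone, |(coneShift ξ z).2| = ξ.1 * |z.2| := fun ξ => by
    rw [coneShift_apply, abs_mul, abs_of_nonneg (h00 ξ)]
  simp only [hs2] at hw hw'
  let ξ₀ : Cone := (1, ⟨EuclideanSpace.single 0 1, by simp⟩)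
  have hB0 : 0 ≤ B := nonneg_of_mul_nonneg_left ((abs_nonneg _).trans (hw ξ₀)) (Real.exp_pos _)
  have hB1 : 0 ≤ B' := nonneg_of_mul_nonneg_left ((norm_nonneg _).trans (hw' ξ₀)) (Real.exp_pos _)
  have hpi := Real.pi_pos
  set D := ∫ ξ : Cone, ((1 - (ξ.1 : ℝ)) • ContinuousLinearMap.id ℝ ℝ).comp
    ((fderiv ℝ w (coneShift ξ z)).comp (coneShift ξ)) ∂coneMeas with hD
  set J := ∫ ξ : Cone, ((1 - (ξ.1 : ℝ)) • ContinuousLinearMap.id ℝ ℝ) (w (coneShift ξ z))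
    ∂coneMeas with hJ
  have b1 : ‖z.2 ^ 2 • D‖ ≤ 2 * B' * (4 * Real.pi * (Real.exp (l * |z.2|) / l ^ 2)) := by
    rw [hD, ← integral_smul]
    refine (norm_integral_le_of_norm_le (g := fun ξ : Cone => 2 * B' * (|z.2| ^ 2 * (1 - (ξ.1 : ℝ))
      * Real.exp (l * (ξ.1 * |z.2|)))) (integrable_of_continuous (by fun_prop))
      (ae_of_all _ fun ξ => ?_)).trans ?_
    · rw [norm_smul, norm_pow, Real.norm_eq_abs]
      have c1 : ‖((1 - (ξ.1 : ℝ)) • ContinuousLinearMap.id ℝ ℝ).comp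
          ((fderiv ℝ w (coneShift ξ z)).comp (coneShift ξ))‖
          ≤ (1 - (ξ.1 : ℝ)) * (B' * Real.exp (l * (ξ.1 * |z.2|)) * 2) := by
        refine (ContinuousLinearMap.opNorm_comp_le _ _).trans ?_
        have : ‖(1 - (ξ.1 : ℝ)) • ContinuousLinearMap.id ℝ ℝ‖ ≤ 1 - (ξ.1 : ℝ) := by
          rw [norm_smul, Real.norm_of_nonneg (h11 ξ), ContinuousLinearMap.norm_id, mul_one]
        refine mul_le_mul this ((ContinuousLinearMap.opNorm_comp_le _ _).trans
          (mul_le_mul (hw' ξ) (norm_coneShift_le ξ) (norm_nonneg _) (by positivity)))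
          (norm_nonneg _) (h11 ξ)
      calc _ ≤ |z.2| ^ 2 * ((1 - (ξ.1 : ℝ)) * (B' * Real.exp (l * (ξ.1 * |z.2|)) * 2)) := by gcongr
        _ = _ := by ring
    · rw [integral_const_mul]
      gcongr
      exact integral_sq_exp_le (abs_nonneg _) hl0
  have b2 : |z.2| * |J| ≤ B * (4 * Real.pi * (Real.exp (l * |z.2|) / l)) := by
    rw [← abs_mul, hJ, ← integral_const_mul, ← Real.norm_eq_abs]
    refine (norm_integral_le_of_norm_le (g := fun ξ : Cone => B * (|z.2|
      * Real.exp (l * (ξ.1 * |z.2|)))) (integrable_of_continuous (by fun_prop))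
      (ae_of_all _ fun ξ => ?_)).trans ?_
    · simp only [smul_apply, ContinuousLinearMap.id_apply, smul_eq_mul, norm_mul, Real.norm_eq_abs]
      rw [abs_of_nonneg (h11 ξ)]
      calc _ ≤ |z.2| * (1 * (B * Real.exp (l * (ξ.1 * |z.2|)))) := by
            have := h00 ξ
            gcongr
            · linarith
            · exact hw ξ
        _ = _ := by ring
    · rw [integral_const_mul]
      gcongr
      exact integral_exp_le hl0
  have b3 : ‖J • ((2 • z.2 ^ (2 - 1)) • ContinuousLinearMap.snd ℝ Space ℝ)‖ ≤ 2 * (|z.2| * |J|) := by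
    rw [norm_smul, norm_smul, Real.norm_eq_abs]
    have : ‖ContinuousLinearMap.snd ℝ Space ℝ‖ ≤ 1 := ContinuousLinearMap.norm_snd_le _ _ _
    calc _ ≤ |J| * (‖2 • z.2 ^ (2 - 1)‖ * 1) := by gcongr
      _ = _ := by
        norm_num
        ring
  refine (norm_add_le _ _).trans ((add_le_add b1 (b3.trans
    (mul_le_mul_of_nonneg_left b2 zero_le_two))).trans ?_)
  have hl2 : Real.exp (l * |z.2|) / l ^ 2 ≤ Real.exp (l * |z.2|) / l := by
    gcongr
    nlinarith
  calc _ ≤ 2 * B' * (4 * Real.pi * (Real.exp (l * |z.2|) / l))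
        + 2 * (B * (4 * Real.pi * (Real.exp (l * |z.2|) / l))) := by gcongr
    _ = _ := by ring

/-! ### Picard iteration for globally Lipschitz nonlinearities -/

/-- A `C¹` time weight `c`, bounded with its derivative by `1`, and a globally Lipschitz
nonlinearity `F` whose derivative is Hölder continuous. -/
structure Admissible (c F : ℝ → ℝ) (K H q : ℝ) : Prop where
  contDiff_weight : ContDiff ℝ 1 c
  abs_weight_le : ∀ s, |c s| ≤ 1
  abs_deriv_weight_le : ∀ s, |deriv c s| ≤ 1
  contDiff : ContDiff ℝ 1 F
  map_zero : F 0 = 0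
  abs_deriv_le : ∀ v, |deriv F v| ≤ K
  holder : ∀ v w, |deriv F v - deriv F w| ≤ H * |v - w| ^ q
  one_le : 1 ≤ K
  nonneg : 0 ≤ H
  exponent_pos : 0 < q
  exponent_le : q ≤ 1

/-- The source term `c(t) F(u(x, t))`. -/
def source (c F : ℝ → ℝ) (u : Space × ℝ → ℝ) (z : Space × ℝ) : ℝ := c z.2 * F (u z)

/-- Picard iterates for `u = u₀ + retard (c F(u))`. -/
def picard (c F : ℝ → ℝ) (u₀ : Space × ℝ → ℝ) : ℕ → Space × ℝ → ℝ
  | 0 => u₀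
  | n + 1 => fun z => u₀ z + retard (source c F (picard c F u₀ n)) z

namespace Admissible

variable {c F : ℝ → ℝ} {K H q : ℝ} (h : Admissible c F K H q)

include h

theorem abs_sub_le (v w : ℝ) : |F v - F w| ≤ K * |v - w| := by
  have := convex_univ.norm_image_sub_le_of_norm_deriv_le (f := F) (C := K)
    (fun x _ => h.contDiff.differentiable one_ne_zero x)
    (fun x _ => h.abs_deriv_le x) (mem_univ w) (mem_univ v)
  simpa using this

theorem abs_le (v : ℝ) : |F v| ≤ K * |v| := by
  simpa [h.map_zero] using h.abs_sub_le v 0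

theorem contDiff_source {u : Space × ℝ → ℝ} (hu : ContDiff ℝ 1 u) :
    ContDiff ℝ 1 (source c F u) :=
  (h.contDiff_weight.comp contDiff_snd).mul (h.contDiff.comp hu)

theorem abs_source_le (u : Space × ℝ → ℝ) (z : Space × ℝ) : |source c F u z| ≤ K * |u z| := by
  rw [source, abs_mul]
  have := mul_le_mul (h.abs_weight_le z.2) (h.abs_le (u z)) (abs_nonneg _) zero_le_one
  linarith

theorem abs_source_sub_le (u v : Space × ℝ → ℝ) (z : Space × ℝ) :
    |source c F u z - source c F v z| ≤ K * |u z - v z| := by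
  rw [source, source, ← mul_sub, abs_mul]
  have := mul_le_mul (h.abs_weight_le z.2) (h.abs_sub_le (u z) (v z)) (abs_nonneg _) zero_le_one
  linarith

theorem fderiv_source {u : Space × ℝ → ℝ} (hu : ContDiff ℝ 1 u) (z : Space × ℝ) :
    fderiv ℝ (source c F u) z = (c z.2 * deriv F (u z)) • fderiv ℝ u z
      + (F (u z) * deriv c z.2) • ContinuousLinearMap.snd ℝ Space ℝ := by
  have h1 : HasFDerivAt (fun z : Space × ℝ => c z.2)
      (deriv c z.2 • ContinuousLinearMap.snd ℝ Space ℝ) z :=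
    ((h.contDiff_weight.differentiable one_ne_zero z.2).hasDerivAt).comp_hasFDerivAt z
      hasFDerivAt_snd
  have h2 : HasFDerivAt (fun z => F (u z)) (deriv F (u z) • fderiv ℝ u z) z :=
    ((h.contDiff.differentiable one_ne_zero (u z)).hasDerivAt).comp_hasFDerivAt z
      (hu.differentiable one_ne_zero z).hasFDerivAt
  refine (HasFDerivAt.fderiv (h1.mul h2)).trans ?_
  rw [smul_smul, smul_smul]

theorem norm_fderiv_source_le {u : Space × ℝ → ℝ} (hu : ContDiff ℝ 1 u) (z : Space × ℝ) :
    ‖fderiv ℝ (source c F u) z‖ ≤ K * (|u z| + ‖fderiv ℝ u z‖) := by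
  rw [h.fderiv_source hu]
  refine (norm_add_le _ _).trans ?_
  rw [norm_smul, norm_smul, norm_mul, norm_mul]
  simp only [Real.norm_eq_abs]
  have hK := h.one_le
  have h1 : |c z.2| * |deriv F (u z)| ≤ 1 * K :=
    mul_le_mul (h.abs_weight_le _) (h.abs_deriv_le _) (abs_nonneg _) zero_le_one
  have h2 : |F (u z)| * |deriv c z.2| ≤ K * |u z| * 1 :=
    mul_le_mul (h.abs_le _) (h.abs_deriv_weight_le _) (abs_nonneg _) (by positivity)
  have h3 : ‖ContinuousLinearMap.snd ℝ Space ℝ‖ ≤ 1 := ContinuousLinearMap.norm_snd_le _ _ _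
  calc _ ≤ 1 * K * ‖fderiv ℝ u z‖ + K * |u z| * 1 * 1 := by gcongr
    _ = _ := by ring

/-- The middle term is the price of a derivative `F'` that is merely Hölder: differences of
gradients are controlled through a power `q` of the difference of the functions, times a gradient.
-/
theorem norm_fderiv_source_sub_le {u v : Space × ℝ → ℝ} (hu : ContDiff ℝ 1 u)
    (hv : ContDiff ℝ 1 v) (z : Space × ℝ) :
    ‖fderiv ℝ (source c F u) z - fderiv ℝ (source c F v) z‖
      ≤ K * ‖fderiv ℝ u z - fderiv ℝ v z‖ + H * |u z - v z| ^ q * ‖fderiv ℝ v z‖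
        + K * |u z - v z| := by
  have hK := h.one_le
  have hH := h.nonneg
  rw [h.fderiv_source hu, h.fderiv_source hv]
  have e : (c z.2 * deriv F (u z)) • fderiv ℝ u z
      + (F (u z) * deriv c z.2) • ContinuousLinearMap.snd ℝ Space ℝ
      - ((c z.2 * deriv F (v z)) • fderiv ℝ v z
      + (F (v z) * deriv c z.2) • ContinuousLinearMap.snd ℝ Space ℝ)
      = (c z.2 * deriv F (u z)) • (fderiv ℝ u z - fderiv ℝ v z)
      + (c z.2 * (deriv F (u z) - deriv F (v z))) • fderiv ℝ v z
      + ((F (u z) - F (v z)) * deriv c z.2) • ContinuousLinearMap.snd ℝ Space ℝ := by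
    module
  rw [e]
  refine (norm_add₃_le).trans ?_
  rw [norm_smul, norm_smul, norm_smul, norm_mul, norm_mul, norm_mul]
  simp only [Real.norm_eq_abs]
  have h1 : |c z.2| * |deriv F (u z)| ≤ 1 * K :=
    mul_le_mul (h.abs_weight_le _) (h.abs_deriv_le _) (abs_nonneg _) zero_le_one
  have h2 : |F (u z) - F (v z)| * |deriv c z.2| ≤ K * |u z - v z| * 1 :=
    mul_le_mul (h.abs_sub_le _ _) (h.abs_deriv_weight_le _) (abs_nonneg _) (by positivity)
  have h4 : |c z.2| * |deriv F (u z) - deriv F (v z)| ≤ 1 * (H * |u z - v z| ^ q) :=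
    mul_le_mul (h.abs_weight_le _) (h.holder _ _) (abs_nonneg _) zero_le_one
  have h3 : ‖ContinuousLinearMap.snd ℝ Space ℝ‖ ≤ 1 := ContinuousLinearMap.norm_snd_le _ _ _
  calc _ ≤ 1 * K * ‖fderiv ℝ u z - fderiv ℝ v z‖ + 1 * (H * |u z - v z| ^ q) * ‖fderiv ℝ v z‖
        + K * |u z - v z| * 1 * 1 := by gcongr
    _ = _ := by ring

variable {u₀ : Space × ℝ → ℝ} (hu₀ : ContDiff ℝ 1 u₀)

include hu₀

theorem contDiff_picard : ∀ n, ContDiff ℝ 1 (picard c F u₀ n)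
  | 0 => hu₀
  | n + 1 => hu₀.add (contDiff_retard (h.contDiff_source (contDiff_picard n)))

theorem picard_succ_sub (n : ℕ) (z : Space × ℝ) :
    picard c F u₀ (n + 2) z - picard c F u₀ (n + 1) z
      = retard (fun z => source c F (picard c F u₀ (n + 1)) z - source c F (picard c F u₀ n) z)
        z := by
  rw [← retard_sub (h.contDiff_source (h.contDiff_picard hu₀ _)).continuous
    (h.contDiff_source (h.contDiff_picard hu₀ _)).continuous]
  simp [picard]

variable {B l : ℝ} (hB : ∀ z, |u₀ z| ≤ B) (hl : 64 * Real.pi * K ≤ l)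

include hB hl

omit hu₀ hB in
theorem rate_pos : 1 ≤ l := by
  have := Real.pi_gt_three
  have := h.one_le
  nlinarith

omit hu₀ hB in
theorem gain_le : 4 * Real.pi / l ^ 2 * K ≤ 1 / 2 := by
  have hl1 := h.rate_pos hl
  have := Real.pi_gt_three
  rw [div_mul_eq_mul_div, div_le_iff₀ (by positivity)]
  nlinarith

omit hu₀ in
theorem abs_picard_le : ∀ n z, |picard c F u₀ n z| ≤ 2 * B * Real.exp (l * |z.2|) := by
  have hl1 := h.rate_pos hl
  intro n
  have hB0 : 0 ≤ B := (abs_nonneg _).trans (hB 0)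
  have hexp : ∀ z : Space × ℝ, 1 ≤ Real.exp (l * |z.2|) := fun z =>
    Real.one_le_exp (by positivity)
  induction n with
  | zero => intro z; have := hB z; have := hexp z; simp only [picard]; nlinarith
  | succ n ih =>
    intro z
    have hr := abs_retard_le (w := source c F (picard c F u₀ n)) (z := z) (B := K * (2 * B))
      (l := l) (by linarith) fun ξ => by
        refine (h.abs_source_le _ _).trans ?_
        rw [mul_assoc]
        exact mul_le_mul_of_nonneg_left (ih _) (by linarith [h.one_le])
    have h2 := abs_add_le (u₀ z) (retard (source c F (picard c F u₀ n)) z)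
    have hg := h.gain_le hl
    have := hB z
    have he := hexp z
    simp only [picard]
    have h3 : 4 * Real.pi / l ^ 2 * (K * (2 * B)) * Real.exp (l * |z.2|)
        ≤ B * Real.exp (l * |z.2|) := by
      have : 4 * Real.pi / l ^ 2 * (K * (2 * B)) ≤ B := by
        calc _ = 4 * Real.pi / l ^ 2 * K * (2 * B) := by ring
          _ ≤ 1 / 2 * (2 * B) := by gcongr
          _ = B := by ring
      gcongr
    nlinarith

theorem abs_picard_sub_le : ∀ n z, |picard c F u₀ (n + 1) z - picard c F u₀ n z|
    ≤ B * (1 / 2) ^ n * Real.exp (l * |z.2|) := by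
  have hl1 := h.rate_pos hl
  have hg := h.gain_le hl
  have hB0 : 0 ≤ B := (abs_nonneg _).trans (hB 0)
  intro n
  induction n with
  | zero =>
    intro z
    have hr := abs_retard_le (w := source c F u₀) (z := z) (B := K * B)
      (l := l) (by linarith) fun ξ => by
        refine (h.abs_source_le _ _).trans ?_
        have hK := h.one_le
        have h1 : 1 ≤ Real.exp (l * |(coneShift ξ z).2|) := Real.one_le_exp (by positivity)
        calc K * |u₀ (coneShift ξ z)| ≤ K * B := by gcongr; exact hB _
          _ ≤ _ := le_mul_of_one_le_right (by positivity) h1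
    simp only [picard, add_sub_cancel_left, pow_zero, mul_one]
    refine hr.trans ?_
    gcongr
    nlinarith
  | succ n ih =>
    intro z
    rw [h.picard_succ_sub hu₀]
    have hr := abs_retard_le (w := fun z => source c F (picard c F u₀ (n + 1)) z
      - source c F (picard c F u₀ n) z) (z := z) (B := K * (B * (1 / 2) ^ n))
      (l := l) (by linarith) fun ξ => by
        refine (h.abs_source_sub_le _ _ _).trans ?_
        rw [mul_assoc K]
        exact mul_le_mul_of_nonneg_left (ih _) (by linarith [h.one_le])
    refine hr.trans (mul_le_mul_of_nonneg_right ?_ (Real.exp_pos _).le)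
    rw [← mul_assoc, pow_succ (1 / 2 : ℝ)]
    calc _ ≤ 1 / 2 * (B * (1 / 2) ^ n) := by gcongr
      _ = _ := by ring

variable (hB' : ∀ z, ‖fderiv ℝ u₀ z‖ ≤ B)

include hB'

-- The constant `64π` in `hl` is fixed here. In the gradient bound, the previous iterate contributes
-- `K (2B + 6B)`, and the gain `1/8` reduces this to the `B` that is available.
omit hu₀ hB hB' in
theorem gain_fderiv_le : 8 * Real.pi / l * K ≤ 1 / 8 := by
  have hl1 := h.rate_pos hl
  rw [div_mul_eq_mul_div, div_le_iff₀ (by positivity)]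
  linarith

theorem norm_fderiv_picard_le : ∀ n z,
    ‖fderiv ℝ (picard c F u₀ n) z‖ ≤ 4 * B * Real.exp (l * |z.2|) := by
  have hl1 := h.rate_pos hl
  have hg := h.gain_fderiv_le hl
  have hB0 : 0 ≤ B := (abs_nonneg _).trans (hB 0)
  have hexp : ∀ z : Space × ℝ, 1 ≤ Real.exp (l * |z.2|) := fun z =>
    Real.one_le_exp (by positivity)
  have hK := h.one_le
  intro n
  induction n with
  | zero => intro z; have := hB' z; have := hexp z; simp only [picard]; nlinarith
  | succ n ih =>
    intro z
    have hc := h.contDiff_picard hu₀ n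
    have hsum : fderiv ℝ (picard c F u₀ (n + 1)) z
        = fderiv ℝ u₀ z + fderiv ℝ (retard (source c F (picard c F u₀ n))) z :=
      fderiv_add (hu₀.differentiable one_ne_zero z)
        ((contDiff_retard (h.contDiff_source hc)).differentiable one_ne_zero z)
    have hr := norm_fderiv_retard_le (h.contDiff_source hc) (z := z) (B := K * (2 * B))
      (B' := K * (6 * B)) hl1
      (fun ξ => by
        refine (h.abs_source_le _ _).trans ?_
        rw [mul_assoc]
        exact mul_le_mul_of_nonneg_left (h.abs_picard_le hB hl n _) (by linarith))
      (fun ξ => by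
        refine (h.norm_fderiv_source_le hc _).trans ?_
        rw [mul_assoc]
        refine mul_le_mul_of_nonneg_left ?_ (by linarith)
        have e1 := h.abs_picard_le hB hl n (coneShift ξ z)
        have e2 := ih (coneShift ξ z)
        linarith)
    rw [hsum]
    refine (norm_add_le _ _).trans ?_
    have := hB' z
    have he := hexp z
    have h3 : 8 * Real.pi / l * (K * (2 * B) + K * (6 * B)) * Real.exp (l * |z.2|)
        ≤ B * Real.exp (l * |z.2|) := by
      gcongr
      calc _ = 8 * Real.pi / l * K * (8 * B) := by ring
        _ ≤ 1 / 8 * (8 * B) := by gcongr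
        _ = B := by ring
    nlinarith

/-- The Hölder term converts the rate `1/2` of the iterates into `θ = (1/2)^q`, and its product with
a gradient doubles the exponential weight. In the constant, `8B` covers the first step and `4HB²` is
the coefficient of the Hölder term; `1 ≤ B` is used for `B^q ≤ B`. The induction closes because the
gain is at most `1/16` and `θ ≥ 1/2`. -/
theorem norm_fderiv_picard_sub_le (hB1 : 1 ≤ B) : ∀ n z,
    ‖fderiv ℝ (picard c F u₀ (n + 1)) z - fderiv ℝ (picard c F u₀ n) z‖
      ≤ (8 * B + 4 * H * B ^ 2) * ((1 / 2) ^ q) ^ n * Real.exp (2 * l * |z.2|) := by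
  have hl1 := h.rate_pos hl
  have hg := h.gain_fderiv_le hl
  have hK := h.one_le
  have hH := h.nonneg
  have hq := h.exponent_pos
  have hq1 := h.exponent_le
  have hexp : ∀ z : Space × ℝ, Real.exp (l * |z.2|) ≤ Real.exp (2 * l * |z.2|) := fun z => by
    gcongr
    linarith
  have hhalf : (1 / 2 : ℝ) ≤ (1 / 2) ^ q := by
    simpa using Real.rpow_le_rpow_of_exponent_ge (x := 1 / 2) (by norm_num) (by norm_num) hq1
  set θ : ℝ := (1 / 2) ^ q with hθ
  have hθ0 : 0 < θ := by positivity
  set M := 8 * B + 4 * H * B ^ 2 with hM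
  intro n
  induction n with
  | zero =>
    intro z
    have e1 := h.norm_fderiv_picard_le hu₀ hB hl hB' 1 z
    have e0 := h.norm_fderiv_picard_le hu₀ hB hl hB' 0 z
    refine (norm_sub_le _ _).trans ((add_le_add e1 e0).trans ?_)
    have : 0 ≤ 4 * H * B ^ 2 := by positivity
    have he := hexp z
    have hp := Real.exp_pos (l * |z.2|)
    rw [pow_zero, mul_one]
    calc _ = 8 * B * Real.exp (l * |z.2|) := by ring
      _ ≤ M * Real.exp (2 * l * |z.2|) := by gcongr; linarith
  | succ n ih =>
    intro z
    have hc := h.contDiff_picard hu₀ n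
    have hc1 := h.contDiff_picard hu₀ (n + 1)
    set w : Space × ℝ → ℝ := fun z => source c F (picard c F u₀ (n + 1)) z
      - source c F (picard c F u₀ n) z with hw
    have hwc : ContDiff ℝ 1 w := (h.contDiff_source hc1).sub (h.contDiff_source hc)
    have hsum : fderiv ℝ (picard c F u₀ (n + 2)) z - fderiv ℝ (picard c F u₀ (n + 1)) z
        = fderiv ℝ (retard w) z := by
      have : (fun z => picard c F u₀ (n + 2) z - picard c F u₀ (n + 1) z) = retard w :=
        funext fun z => h.picard_succ_sub hu₀ n z
      rw [← this]
      exact (fderiv_sub ((h.contDiff_picard hu₀ (n + 2)).differentiable one_ne_zero z)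
        (hc1.differentiable one_ne_zero z)).symm
    have hpow : (1 / 2 : ℝ) ^ n ≤ θ ^ n := by gcongr
    have hdiff : ∀ y : Space × ℝ, |picard c F u₀ (n + 1) y - picard c F u₀ n y|
        ≤ B * θ ^ n * Real.exp (2 * l * |y.2|) := fun y =>
      (h.abs_picard_sub_le hu₀ hB hl n y).trans (by gcongr; linarith)
    have hhol : ∀ y : Space × ℝ, |picard c F u₀ (n + 1) y - picard c F u₀ n y| ^ q
        ≤ B * θ ^ n * Real.exp (l * |y.2|) := by
      intro y
      refine (Real.rpow_le_rpow (abs_nonneg _) (h.abs_picard_sub_le hu₀ hB hl n y) hq.le).trans ?_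
      rw [Real.mul_rpow (by positivity) (by positivity), Real.mul_rpow (by positivity)
        (by positivity)]
      have a1 : B ^ q ≤ B := by
        simpa using Real.rpow_le_rpow_of_exponent_le hB1 hq1
      have a2 : ((1 / 2 : ℝ) ^ n) ^ q = θ ^ n := by
        rw [hθ, ← Real.rpow_natCast, ← Real.rpow_natCast, ← Real.rpow_mul (by norm_num),
          ← Real.rpow_mul (by norm_num), mul_comm]
      have a3 : Real.exp (l * |y.2|) ^ q ≤ Real.exp (l * |y.2|) := by
        have := Real.rpow_le_rpow_of_exponent_le
          (Real.one_le_exp (by positivity : 0 ≤ l * |y.2|)) hq1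
        simpa using this
      rw [a2]
      gcongr
    have hr := norm_fderiv_retard_le hwc (z := z) (B := K * (B * θ ^ n))
      (B' := K * (M * θ ^ n) + 4 * H * B ^ 2 * θ ^ n + K * (B * θ ^ n)) (l := 2 * l) (by linarith)
      (fun ξ => by
        refine (h.abs_source_sub_le _ _ _).trans ?_
        rw [mul_assoc K]
        exact mul_le_mul_of_nonneg_left (hdiff _) (by linarith))
      (fun ξ => by
        set y := coneShift ξ z
        have hfd : fderiv ℝ w y = fderiv ℝ (source c F (picard c F u₀ (n + 1))) y
            - fderiv ℝ (source c F (picard c F u₀ n)) y :=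
          fderiv_sub ((h.contDiff_source hc1).differentiable one_ne_zero y)
            ((h.contDiff_source hc).differentiable one_ne_zero y)
        rw [hfd]
        refine (h.norm_fderiv_source_sub_le hc1 hc y).trans ?_
        have b1 := ih y
        have b2 := h.norm_fderiv_picard_le hu₀ hB hl hB' n y
        have b3 : Real.exp (l * |y.2|) * Real.exp (l * |y.2|) = Real.exp (2 * l * |y.2|) := by
          rw [← Real.exp_add]; congr 1; ring
        calc _ ≤ K * (M * θ ^ n * Real.exp (2 * l * |y.2|))
              + H * (B * θ ^ n * Real.exp (l * |y.2|)) * (4 * B * Real.exp (l * |y.2|))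
              + K * (B * θ ^ n * Real.exp (2 * l * |y.2|)) := by
              gcongr
              · exact hhol y
              · exact hdiff y
          _ = _ := by rw [← b3]; ring)
    rw [hsum]
    refine hr.trans (mul_le_mul_of_nonneg_right ?_ (Real.exp_pos _).le)
    have hBn : 0 < θ ^ n := by positivity
    have hHB : 0 ≤ 4 * H * B ^ 2 := by positivity
    have hMK : 4 * H * B ^ 2 ≤ K * (4 * H * B ^ 2) := le_mul_of_one_le_left hHB hK
    have hM0 : 0 ≤ M := by positivity
    have g2 : 8 * Real.pi / (2 * l) * K ≤ 1 / 16 := by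
      have : 8 * Real.pi / (2 * l) * K = 8 * Real.pi / l * K / 2 := by field_simp
      linarith
    have g3 : 0 ≤ 8 * Real.pi / (2 * l) := by positivity
    calc 8 * Real.pi / (2 * l) * (K * (B * θ ^ n) + (K * (M * θ ^ n) + 4 * H * B ^ 2 * θ ^ n
          + K * (B * θ ^ n)))
        = 8 * Real.pi / (2 * l) * ((K * (2 * B + M) + 4 * H * B ^ 2) * θ ^ n) := by ring
      _ ≤ 8 * Real.pi / (2 * l) * ((K * (2 * B + M) + K * (4 * H * B ^ 2)) * θ ^ n) := by gcongr
      _ = 8 * Real.pi / (2 * l) * K * ((2 * B + M + 4 * H * B ^ 2) * θ ^ n) := by ring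
      _ ≤ 1 / 16 * ((2 * B + M + 4 * H * B ^ 2) * θ ^ n) := by gcongr
      _ ≤ 1 / 16 * ((M + M + M) * θ ^ n) := by gcongr <;> linarith
      _ ≤ M * (1 / 2) * θ ^ n := by nlinarith
      _ ≤ M * θ * θ ^ n := by gcongr
      _ = M * θ ^ (n + 1) := by ring

end Admissible

theorem tendstoLocallyUniformlyOn_of_le {E G : Type*} [TopologicalSpace E] [PseudoMetricSpace G]
    {f : ℕ → E → G} {g : E → G} {M : E → ℝ} (hM : Continuous M) (hM0 : ∀ z, 0 ≤ M z) {a : ℕ → ℝ}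
    (ha : Tendsto a atTop (𝓝 0)) (hle : ∀ n z, dist (f n z) (g z) ≤ M z * a n) :
    TendstoLocallyUniformlyOn f g atTop univ := by
  rw [Metric.tendstoLocallyUniformlyOn_iff]
  intro ε hε x _
  refine ⟨{y | M y < M x + 1}, mem_nhdsWithin_of_mem_nhds
    (hM.continuousAt.eventually_lt continuousAt_const (by simp)), ?_⟩
  have h1 : Tendsto (fun n => (M x + 1) * |a n|) atTop (𝓝 0) := by
    simpa using ha.abs.const_mul (M x + 1)
  filter_upwards [h1.eventually (gt_mem_nhds hε)] with n hn y hy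
  rw [dist_comm]
  refine (hle n y).trans_lt (lt_of_le_of_lt ?_ hn)
  have hy' : M y < M x + 1 := hy
  have := hM0 y
  calc M y * a n ≤ M y * |a n| := by gcongr; exact le_abs_self _
    _ ≤ (M x + 1) * |a n| := by gcongr

/-- Global existence for the truncated equation: the Picard iterates converge to a `C¹` solution. -/
theorem Admissible.exists_solution {c F : ℝ → ℝ} {K H q : ℝ} (h : Admissible c F K H q)
    {u₀ : Space × ℝ → ℝ} (hu₀ : ContDiff ℝ 1 u₀) {B : ℝ} (hB : ∀ z, |u₀ z| ≤ B)
    (hB' : ∀ z, ‖fderiv ℝ u₀ z‖ ≤ B) :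
    ∃ u : Space × ℝ → ℝ, ContDiff ℝ 1 u ∧ (∀ z, u z = u₀ z + retard (source c F u) z) ∧
      ∀ z, Tendsto (fun n => picard c F u₀ n z) atTop (𝓝 (u z)) := by
  wlog hB1 : 1 ≤ B generalizing B
  · exact this (B := 1) (fun z => (hB z).trans (not_le.1 hB1).le)
      (fun z => (hB' z).trans (not_le.1 hB1).le) le_rfl
  obtain ⟨l, hl⟩ : ∃ l, 64 * Real.pi * K ≤ l := ⟨_, le_rfl⟩
  have hl1 := h.rate_pos hl
  have hH := h.nonneg
  set θ : ℝ := (1 / 2) ^ q with hθ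
  have hθ1 : θ < 1 := Real.rpow_lt_one (by norm_num) (by norm_num) h.exponent_pos
  have hθ0 : 0 < θ := by positivity
  have c1 : ∀ z n, dist (picard c F u₀ n z) (picard c F u₀ (n + 1) z)
      ≤ B * Real.exp (l * |z.2|) * (1 / 2) ^ n := by
    intro z n
    rw [dist_comm, Real.dist_eq]
    refine (h.abs_picard_sub_le hu₀ hB hl n z).trans (le_of_eq (by ring))
  have c2 : ∀ z n, dist (fderiv ℝ (picard c F u₀ n) z) (fderiv ℝ (picard c F u₀ (n + 1)) z)
      ≤ (8 * B + 4 * H * B ^ 2) * Real.exp (2 * l * |z.2|) * θ ^ n := by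
    intro z n
    rw [dist_comm, dist_eq_norm]
    refine (h.norm_fderiv_picard_sub_le hu₀ hB hl hB' hB1 n z).trans (le_of_eq (by ring))
  choose u hu using fun z => cauchySeq_tendsto_of_complete
    (cauchySeq_of_le_geometric (1 / 2) _ (by norm_num) (c1 z))
  choose v hv using fun z => cauchySeq_tendsto_of_complete
    (cauchySeq_of_le_geometric θ _ hθ1 (c2 z))
  have d1 := fun z => dist_le_of_le_geometric_of_tendsto (1 / 2) _ (by norm_num) (c1 z) (hu z)
  have d2 := fun z => dist_le_of_le_geometric_of_tendsto θ _ hθ1 (c2 z) (hv z)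
  have hvu : TendstoLocallyUniformlyOn (fun n => fderiv ℝ (picard c F u₀ n)) v atTop univ := by
    refine tendstoLocallyUniformlyOn_of_le
      (M := fun z => (8 * B + 4 * H * B ^ 2) * Real.exp (2 * l * |z.2|) / (1 - θ))
      (by fun_prop) (fun z => div_nonneg (by positivity) (by linarith))
      (tendsto_pow_atTop_nhds_zero_of_lt_one hθ0.le hθ1) fun n z => ?_
    exact (d2 z n).trans (le_of_eq (by ring))
  have hder : ∀ z, HasFDerivAt u (v z) z := fun z =>
    hasFDerivAt_of_tendstoLocallyUniformlyOn isOpen_univ hvu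
      (fun n x _ => ((h.contDiff_picard hu₀ n).differentiable one_ne_zero x).hasFDerivAt)
      (fun x _ => hu x) (mem_univ z)
  have hvc : Continuous v := by
    rw [← continuousOn_univ]
    exact hvu.continuousOn (Frequently.of_forall fun n =>
      ((h.contDiff_picard hu₀ n).continuous_fderiv one_ne_zero).continuousOn)
  have huC : ContDiff ℝ 1 u := contDiff_one_iff_fderiv.2
    ⟨fun z => (hder z).differentiableAt, by
      rw [show fderiv ℝ u = v from funext fun z => (hder z).fderiv]; exact hvc⟩
  refine ⟨u, huC, fun z => ?_, hu⟩
  have hlim : Tendsto (fun n => picard c F u₀ (n + 1) z) atTop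
      (𝓝 (u₀ z + retard (source c F u) z)) := by
    rw [tendsto_iff_dist_tendsto_zero]
    have h0 : Tendsto (fun n : ℕ => 4 * Real.pi / l ^ 2 * (K * (2 * B) * (1 / 2) ^ n)
        * Real.exp (l * |z.2|)) atTop (𝓝 0) := by
      have := ((tendsto_pow_atTop_nhds_zero_of_lt_one (by norm_num : (0 : ℝ) ≤ 1 / 2)
        (by norm_num)).const_mul (4 * Real.pi / l ^ 2 * (K * (2 * B)))).mul_const
        (Real.exp (l * |z.2|))
      simpa [mul_assoc] using this
    refine squeeze_zero (fun _ => dist_nonneg) (fun n => ?_) h0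
    rw [Real.dist_eq]
    simp only [picard]
    rw [add_sub_add_left_eq_sub, retard_sub
      (h.contDiff_source (h.contDiff_picard hu₀ n)).continuous (h.contDiff_source huC).continuous]
    refine abs_retard_le (by linarith) fun ξ => (h.abs_source_sub_le _ _ _).trans ?_
    have hK := h.one_le
    have := d1 (coneShift ξ z) n
    rw [Real.dist_eq] at this
    calc _ ≤ K * (B * Real.exp (l * |(coneShift ξ z).2|) * (1 / 2) ^ n / (1 - 1 / 2)) := by gcongr
      _ = _ := by ring
  exact tendsto_nhds_unique ((tendsto_add_atTop_iff_nat 1).2 (hu z)) hlim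

/-! ### The weighted estimate for the retarded potential -/

/-- If `1 + M ≤ 2(1 + m)`, the integrand is comparable to its value at `m` and the length is at most
`2r`. Otherwise the primitive gives `(1 + m)^(-b) / b`, while `2r ≥ M - m > (1 + M)/2` yields `1 ≤
4r / (1 + M)`. The factor `r` is kept to cancel the `1/r` of John's formula. -/
theorem lintegral_rpow_Icc_le {b : ℝ} (hb : 0 < b) {m M r : ℝ} (hm : 0 ≤ m) (hmM : m ≤ M)
    (hr : M - m ≤ 2 * r) :
    ∫⁻ α in Icc m M, ENNReal.ofReal ((1 + α) ^ (-1 - b))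
      ≤ ENNReal.ofReal (r * ((4 + 4 / b) * (1 + M)⁻¹ * (1 + m) ^ (-b))) := by
  have hr0 : 0 ≤ r := by linarith
  have hm1 : 0 < 1 + m := by linarith
  have hM1 : 0 < 1 + M := by linarith
  have hpow : 0 < (1 + m) ^ (-b) := Real.rpow_pos_of_pos hm1 _
  rcases le_or_gt (1 + M) (2 * (1 + m)) with h | h
  · calc _ ≤ ∫⁻ α in Icc m M, ENNReal.ofReal ((1 + m) ^ (-1 - b)) := by
          refine setLIntegral_mono measurable_const fun α hα => ENNReal.ofReal_le_ofReal ?_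
          exact Real.rpow_le_rpow_of_nonpos hm1 (by linarith [hα.1]) (by linarith)
      _ = ENNReal.ofReal ((1 + m) ^ (-1 - b) * (M - m)) := by
          rw [setLIntegral_const, Real.volume_Icc, ENNReal.ofReal_mul (by positivity)]
      _ ≤ _ := by
          refine ENNReal.ofReal_le_ofReal ?_
          rw [show -1 - b = -1 + -b by ring, Real.rpow_add hm1, Real.rpow_neg_one]
          have h1 : (1 + m)⁻¹ ≤ 2 * (1 + M)⁻¹ := by
            rw [← div_eq_mul_inv, inv_eq_one_div, div_le_div_iff₀ hm1 hM1]; linarith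
          calc (1 + m)⁻¹ * (1 + m) ^ (-b) * (M - m)
              ≤ 2 * (1 + M)⁻¹ * (1 + m) ^ (-b) * (2 * r) := by gcongr
            _ = r * (4 * (1 + M)⁻¹ * (1 + m) ^ (-b)) := by ring
            _ ≤ _ := by
              have : 4 ≤ 4 + 4 / b := le_add_of_nonneg_right (by positivity)
              gcongr
  · have hcont : ContinuousOn (fun α : ℝ => (1 + α) ^ (-1 - b)) (Icc m M) := by
      refine ContinuousOn.rpow_const (by fun_prop) fun α hα => Or.inl ?_
      have := hα.1
      intro h0; linarith
    have hint : IntegrableOn (fun α : ℝ => (1 + α) ^ (-1 - b)) (Icc m M) :=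
      hcont.integrableOn_Icc
    rw [← ofReal_integral_eq_lintegral_ofReal hint
      ((ae_restrict_iff' measurableSet_Icc).2 (ae_of_all _ fun α hα =>
        Real.rpow_nonneg (by linarith [hα.1]) _))]
    refine ENNReal.ofReal_le_ofReal ?_
    rw [integral_Icc_eq_integral_Ioc, ← intervalIntegral.integral_of_le hmM]
    have hd : ∀ α ∈ uIcc m M, HasDerivAt (fun α : ℝ => -((1 + α) ^ (-b) / b))
        ((1 + α) ^ (-1 - b)) α := by
      intro α hα
      rw [uIcc_of_le hmM] at hα
      have h1 : (1 + α) ≠ 0 := by have := hα.1; intro h0; linarith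
      have := ((((hasDerivAt_id α).const_add 1).rpow_const (p := -b) (Or.inl h1)).div_const b).neg
      refine this.congr_deriv ?_
      simp only [id]
      rw [show -b - 1 = -1 - b by ring]
      field_simp
    rw [intervalIntegral.integral_eq_sub_of_hasDerivAt hd (by
      rw [intervalIntegrable_iff_integrableOn_Icc_of_le hmM]; exact hint)]
    have hMp : 0 ≤ (1 + M) ^ (-b) / b := by positivity
    have h4 : 1 ≤ r * (4 * (1 + M)⁻¹) := by
      rw [← div_eq_mul_inv, mul_div_assoc', one_le_div hM1]; linarith
    calc _ ≤ 1 * ((1 + m) ^ (-b) / b) := by linarith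
      _ ≤ r * (4 * (1 + M)⁻¹) * ((1 + m) ^ (-b) / b) := by gcongr
      _ = r * ((4 / b) * (1 + M)⁻¹ * (1 + m) ^ (-b)) := by field_simp
      _ ≤ _ := by gcongr; simp

/-- The change of variable `β = 2s - α` at fixed `α = s + l`; the `1/2` is the Jacobian of the
characteristic coordinates. -/
theorem lintegral_comp_two_mul_sub {h : ℝ → ENNReal} (hh : Measurable h) (α : ℝ) :
    ∫⁻ s, h (2 * s - α) = ENNReal.ofReal (1 / 2) * ∫⁻ β, h β := by
  have h1 : Measurable fun s : ℝ => h (s - α) := hh.comp (by fun_prop)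
  rw [← lintegral_map (f := fun s => h (s - α)) (g := fun s : ℝ => 2 * s) h1 (by fun_prop),
    Real.map_volume_mul_left two_ne_zero, lintegral_smul_measure, lintegral_sub_right_eq_self]
  norm_num

/-- Inside the support cone `1 + s + l ≤ (2 + k)(1 + s)`, so the damping in `s` acts as damping in
`α = s + l`. The exponents add to `1 - (p - 1) - p = 2 - 2p`. -/
theorem radial_weight_le {p k s l : ℝ} (hp : 1 < p) (hk : 1 ≤ k) (hs : 0 ≤ s) (hl : 0 ≤ l)
    (hlk : l ≤ s + k) :
    l * ((1 + s) ^ (-(p - 1)) * (1 + s + l) ^ (-p))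
      ≤ (2 + k) ^ (p - 1) * (1 + (s + l)) ^ (2 - 2 * p) := by
  have hα : 0 < 1 + (s + l) := by linarith
  have hk2 : 0 < 2 + k := by linarith
  have h1 : (1 + s) ^ (-(p - 1)) ≤ (2 + k) ^ (p - 1) * (1 + (s + l)) ^ (-(p - 1)) := by
    have : ((1 + (s + l)) / (2 + k)) ^ (-(p - 1)) = (2 + k) ^ (p - 1) * (1 + (s + l)) ^ (-(p - 1)) := by
      rw [Real.div_rpow hα.le hk2.le, Real.rpow_neg hk2.le, div_inv_eq_mul, mul_comm]
    rw [← this]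
    refine Real.rpow_le_rpow_of_nonpos (by positivity) ?_ (by linarith)
    rw [div_le_iff₀ hk2]
    nlinarith
  have e : (1 + (s + l)) ^ (2 - 2 * p)
      = (1 + (s + l)) * ((1 + (s + l)) ^ (-(p - 1)) * (1 + s + l) ^ (-p)) := by
    rw [show (1 + s + l) = 1 + (s + l) by ring, ← Real.rpow_add hα]
    nth_rewrite 2 [← Real.rpow_one (1 + (s + l))]
    rw [← Real.rpow_add hα]
    congr 1; ring
  rw [e]
  have hq : 0 ≤ (1 + s + l) ^ (-p) := Real.rpow_nonneg (by linarith) _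
  have hq2 : 0 ≤ (1 + (s + l)) ^ (-(p - 1)) := Real.rpow_nonneg (by linarith) _
  calc l * ((1 + s) ^ (-(p - 1)) * (1 + s + l) ^ (-p))
      ≤ (1 + (s + l)) * ((2 + k) ^ (p - 1) * (1 + (s + l)) ^ (-(p - 1)) * (1 + s + l) ^ (-p)) := by
        gcongr
        linarith
    _ = _ := by ring

theorem enorm_retard_le {w : Space × ℝ → ℝ} (hw : Continuous w) (x : Space) {t : ℝ} (ht : 0 ≤ t) :
    ‖retard w (x, t)‖ₑ ≤ ∫⁻ s in Ioc 0 t, ENNReal.ofReal (t - s) *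
      ∫⁻ η : Sph, ‖w (x + (t - s) • (η : Space), s)‖ₑ ∂surf := by
  rw [retard_eq hw, intervalIntegral.integral_of_le ht]
  refine (enorm_integral_le_lintegral_enorm _).trans ?_
  refine setLIntegral_mono' measurableSet_Ioc fun s hs => ?_
  rw [enorm_mul, Real.enorm_of_nonneg (sub_nonneg.2 hs.2)]
  gcongr
  exact enorm_integral_le_lintegral_enorm _

/-- The basic weighted estimate for the retarded potential, away from the spatial origin. -/
theorem abs_retard_radial_le_of_ne {p a b k : ℝ} (hp : 1 < p) (ha : 0 ≤ a) (hb : 0 < b)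
    (hab : b = a + 2 * p - 3) (hk : 1 ≤ k) {T J : ℝ} (hJ : 0 ≤ J) {h : ℝ → ℝ} (hh : Measurable h)
    (hh0 : ∀ β, 0 ≤ h β)
    (hhJ : ∫⁻ β in Icc (-k) T, ENNReal.ofReal (h β) ≤ ENNReal.ofReal J)
    {w : Space × ℝ → ℝ} (hw : Continuous w)
    (hbd : ∀ y s, 0 ≤ s → s ≤ T →
      |w (y, s)| ≤ (1 + s) ^ (-(p - 1)) * (1 + s + ‖y‖) ^ (-p) * h (s - ‖y‖))
    (hsupp : ∀ y s, 0 ≤ s → s ≤ T → s + k < ‖y‖ → w (y, s) = 0)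
    {x : Space} (hx : x ≠ 0) {t : ℝ} (ht : 0 ≤ t) (htT : t ≤ T) :
    |retard w (x, t)| ≤ Real.pi * (2 + k) ^ (p - 1) * (4 + 4 / b) * J
      * (1 + t + ‖x‖) ^ (a - 1) * (1 + |t - ‖x‖|) ^ (-b) := by
  have hpi := Real.pi_pos
  set r := ‖x‖ with hr
  have hr0 : 0 < r := norm_pos_iff.2 hx
  set C₁ := (2 + k) ^ (p - 1) with hC₁
  have hC₁0 : 0 < C₁ := Real.rpow_pos_of_pos (by linarith) _
  set hhat : ℝ → ENNReal := (Icc (-k) T).indicator fun β => ENNReal.ofReal (h β) with hhat_def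
  have hhat_meas : Measurable hhat :=
    (ENNReal.measurable_ofReal.comp hh).indicator measurableSet_Icc
  set g : ℝ → ENNReal := (Icc |t - r| (t + r)).indicator
    fun α => ENNReal.ofReal (C₁ * (1 + α) ^ (2 - 2 * p)) with hg_def
  have hg_meas : Measurable g := by
    refine Measurable.indicator ?_ measurableSet_Icc
    fun_prop
  -- At a fixed time the factor `t - s` cancels the one in John's formula. With `α = s + l` one has
  -- `s - l = 2s - α`, and the limits `|r - (t - s)| ≤ l ≤ r + (t - s)` place `α` in `[|t - r|, t +
  -- r]`.
  have hstep : ∀ s ∈ Ioc 0 t, ENNReal.ofReal (t - s) *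
      ∫⁻ η : Sph, ‖w (x + (t - s) • (η : Space), s)‖ₑ ∂surf
      ≤ ENNReal.ofReal (2 * Real.pi / r) * ∫⁻ α, g α * hhat (2 * s - α) := by
    intro s hs
    have hs0 : 0 ≤ s := hs.1.le
    rcases hs.2.eq_or_lt with rfl | hst
    · simp
    have hτ : 0 < t - s := sub_pos.2 hst
    have hsT : s ≤ T := hs.2.trans htT
    set W : ℝ → ENNReal := (Iic (s + k)).indicator fun l =>
      ENNReal.ofReal ((1 + s) ^ (-(p - 1)) * (1 + s + l) ^ (-p) * h (s - l)) with hW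
    have hWm : Measurable W := by
      refine Measurable.indicator ?_ measurableSet_Iic
      have : Measurable fun l => h (s - l) := hh.comp (by fun_prop)
      fun_prop
    have h1 : ∫⁻ η : Sph, ‖w (x + (t - s) • (η : Space), s)‖ₑ ∂surf
        ≤ ∫⁻ η : Sph, W ‖x + (t - s) • (η : Space)‖ ∂surf := by
      refine lintegral_mono fun η => ?_
      set y := x + (t - s) • (η : Space)
      by_cases hy : ‖y‖ ≤ s + k
      · rw [hW, indicator_of_mem (mem_Iic.2 hy), ← ofReal_norm, Real.norm_eq_abs]
        exact ENNReal.ofReal_le_ofReal (hbd y s hs0 hsT)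
      · rw [hsupp y s hs0 hsT (not_le.1 hy)]; simp
    have h2 : ∫⁻ l in Icc |r - (t - s)| (r + (t - s)), ENNReal.ofReal l * W l
        ≤ ∫⁻ α, g α * hhat (2 * s - α) := by
      rw [← lintegral_add_left_eq_self (fun α => g α * hhat (2 * s - α)) s]
      refine le_trans (setLIntegral_mono' measurableSet_Icc (g := fun l =>
        g (s + l) * hhat (2 * s - (s + l))) fun l hl => ?_) (setLIntegral_le_lintegral _ _)
      have hl0 : 0 ≤ l := (abs_nonneg _).trans hl.1
      by_cases hlk : l ≤ s + k
      · have m1 : s + l ∈ Icc |t - r| (t + r) := by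
          refine ⟨abs_le.2 ⟨?_, ?_⟩, by linarith [hl.2]⟩
          · have := (neg_abs_le (r - (t - s))).trans' (neg_le_neg hl.1)
            have h3 := (le_abs_self (r - (t - s))).trans hl.1
            linarith
          · have h3 := (neg_le_abs (r - (t - s))).trans hl.1
            linarith
        have m2 : 2 * s - (s + l) ∈ Icc (-k) T := ⟨by linarith, by linarith⟩
        rw [hW, hg_def, hhat_def, indicator_of_mem (mem_Iic.2 hlk), indicator_of_mem m1,
          indicator_of_mem m2, ← ENNReal.ofReal_mul hl0, ← ENNReal.ofReal_mul (by positivity)]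
        refine ENNReal.ofReal_le_ofReal ?_
        rw [show 2 * s - (s + l) = s - l by ring, ← mul_assoc]
        exact mul_le_mul_of_nonneg_right (radial_weight_le hp hk hs0 hl0 hlk) (hh0 _)
      · rw [hW, indicator_of_notMem (by simpa using hlk)]; simp
    calc _ ≤ ENNReal.ofReal (t - s) * (ENNReal.ofReal (2 * Real.pi / (r * (t - s))) *
          ∫⁻ α, g α * hhat (2 * s - α)) := by
          gcongr
          refine h1.trans ?_
          rw [lintegral_sphere_radial hx hτ hWm]
          gcongr
      _ = _ := by
          rw [← mul_assoc, ← ENNReal.ofReal_mul hτ.le]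
          congr 2
          field_simp
  have hm2 : Measurable fun q : ℝ × ℝ => g q.2 * hhat (2 * q.1 - q.2) :=
    (hg_meas.comp measurable_snd).mul (hhat_meas.comp (by fun_prop))
  have hI : ‖retard w (x, t)‖ₑ ≤ ENNReal.ofReal (2 * Real.pi / r) *
      ((∫⁻ α, g α) * (ENNReal.ofReal (1 / 2) * ENNReal.ofReal J)) := by
    refine (enorm_retard_le hw x ht).trans ?_
    refine (setLIntegral_mono' measurableSet_Ioc hstep).trans ?_
    refine (setLIntegral_le_lintegral _ _).trans ?_
    rw [lintegral_const_mul _ hm2.lintegral_prod_right']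
    gcongr
    -- Integrating in `s` first, the inner integral is half the mass of `hhat` for every `α`: the
    -- two characteristic variables decouple.
    rw [lintegral_lintegral_swap hm2.aemeasurable]
    have e1 : ∀ α, ∫⁻ s, g α * hhat (2 * s - α)
        = g α * (ENNReal.ofReal (1 / 2) * ∫⁻ β, hhat β) := by
      intro α
      have hm : Measurable fun s => hhat (2 * s - α) := hhat_meas.comp (by fun_prop)
      rw [lintegral_const_mul _ hm,
        lintegral_comp_two_mul_sub hhat_meas]
    simp only [e1]
    rw [lintegral_mul_const _ hg_meas]
    gcongr
    rw [hhat_def, lintegral_indicator measurableSet_Icc]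
    exact hhJ
  have hmM : |t - r| ≤ t + r := abs_le.2 ⟨by linarith, by linarith⟩
  have hlen : t + r - |t - r| ≤ 2 * r := by
    have := le_abs_self (t - r)
    linarith
  have hMpos : 0 < 1 + (t + r) := by linarith
  have hG : ∫⁻ α, g α ≤ ENNReal.ofReal (C₁ * (1 + (t + r)) ^ a *
      (r * ((4 + 4 / b) * (1 + (t + r))⁻¹ * (1 + |t - r|) ^ (-b)))) := by
    rw [hg_def, lintegral_indicator measurableSet_Icc]
    calc _ ≤ ∫⁻ α in Icc |t - r| (t + r), ENNReal.ofReal (C₁ * (1 + (t + r)) ^ a) *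
          ENNReal.ofReal ((1 + α) ^ (-1 - b)) := by
          refine setLIntegral_mono' measurableSet_Icc fun α hα => ?_
          have hα0 : 0 ≤ α := (abs_nonneg _).trans hα.1
          rw [← ENNReal.ofReal_mul (by positivity)]
          refine ENNReal.ofReal_le_ofReal ?_
          -- The relation between `a` and `b` splits the exponent so that `(1 + α)^a` can be bounded
          -- by its value at `t + r`, leaving an integrable power.
          rw [show 2 - 2 * p = a + (-1 - b) by linarith, Real.rpow_add (by linarith), ← mul_assoc]
          gcongr
          exact hα.2
      _ = ENNReal.ofReal (C₁ * (1 + (t + r)) ^ a) *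
          ∫⁻ α in Icc |t - r| (t + r), ENNReal.ofReal ((1 + α) ^ (-1 - b)) := by
          rw [lintegral_const_mul _ (by fun_prop)]
      _ ≤ _ := by
          rw [ENNReal.ofReal_mul (p := C₁ * (1 + (t + r)) ^ a) (by positivity)]
          exact mul_le_mul_right (lintegral_rpow_Icc_le hb (abs_nonneg _) hmM hlen) _
  have hfin : ‖retard w (x, t)‖ₑ ≤ ENNReal.ofReal (Real.pi * C₁ * (4 + 4 / b) * J
      * (1 + t + r) ^ (a - 1) * (1 + |t - r|) ^ (-b)) := by
    refine hI.trans ?_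
    refine (mul_le_mul_right (mul_le_mul_left hG _) _).trans (le_of_eq ?_)
    rw [← ENNReal.ofReal_mul (by positivity), ← ENNReal.ofReal_mul (by positivity),
      ← ENNReal.ofReal_mul (by positivity)]
    congr 1
    rw [← add_assoc, Real.rpow_sub (by linarith), Real.rpow_one]
    field_simp
  rw [← ofReal_norm, Real.norm_eq_abs] at hfin
  exact (ENNReal.ofReal_le_ofReal_iff (by positivity)).1 hfin

/-- The basic weighted estimate for the retarded potential. -/
theorem abs_retard_radial_le {p a b k : ℝ} (hp : 1 < p) (ha : 0 ≤ a) (hb : 0 < b)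
    (hab : b = a + 2 * p - 3) (hk : 1 ≤ k) {T J : ℝ} (hJ : 0 ≤ J) {h : ℝ → ℝ} (hh : Measurable h)
    (hh0 : ∀ β, 0 ≤ h β)
    (hhJ : ∫⁻ β in Icc (-k) T, ENNReal.ofReal (h β) ≤ ENNReal.ofReal J)
    {w : Space × ℝ → ℝ} (hw : ContDiff ℝ 1 w)
    (hbd : ∀ y s, 0 ≤ s → s ≤ T →
      |w (y, s)| ≤ (1 + s) ^ (-(p - 1)) * (1 + s + ‖y‖) ^ (-p) * h (s - ‖y‖))
    (hsupp : ∀ y s, 0 ≤ s → s ≤ T → s + k < ‖y‖ → w (y, s) = 0)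
    (x : Space) {t : ℝ} (ht : 0 ≤ t) (htT : t ≤ T) :
    |retard w (x, t)| ≤ Real.pi * (2 + k) ^ (p - 1) * (4 + 4 / b) * J
      * (1 + t + ‖x‖) ^ (a - 1) * (1 + |t - ‖x‖|) ^ (-b) := by
  rcases ne_or_eq x 0 with hx | rfl
  · exact abs_retard_radial_le_of_ne hp ha hb hab hk hJ hh hh0 hhJ hw.continuous hbd hsupp hx ht htT
  -- John's formula degenerates at the origin; both sides are continuous in `x`, so the bound passes
  -- to the limit along `x ≠ 0`.
  have c1 : Continuous fun x : Space => |retard w (x, t)| :=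
    ((contDiff_retard hw).continuous.comp (by fun_prop)).abs
  have c2 : Continuous fun x : Space => Real.pi * (2 + k) ^ (p - 1) * (4 + 4 / b) * J
      * (1 + t + ‖x‖) ^ (a - 1) * (1 + |t - ‖x‖|) ^ (-b) := by
    refine Continuous.mul (Continuous.mul continuous_const ?_) ?_
    · refine Continuous.rpow_const (by fun_prop) fun x => Or.inl ?_
      positivity
    · refine Continuous.rpow_const (by fun_prop) fun x => Or.inl ?_
      positivity
  refine le_of_tendsto_of_tendsto ((c1.tendsto 0).mono_left nhdsWithin_le_nhds)
    ((c2.tendsto 0).mono_left (nhdsWithin_le_nhds (s := {0}ᶜ))) ?_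
  filter_upwards [self_mem_nhdsWithin] with y hy
  exact abs_retard_radial_le_of_ne hp ha hb hab hk hJ hh hh0 hhJ hw.continuous hbd hsupp hy ht htT

/-! ### The truncated power and the time weight -/

/-- The function `v ↦ |v|^{p-2} v`. -/
def signedPow (p v : ℝ) : ℝ := |v| ^ (p - 2) * v

theorem signedPow_of_nonneg {p v : ℝ} (hp : 1 < p) (hv : 0 ≤ v) : signedPow p v = v ^ (p - 1) := by
  rcases hv.eq_or_lt with rfl | h
  · simp [signedPow, Real.zero_rpow (by linarith : p - 1 ≠ 0)]
  · rw [signedPow, abs_of_pos h, show p - 1 = (p - 2) + 1 by ring, Real.rpow_add h, Real.rpow_one]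

theorem signedPow_neg (p v : ℝ) : signedPow p (-v) = -signedPow p v := by
  simp [signedPow]

theorem rpow_sub_le {q x y : ℝ} (hq : 0 ≤ q) (hq1 : q ≤ 1) (hy : 0 ≤ y) (hxy : y ≤ x) :
    x ^ q - y ^ q ≤ (x - y) ^ q := by
  have := Real.rpow_add_le_add_rpow hy (sub_nonneg.2 hxy) hq hq1
  rw [add_sub_cancel] at this
  linarith

/-- For equal signs this is subadditivity of `x^(p-1)`, valid as `p - 1 ≤ 1`. For opposite signs
each term is at most `|v - w|^(p-1)`, whence the factor 2. -/
theorem abs_signedPow_sub_le {p : ℝ} (hp : 1 < p) (hp2 : p ≤ 2) (v w : ℝ) :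
    |signedPow p v - signedPow p w| ≤ 2 * |v - w| ^ (p - 1) := by
  have hq : 0 ≤ p - 1 := by linarith
  have hq1 : p - 1 ≤ 1 := by linarith
  have key : ∀ x y : ℝ, 0 ≤ y → y ≤ x → |signedPow p x - signedPow p y| ≤ 2 * |x - y| ^ (p - 1) := by
    intro x y hy hxy
    rw [signedPow_of_nonneg hp hy, signedPow_of_nonneg hp (hy.trans hxy),
      abs_of_nonneg (sub_nonneg.2 (Real.rpow_le_rpow hy hxy hq)), abs_of_nonneg (sub_nonneg.2 hxy)]
    have := rpow_sub_le hq hq1 hy hxy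
    have : 0 ≤ (x - y) ^ (p - 1) := Real.rpow_nonneg (sub_nonneg.2 hxy) _
    linarith
  have key2 : ∀ x y : ℝ, 0 ≤ x → 0 ≤ y → |signedPow p x - signedPow p (-y)|
      ≤ 2 * |x - -y| ^ (p - 1) := by
    intro x y hx hy
    rw [signedPow_neg, sub_neg_eq_add, sub_neg_eq_add, signedPow_of_nonneg hp hx,
      signedPow_of_nonneg hp hy, abs_of_nonneg (by positivity), abs_of_nonneg (by positivity)]
    have h1 : x ^ (p - 1) ≤ (x + y) ^ (p - 1) := Real.rpow_le_rpow hx (by linarith) hq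
    have h2 : y ^ (p - 1) ≤ (x + y) ^ (p - 1) := Real.rpow_le_rpow hy (by linarith) hq
    linarith
  have key3 : ∀ x y : ℝ, 0 ≤ x → 0 ≤ y → |signedPow p x - signedPow p y|
      ≤ 2 * |x - y| ^ (p - 1) := by
    intro x y hx hy
    rcases le_total y x with h | h
    · exact key x y hy h
    · rw [abs_sub_comm, abs_sub_comm x]; exact key y x hx h
  rcases le_total 0 v with hv | hv <;> rcases le_total 0 w with hw | hw
  · exact key3 v w hv hw
  · simpa using key2 v (-w) hv (by linarith)
  · rw [abs_sub_comm, abs_sub_comm v]; simpa using key2 w (-v) hw (by linarith)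
  · have := key3 (-v) (-w) (by linarith) (by linarith)
    rwa [signedPow_neg, signedPow_neg, neg_sub_neg, neg_sub_neg, abs_sub_comm, abs_sub_comm w] at this

theorem continuous_signedPow {p : ℝ} (hp : 1 < p) (hp2 : p ≤ 2) : Continuous (signedPow p) := by
  refine continuous_iff_continuousAt.2 fun v => ?_
  rw [ContinuousAt, tendsto_iff_dist_tendsto_zero]
  have h0 : Tendsto (fun w => 2 * |w - v| ^ (p - 1)) (𝓝 v) (𝓝 0) := by
    have hc : Continuous fun w : ℝ => 2 * |w - v| ^ (p - 1) :=
      continuous_const.mul (Continuous.rpow_const (by fun_prop) fun _ => Or.inr (by linarith))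
    have := hc.tendsto v
    simpa [Real.zero_rpow (by linarith : p - 1 ≠ 0)] using this
  exact squeeze_zero (fun _ => dist_nonneg) (fun w => abs_signedPow_sub_le hp hp2 w v) h0

/-- The derivative of `|v|^p`, frozen outside `[-1, 1]`. -/
def truncDeriv (p v : ℝ) : ℝ := p * signedPow p (max (-1) (min v 1))

/-- The function `|v|^p`, extended linearly outside `[-1, 1]`. -/
def truncPow (p v : ℝ) : ℝ := ∫ y in (0 : ℝ)..v, truncDeriv p y

theorem continuous_truncDeriv {p : ℝ} (hp : 1 < p) (hp2 : p ≤ 2) : Continuous (truncDeriv p) :=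
  continuous_const.mul ((continuous_signedPow hp hp2).comp (by fun_prop))

theorem hasDerivAt_truncPow {p : ℝ} (hp : 1 < p) (hp2 : p ≤ 2) (v : ℝ) :
    HasDerivAt (truncPow p) (truncDeriv p v) v :=
  intervalIntegral.integral_hasDerivAt_right
    ((continuous_truncDeriv hp hp2).intervalIntegrable _ _)
    ((continuous_truncDeriv hp hp2).stronglyMeasurableAtFilter _ _)
    (continuous_truncDeriv hp hp2).continuousAt

theorem truncPow_of_mem {p : ℝ} (hp : 1 < p) (hp2 : p ≤ 2) {v : ℝ} (hv : |v| ≤ 1) :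
    truncPow p v = |v| ^ p := by
  have hd : ∀ y ∈ uIcc 0 v, HasDerivAt (fun y : ℝ => |y| ^ p) (truncDeriv p y) y := by
    intro y hy
    have hy1 : |y| ≤ 1 := (by simpa using abs_sub_left_of_mem_uIcc hy : |y| ≤ |v|).trans hv
    rw [abs_le] at hy1
    rw [truncDeriv, min_eq_left hy1.2, max_eq_right hy1.1, signedPow, ← mul_assoc]
    exact hasDerivAt_abs_rpow y hp
  rw [truncPow, intervalIntegral.integral_eq_sub_of_hasDerivAt hd
    ((continuous_truncDeriv hp hp2).intervalIntegrable _ _)]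
  simp [Real.zero_rpow (by linarith : p ≠ 0)]

theorem truncDeriv_neg (p v : ℝ) : truncDeriv p (-v) = -truncDeriv p v := by
  have : max (-1) (min (-v) 1) = -max (-1) (min v 1) := by
    rcases le_total v 1 with h1 | h1 <;> rcases le_total (-1) v with h2 | h2 <;>
      simp [min_def, max_def] <;> split_ifs <;> linarith
  rw [truncDeriv, this, signedPow_neg, truncDeriv, mul_neg]

theorem truncPow_neg (p v : ℝ) : truncPow p (-v) = truncPow p v := by
  have h := intervalIntegral.integral_comp_neg (a := 0) (b := v) (truncDeriv p)
  simp only [truncDeriv_neg, intervalIntegral.integral_neg, neg_zero] at h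
  rw [truncPow, truncPow, intervalIntegral.integral_symm, ← h, neg_neg]

/-- Freezing the derivative only lowers it for positive arguments, and both functions are even.
Hence the weighted estimates for the power apply to the truncated equation before any bound on the
solution is known. -/
theorem abs_truncPow_le {p : ℝ} (hp : 1 < p) (hp2 : p ≤ 2) (v : ℝ) : |truncPow p v| ≤ |v| ^ p := by
  wlog hv : 0 ≤ v generalizing v
  · have := this (-v) (by linarith)
    rwa [truncPow_neg, abs_neg] at this
  have hb : ∀ y ∈ Icc 0 v, 0 ≤ truncDeriv p y ∧ truncDeriv p y ≤ p * |y| ^ (p - 2) * y := by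
    intro y hy
    have h1 : max (-1) (min y 1) = min y 1 := max_eq_right (by
      have := hy.1
      exact le_min (by linarith) (by norm_num))
    have h0 : 0 ≤ min y 1 := le_min hy.1 zero_le_one
    rw [truncDeriv, h1, mul_assoc, ← signedPow, signedPow_of_nonneg hp h0,
      signedPow_of_nonneg hp hy.1]
    exact ⟨by positivity, mul_le_mul_of_nonneg_left
      (Real.rpow_le_rpow h0 (min_le_left _ _) (by linarith)) (by linarith)⟩
  have hc := continuous_truncDeriv hp hp2
  have hc2 : Continuous fun y : ℝ => p * |y| ^ (p - 2) * y := by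
    have := (continuous_signedPow hp hp2).const_smul p
    refine this.congr fun y => ?_
    simp [signedPow, mul_assoc]
  have hnn : 0 ≤ truncPow p v :=
    intervalIntegral.integral_nonneg hv fun y hy => (hb y hy).1
  rw [abs_of_nonneg hnn]
  calc truncPow p v ≤ ∫ y in (0 : ℝ)..v, p * |y| ^ (p - 2) * y :=
        intervalIntegral.integral_mono_on hv (hc.intervalIntegrable _ _)
          (hc2.intervalIntegrable _ _) fun y hy => (hb y hy).2
    _ = |v| ^ p := by
        rw [intervalIntegral.integral_eq_sub_of_hasDerivAt (fun y _ => hasDerivAt_abs_rpow y hp)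
          (hc2.intervalIntegrable _ _)]
        simp [Real.zero_rpow (by linarith : p ≠ 0)]

/-- A `C¹` extension of `(4π)⁻¹ (1 + s)^{-(p - 1)}` to negative times. -/
def timeWeight (p s : ℝ) : ℝ :=
  1 / (4 * Real.pi) * (1 - (p - 1) * ∫ y in (0 : ℝ)..s, (1 + |y|) ^ (-p))

theorem continuous_timeWeight_integrand (p : ℝ) : Continuous fun y : ℝ => (1 + |y|) ^ (-p) :=
  Continuous.rpow_const (by fun_prop) fun y => Or.inl (by positivity)

theorem integral_timeWeight (p : ℝ) {s : ℝ} (hs : 0 ≤ s) :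
    (p - 1) * ∫ y in (0 : ℝ)..s, (1 + |y|) ^ (-p) = 1 - (1 + s) ^ (-(p - 1)) := by
  have hd : ∀ y ∈ uIcc 0 s, HasDerivAt (fun y : ℝ => -(1 + y) ^ (-(p - 1)))
      ((p - 1) * (1 + |y|) ^ (-p)) y := by
    intro y hy
    rw [uIcc_of_le hs] at hy
    have h1 : 1 + y ≠ 0 := by have := hy.1; intro h; linarith
    have := (((hasDerivAt_id y).const_add 1).rpow_const (p := -(p - 1)) (Or.inl h1)).neg
    refine this.congr_deriv ?_
    simp only [id]
    rw [abs_of_nonneg hy.1, show -(p - 1) - 1 = -p by ring]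
    ring
  rw [← intervalIntegral.integral_const_mul, intervalIntegral.integral_eq_sub_of_hasDerivAt hd
    (((continuous_timeWeight_integrand p).const_smul (p - 1)).intervalIntegrable _ _)]
  simp
  ring

theorem timeWeight_of_nonneg (p : ℝ) {s : ℝ} (hs : 0 ≤ s) :
    timeWeight p s = 1 / (4 * Real.pi) * (1 + s) ^ (-(p - 1)) := by
  rw [timeWeight, integral_timeWeight p hs]; ring

theorem hasDerivAt_timeWeight (p s : ℝ) :
    HasDerivAt (timeWeight p) (1 / (4 * Real.pi) * -((p - 1) * (1 + |s|) ^ (-p))) s := by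
  have hc := continuous_timeWeight_integrand p
  have := intervalIntegral.integral_hasDerivAt_right (hc.intervalIntegrable 0 s)
    (hc.stronglyMeasurableAtFilter _ _) hc.continuousAt
  exact ((this.const_mul (p - 1)).const_sub 1).const_mul _

theorem abs_timeWeight_le {p : ℝ} (hp : 1 < p) (s : ℝ) : |timeWeight p s| ≤ 1 := by
  have hpi := Real.pi_gt_three
  have h1 : ∀ s : ℝ, 0 ≤ s → (1 + s) ^ (-(p - 1)) ≤ 1 := fun s hs =>
    Real.rpow_le_one_of_one_le_of_nonpos (by linarith) (by linarith)
  have h2 : ∀ s : ℝ, 0 ≤ s → 0 ≤ (1 + s) ^ (-(p - 1)) := fun s hs => by positivity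
  have key : |1 - (p - 1) * ∫ y in (0 : ℝ)..s, (1 + |y|) ^ (-p)| ≤ 2 := by
    rcases le_total 0 s with hs | hs
    · rw [integral_timeWeight p hs, abs_le]
      constructor <;> linarith [h1 s hs, h2 s hs]
    · have hs' : 0 ≤ -s := by linarith
      have e := intervalIntegral.integral_comp_neg (a := 0) (b := s)
        (fun y : ℝ => (1 + |y|) ^ (-p))
      simp only [abs_neg, neg_zero] at e
      rw [e, intervalIntegral.integral_symm, mul_neg, integral_timeWeight p hs', abs_le]
      constructor <;> linarith [h1 _ hs', h2 _ hs']
  rw [timeWeight, abs_mul, abs_of_pos (by positivity)]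
  calc _ ≤ 1 / (4 * Real.pi) * 2 := by gcongr
    _ ≤ 1 := by rw [div_mul_eq_mul_div, div_le_one (by positivity)]; linarith

theorem admissible_truncPow {p : ℝ} (hp : 1 < p) (hp2 : p ≤ 2) :
    Admissible (timeWeight p) (truncPow p) p (2 * p) (p - 1) where
  contDiff_weight := by
    refine contDiff_one_iff_deriv.2 ⟨fun s => (hasDerivAt_timeWeight p s).differentiableAt, ?_⟩
    rw [show deriv (timeWeight p) = _ from funext fun s => (hasDerivAt_timeWeight p s).deriv]
    exact continuous_const.mul (continuous_const.mul (continuous_timeWeight_integrand p)).neg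
  abs_weight_le := abs_timeWeight_le hp
  abs_deriv_weight_le s := by
    have hpi := Real.pi_gt_three
    rw [(hasDerivAt_timeWeight p s).deriv, abs_mul, abs_neg, abs_mul,
      abs_of_pos (by positivity : 0 < 1 / (4 * Real.pi)), abs_of_pos (by linarith : 0 < p - 1),
      abs_of_nonneg (by positivity)]
    have h1 : (1 + |s|) ^ (-p) ≤ 1 := Real.rpow_le_one_of_one_le_of_nonpos
      (by linarith [abs_nonneg s]) (by linarith)
    calc _ ≤ 1 / (4 * Real.pi) * (1 * 1) := by gcongr; linarith
      _ ≤ 1 := by rw [mul_one, mul_one, div_le_one (by positivity)]; linarith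
  contDiff := by
    refine contDiff_one_iff_deriv.2 ⟨fun s => (hasDerivAt_truncPow hp hp2 s).differentiableAt, ?_⟩
    rw [show deriv (truncPow p) = _ from funext fun s => (hasDerivAt_truncPow hp hp2 s).deriv]
    exact continuous_truncDeriv hp hp2
  map_zero := by simp [truncPow]
  abs_deriv_le v := by
    rw [(hasDerivAt_truncPow hp hp2 v).deriv, truncDeriv, abs_mul, abs_of_pos (by linarith)]
    have hv : |max (-1) (min v 1)| ≤ 1 := abs_le.2 ⟨le_max_left _ _,
      max_le (by norm_num) (min_le_right _ _)⟩
    set y := max (-1) (min v 1)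
    have : |signedPow p y| ≤ 1 := by
      have e : |signedPow p y| = |y| ^ (p - 1) := by
        rw [← signedPow_of_nonneg hp (abs_nonneg y), signedPow, signedPow, abs_mul, abs_abs,
          Real.abs_rpow_of_nonneg (abs_nonneg y), abs_abs]
      rw [e]
      exact Real.rpow_le_one (abs_nonneg _) hv (by linarith)
    calc _ ≤ p * 1 := by gcongr
      _ = p := mul_one p
  holder v w := by
    rw [(hasDerivAt_truncPow hp hp2 v).deriv, (hasDerivAt_truncPow hp hp2 w).deriv, truncDeriv,
      truncDeriv, ← mul_sub, abs_mul, abs_of_pos (by linarith : 0 < p)]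
    have h1 := abs_signedPow_sub_le hp hp2 (max (-1) (min v 1)) (max (-1) (min w 1))
    have h2 : |max (-1) (min v 1) - max (-1) (min w 1)| ≤ |v - w| := by
      have e1 := abs_max_sub_max_le_max (-1) (min v 1) (-1) (min w 1)
      have e2 := abs_min_sub_min_le_max v 1 w 1
      simp only [sub_self, abs_zero] at e1 e2
      exact e1.trans (max_le (abs_nonneg _) (e2.trans (max_le le_rfl (abs_nonneg _))))
    calc p * _ ≤ p * (2 * |v - w| ^ (p - 1)) := by
          refine mul_le_mul_of_nonneg_left (h1.trans ?_) (by linarith)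
          gcongr
      _ = _ := by ring
  one_le := hp.le
  nonneg := by linarith
  exponent_pos := by linarith
  exponent_le := by linarith

/-! ### Uniqueness, support of the free wave, cutoff -/

theorem abs_abs_rpow_sub_le {p R : ℝ} (hp : 1 < p) {v w : ℝ} (hv : |v| ≤ R)
    (hw : |w| ≤ R) : |(|v| ^ p) - |w| ^ p| ≤ p * R ^ (p - 1) * |v - w| := by
  refine (convex_Icc (-R) R).norm_image_sub_le_of_norm_hasDerivWithin_le
    (f := fun y : ℝ => |y| ^ p) (f' := fun y => p * |y| ^ (p - 2) * y)
    (fun y _ => (hasDerivAt_abs_rpow y hp).hasDerivWithinAt) ?_ (abs_le.1 hw) (abs_le.1 hv)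
  intro y hy
  have e : ‖p * |y| ^ (p - 2) * y‖ = p * |y| ^ (p - 1) := by
    rw [Real.norm_eq_abs, mul_assoc, abs_mul, abs_of_pos (by linarith : 0 < p),
      ← signedPow_of_nonneg hp (abs_nonneg y), signedPow, abs_mul,
      Real.abs_rpow_of_nonneg (abs_nonneg y), abs_abs]
  rw [e]
  exact mul_le_mul_of_nonneg_left (Real.rpow_le_rpow (abs_nonneg _) (abs_le.2 hy) (by linarith))
    (by linarith)

/-- The domain of dependence of `(x₀, t₀)`. -/
def backCone (x₀ : Space) (t₀ : ℝ) : Set (Space × ℝ) :=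
  {z | 0 ≤ z.2 ∧ z.2 ≤ t₀ ∧ ‖z.1 - x₀‖ ≤ t₀ - z.2}

/-- Finite speed of propagation: the potential at a point of the backward cone sees only that
compact cone, so uniqueness requires no growth condition in space. -/
theorem coneShift_mem_backCone {x₀ : Space} {t₀ : ℝ} {z : Space × ℝ} (hz : z ∈ backCone x₀ t₀)
    (ξ : Cone) : coneShift ξ z ∈ backCone x₀ t₀ := by
  obtain ⟨h1, h2, h3⟩ := hz
  have hσ := ξ.1.2.1
  have hσ1 := sub_nonneg.2 ξ.1.2.2
  rw [coneShift_apply]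
  refine ⟨by positivity, by nlinarith, ?_⟩
  have e : z.1 + (1 - (ξ.1 : ℝ)) • z.2 • (ξ.2 : Space) - x₀
      = (z.1 - x₀) + (1 - (ξ.1 : ℝ)) • z.2 • (ξ.2 : Space) := by abel
  simp only []
  rw [e]
  refine (norm_add_le _ _).trans ?_
  rw [norm_smul, norm_smul, norm_coe_sph, Real.norm_eq_abs, Real.norm_eq_abs, abs_of_nonneg hσ1,
    abs_of_nonneg h1]
  linarith

/-- A continuous extension of the restriction of `u` to times in `[0, t₀]`. -/
def clampTime (u : Space → ℝ → ℝ) (t₀ : ℝ) (z : Space × ℝ) : ℝ := u z.1 (max 0 (min z.2 t₀))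

theorem clampTime_of_mem (u : Space → ℝ → ℝ) {t₀ s : ℝ} (hs : 0 ≤ s) (hst : s ≤ t₀) (y : Space) :
    clampTime u t₀ (y, s) = u y s := by
  simp [clampTime, min_eq_left hst, max_eq_right hs]

theorem IsSolution.continuous_clampTime {p ε T t₀ : ℝ} {f g : Space → ℝ} {u : Space → ℝ → ℝ}
    (hu : IsSolution p f g ε T u) (h0 : 0 ≤ t₀) (ht : t₀ < T) : Continuous (clampTime u t₀) := by
  have := hu.contDiffOn.continuousOn.comp_continuous
    (f := fun z : Space × ℝ => (z.1, max 0 (min z.2 t₀))) (by fun_prop) fun z =>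
      ⟨mem_univ _, le_max_left _ _, max_lt (by linarith) ((min_le_right _ _).trans_lt ht)⟩
  exact this

theorem continuous_timeWeight (p : ℝ) : Continuous (timeWeight p) :=
  continuous_iff_continuousAt.2 fun s => (hasDerivAt_timeWeight p s).continuousAt

theorem IsSolution.clampTime_eq {p ε T t₀ : ℝ} {f g : Space → ℝ} {u : Space → ℝ → ℝ}
    (hp : 1 < p) (hf : ContDiff ℝ 1 f) (hu : IsSolution p f g ε T u) (h0 : 0 ≤ t₀) (ht : t₀ < T)
    {z : Space × ℝ} (hz : 0 ≤ z.2) (hzt : z.2 ≤ t₀) :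
    clampTime u t₀ z = ε * kirchhoff f g z +
      retard (fun z => timeWeight p z.2 * |clampTime u t₀ z| ^ p) z := by
  obtain ⟨x, t⟩ := z
  obtain ⟨u₀, hu₀, he⟩ := hu.eqn
  have hW : Continuous fun z : Space × ℝ => timeWeight p z.2 * |clampTime u t₀ z| ^ p :=
    ((continuous_timeWeight p).comp continuous_snd).mul
      ((hu.continuous_clampTime h0 ht).abs.rpow_const fun z => Or.inr (by linarith))
  rw [clampTime_of_mem u hz hzt, he x t hz (hzt.trans_lt ht), hu₀.eq_kirchhoff hf x hz,
    opL_eq_retard hW hz]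
  intro y s hs
  simp only []
  rw [clampTime_of_mem u hs.1 (hs.2.trans hzt), timeWeight_of_nonneg p hs.1, mul_assoc]

/-- Both solutions have the same Kirchhoff free part and are bounded by some `R` on the compact
cone, where `|·|^p` has Lipschitz constant `K = p R^(p-1)`. In the weight `exp(l|t|)` the difference
is therefore halved by each application of the equation. -/
theorem IsSolution.eq {p ε T : ℝ} {f g : Space → ℝ} {u v : Space → ℝ → ℝ}
    (hp : 1 < p) (hf : ContDiff ℝ 1 f) (hu : IsSolution p f g ε T u) (hv : IsSolution p f g ε T v)
    (x₀ : Space) {t₀ : ℝ} (h0 : 0 ≤ t₀) (ht : t₀ < T) : u x₀ t₀ = v x₀ t₀ := by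
  have hcu := hu.continuous_clampTime h0 ht
  have hcv := hv.continuous_clampTime h0 ht
  set U := clampTime u t₀ with hU
  set V := clampTime v t₀ with hV
  have hK : IsCompact (Metric.closedBall x₀ t₀ ×ˢ Icc (0 : ℝ) t₀) :=
    (isCompact_closedBall _ _).prod isCompact_Icc
  obtain ⟨R₁, hR₁⟩ := hK.exists_bound_of_continuousOn hcu.continuousOn
  obtain ⟨R₂, hR₂⟩ := hK.exists_bound_of_continuousOn hcv.continuousOn
  set R := max 0 (max R₁ R₂) with hR
  have hR0 : 0 ≤ R := le_max_left _ _
  have hsub : ∀ z ∈ backCone x₀ t₀, z ∈ Metric.closedBall x₀ t₀ ×ˢ Icc (0 : ℝ) t₀ := by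
    rintro z ⟨h1, h2, h3⟩
    exact ⟨by rw [mem_closedBall_iff_norm]; linarith, h1, h2⟩
  have hUR : ∀ z ∈ backCone x₀ t₀, |U z| ≤ R := fun z hz =>
    (hR₁ z (hsub z hz)).trans ((le_max_left _ _).trans (le_max_right _ _))
  have hVR : ∀ z ∈ backCone x₀ t₀, |V z| ≤ R := fun z hz =>
    (hR₂ z (hsub z hz)).trans ((le_max_right _ _).trans (le_max_right _ _))
  set K := p * R ^ (p - 1) with hKdef
  have hK0 : 0 ≤ K := by positivity
  -- Chosen so that `8πK ≤ l²`, which makes the gain `4πK / l²` at most `1/2`.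
  set l := 1 + 8 * Real.pi * K with hl
  have hpi := Real.pi_pos
  have hl1 : 1 ≤ l := by rw [hl]; linarith [show 0 ≤ 8 * Real.pi * K by positivity]
  have hgain : 4 * Real.pi / l ^ 2 * K ≤ 1 / 2 := by
    rw [div_mul_eq_mul_div, div_le_iff₀ (by positivity)]
    nlinarith
  have key : ∀ n : ℕ, ∀ z ∈ backCone x₀ t₀,
      |U z - V z| ≤ 2 * R * (1 / 2) ^ n * Real.exp (l * |z.2|) := by
    intro n
    induction n with
    | zero =>
      intro z hz
      have h1 : (1 : ℝ) ≤ Real.exp (l * |z.2|) := Real.one_le_exp (by positivity)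
      have h2 := abs_sub (U z) (V z)
      have h3 := hUR z hz
      have h4 := hVR z hz
      rw [pow_zero, mul_one]
      nlinarith
    | succ n ih =>
      intro z hz
      have hsrc : ∀ {W : Space × ℝ → ℝ}, Continuous W →
          Continuous fun z : Space × ℝ => timeWeight p z.2 * |W z| ^ p := fun hW =>
        ((continuous_timeWeight p).comp continuous_snd).mul
          (hW.abs.rpow_const fun z => Or.inr (by linarith))
      rw [hU, hV, hu.clampTime_eq hp hf h0 ht hz.1 hz.2.1, hv.clampTime_eq hp hf h0 ht hz.1 hz.2.1,
        add_sub_add_left_eq_sub, ← hU, ← hV, retard_sub (hsrc hcu) (hsrc hcv)]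
      refine (abs_retard_le (B := K * (2 * R * (1 / 2) ^ n)) (l := l) (by linarith) ?_).trans ?_
      · intro ξ
        have hξ := coneShift_mem_backCone hz ξ
        rw [← mul_sub, abs_mul]
        calc _ ≤ 1 * (K * |U (coneShift ξ z) - V (coneShift ξ z)|) :=
              mul_le_mul (abs_timeWeight_le hp _)
                (abs_abs_rpow_sub_le hp (hUR _ hξ) (hVR _ hξ)) (abs_nonneg _) zero_le_one
          _ ≤ 1 * (K * (2 * R * (1 / 2) ^ n * Real.exp (l * |(coneShift ξ z).2|))) := by
              gcongr; exact ih _ hξ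
          _ = _ := by ring
      · calc _ = 4 * Real.pi / l ^ 2 * K * (2 * R * (1 / 2) ^ n * Real.exp (l * |z.2|)) := by ring
          _ ≤ 1 / 2 * (2 * R * (1 / 2) ^ n * Real.exp (l * |z.2|)) := by gcongr
          _ = _ := by rw [pow_succ]; ring
  have hmem : (x₀, t₀) ∈ backCone x₀ t₀ := ⟨h0, le_rfl, by simp⟩
  have hlim : Tendsto (fun n : ℕ => 2 * R * (1 / 2 : ℝ) ^ n * Real.exp (l * |t₀|)) atTop (𝓝 0) := by
    have := ((tendsto_pow_atTop_nhds_zero_of_lt_one (by norm_num : (0 : ℝ) ≤ 1 / 2)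
      (by norm_num)).const_mul (2 * R)).mul_const (Real.exp (l * |t₀|))
    simpa using this
  have h := ge_of_tendsto' hlim fun n => key n _ hmem
  have h' := sub_eq_zero.1 (abs_nonpos_iff.1 h)
  rwa [hU, hV, clampTime_of_mem u h0 le_rfl, clampTime_of_mem v h0 le_rfl] at h'

theorem exists_kirchhoff_bound {f g : Space → ℝ} (hf : ContDiff ℝ 1 f) (hfs : HasCompactSupport f)
    (hg : Continuous g) (hgs : HasCompactSupport g) :
    ∃ k C : ℝ, 1 ≤ k ∧ 0 < C ∧
      (∀ x t, 0 ≤ t → |kirchhoff f g (x, t)| ≤ C * (1 + t)⁻¹) ∧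
      ∀ x t, k < abs (‖x‖ - |t|) → kirchhoff f g (x, t) = 0 := by
  have zero_off : ∀ {E : Type} [NormedAddCommGroup E] {h : Space → E}, HasCompactSupport h →
      ∃ k : ℝ, ∀ x, k < ‖x‖ → h x = 0 := by
    intro E _ h hh
    obtain ⟨k, hk⟩ := hh.isCompact.isBounded.subset_closedBall 0
    refine ⟨k, fun x hx => image_eq_zero_of_notMem_tsupport fun hx' => ?_⟩
    have := hk hx'
    rw [mem_closedBall_zero_iff] at this
    linarith
  have hdc := hf.continuous_fderiv one_ne_zero
  have hds := hfs.fderiv (𝕜 := ℝ)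
  obtain ⟨k₁, hk₁⟩ := zero_off hfs
  obtain ⟨k₂, hk₂⟩ := zero_off hds
  obtain ⟨k₃, hk₃⟩ := zero_off hgs
  obtain ⟨C₁, hC₁⟩ := hf.continuous.bounded_above_of_compact_support hfs
  obtain ⟨C₂, hC₂⟩ := hdc.bounded_above_of_compact_support hds
  obtain ⟨C₃, hC₃⟩ := hg.bounded_above_of_compact_support hgs
  set k := max 1 (max k₁ (max k₂ k₃)) with hk
  set C := max 1 (max C₁ (max C₂ C₃)) with hC
  have hk0 : 1 ≤ k := le_max_left _ _
  have hC0 : 1 ≤ C := le_max_left _ _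
  have l1 : k₁ ≤ k := by simp [hk]
  have l2 : k₂ ≤ k := by simp [hk]
  have l3 : k₃ ≤ k := by simp [hk]
  have m1 : C₁ ≤ C := by simp [hC]
  have m2 : C₂ ≤ C := by simp [hC]
  have m3 : C₃ ≤ C := by simp [hC]
  have s1 : ∀ x, k < ‖x‖ → f x = 0 := fun x hx => hk₁ x (by linarith)
  have s2 : ∀ x, k < ‖x‖ → fderiv ℝ f x = 0 := fun x hx => hk₂ x (by linarith)
  have s3 : ∀ x, k < ‖x‖ → g x = 0 := fun x hx => hk₃ x (by linarith)
  refine ⟨k, 3 * C * (1 + 2 * k) ^ 2, hk0, by positivity, fun x t ht => ?_,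
    fun x t h => kirchhoff_eq_zero s1 s2 s3 h⟩
  exact abs_kirchhoff_le hk0 (by linarith) s1 s2 s3 (fun x => (hC₁ x).trans m1)
    (fun x => (hC₂ x).trans m2) (fun x => (hC₃ x).trans m3) x ht

/-- A `C¹` function with compact support that agrees with the free wave for `|t| ≤ T`. -/
theorem exists_cutoff {w : Space × ℝ → ℝ} (hw : ContDiff ℝ 1 w) {k : ℝ}
    (hk : ∀ x t, k < abs (‖x‖ - |t|) → w (x, t) = 0) {T : ℝ} (hT : 0 < T) :
    ∃ v : Space × ℝ → ℝ, ContDiff ℝ 1 v ∧ HasCompactSupport v ∧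
      ∀ x t, |t| ≤ T → v (x, t) = w (x, t) := by
  let χ : ContDiffBump (0 : ℝ) := ⟨T, T + 1, hT, by linarith⟩
  refine ⟨fun z => χ z.2 * w z, (χ.contDiff.comp contDiff_snd).mul hw, ?_, fun x t ht => ?_⟩
  · refine HasCompactSupport.intro
      ((isCompact_closedBall (0 : Space) (T + 1 + k)).prod (isCompact_closedBall (0 : ℝ) (T + 1))) ?_
    rintro ⟨x, t⟩ hz
    simp only [mem_prod, mem_closedBall_zero_iff, not_and_or, not_le] at hz
    by_cases ht : T + 1 < |t|
    · have : χ t = 0 := χ.zero_of_le_dist (by simpa using ht.le)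
      simp [this]
    · rw [not_lt] at ht
      have hx : T + 1 + k < ‖x‖ := hz.resolve_right (by simpa using ht)
      simp only []
      rw [hk x t (lt_of_lt_of_le (by linarith) (le_abs_self _)), mul_zero]
  · have : χ t = 1 := χ.one_of_mem_closedBall (by simpa using ht)
    simp [this]

/-! ### The iteration in the weighted space -/

theorem add_rpow_le_four_mul {p x y : ℝ} (hp : 0 ≤ p) (hp2 : p ≤ 2) (hx : 0 ≤ x) (hy : 0 ≤ y) :
    (x + y) ^ p ≤ 4 * (x ^ p + y ^ p) := by
  have h2 : (2 : ℝ) ^ p ≤ 4 := by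
    calc (2 : ℝ) ^ p ≤ 2 ^ (2 : ℝ) := Real.rpow_le_rpow_of_exponent_le (by norm_num) hp2
      _ = 4 := by norm_num
  have hxp : 0 ≤ x ^ p := by positivity
  have hyp : 0 ≤ y ^ p := by positivity
  have hm : (max x y) ^ p ≤ x ^ p + y ^ p := by
    rcases max_choice x y with h | h <;> rw [h] <;> linarith
  calc (x + y) ^ p ≤ (2 * max x y) ^ p := by
        refine Real.rpow_le_rpow (by positivity) ?_ hp
        linarith [le_max_left x y, le_max_right x y]
    _ = 2 ^ p * (max x y) ^ p := Real.mul_rpow (by norm_num) (le_max_of_le_left hx)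
    _ ≤ 4 * (x ^ p + y ^ p) := by gcongr

/-- The decay profile `(1 + t + |x|)^{a - 1} (1 + |t - |x||)^{-b}`. -/
def decay (a b : ℝ) (x : Space) (t : ℝ) : ℝ :=
  (1 + t + ‖x‖) ^ (a - 1) * (1 + |t - ‖x‖|) ^ (-b)

theorem decay_nonneg (a b : ℝ) (x : Space) {t : ℝ} (ht : 0 ≤ t) : 0 ≤ decay a b x t := by
  unfold decay; positivity

theorem decay_le_one {a b : ℝ} (ha : a ≤ 1) (hb : 0 ≤ b) (x : Space) {t : ℝ} (ht : 0 ≤ t) :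
    decay a b x t ≤ 1 := by
  refine mul_le_one₀ (Real.rpow_le_one_of_one_le_of_nonpos ?_ (by linarith)) (by positivity)
    (Real.rpow_le_one_of_one_le_of_nonpos ?_ (by linarith))
  · linarith [norm_nonneg x]
  · linarith [abs_nonneg (t - ‖x‖)]

/-- Vanishing outside the support cone `|y| ≤ s + k`, for `0 ≤ s ≤ T`. -/
def ConeSupported (k T : ℝ) (w : Space × ℝ → ℝ) : Prop :=
  ∀ y s, 0 ≤ s → s ≤ T → s + k < ‖y‖ → w (y, s) = 0

theorem ConeSupported.retard {k T : ℝ} {w : Space × ℝ → ℝ} (hw : ConeSupported k T w) :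
    ConeSupported k T (retard w) := by
  intro x t ht htT hx
  have h : ∀ ξ : Cone, w (coneShift ξ (x, t)) = 0 := by
    intro ξ
    have h0 := ξ.1.2.1
    have h1 := sub_nonneg.2 ξ.1.2.2
    rw [coneShift_apply]
    refine hw _ _ (by positivity) (by nlinarith) ?_
    have h2 := norm_sub_norm_le x (-((1 - (ξ.1 : ℝ)) • t • (ξ.2 : Space)))
    rw [sub_neg_eq_add, norm_neg, norm_smul, norm_smul, norm_coe_sph, Real.norm_eq_abs,
      Real.norm_eq_abs, abs_of_nonneg h1, abs_of_nonneg ht] at h2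
    linarith
  simp [DampedWave.retard, h]

theorem lintegral_indicator_add_le {k T X Y J : ℝ} (hk : 0 ≤ k) (hX : 0 ≤ X) (hY : 0 ≤ Y)
    (hJ : 0 ≤ J) {φ : ℝ → ℝ} (hφ : Measurable φ)
    (hφJ : ∫⁻ β in Icc (-k) T, ENNReal.ofReal (φ β) ≤ ENNReal.ofReal J) :
    ∫⁻ β in Icc (-k) T, ENNReal.ofReal ((Icc (-k) k).indicator (fun _ => X) β + Y * φ β)
      ≤ ENNReal.ofReal (2 * k * X + Y * J) := by
  calc _ ≤ ∫⁻ β in Icc (-k) T, ((Icc (-k) k).indicator (fun _ => ENNReal.ofReal X) β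
          + ENNReal.ofReal Y * ENNReal.ofReal (φ β)) := by
        refine lintegral_mono fun β => ENNReal.ofReal_add_le.trans ?_
        rw [← ENNReal.ofReal_mul hY]
        gcongr
        by_cases h : β ∈ Icc (-k) k <;> simp [h]
    _ = (∫⁻ β in Icc (-k) T, (Icc (-k) k).indicator (fun _ => ENNReal.ofReal X) β)
          + ENNReal.ofReal Y * ∫⁻ β in Icc (-k) T, ENNReal.ofReal (φ β) := by
        rw [lintegral_add_left (measurable_const.indicator measurableSet_Icc),
          lintegral_const_mul _ hφ.ennreal_ofReal]
    _ ≤ ENNReal.ofReal X * ENNReal.ofReal (k - -k) + ENNReal.ofReal Y * ENNReal.ofReal J := by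
        gcongr
        refine (setLIntegral_le_lintegral _ _).trans ?_
        rw [lintegral_indicator measurableSet_Icc, setLIntegral_const, Real.volume_Icc]
    _ = _ := by
        rw [← ENNReal.ofReal_mul hX, ← ENNReal.ofReal_mul hY,
          ← ENNReal.ofReal_add (mul_nonneg hX (by linarith)) (by positivity)]
        congr 1; ring

section Iteration

variable {p a b k T J : ℝ} {u₀ : Space × ℝ → ℝ}

/-- Split `|v|^p ≤ 4(|u₀|^p + |v - u₀|^p)`. The free part lives in the strip `|s - |y|| ≤ k` and has
mass `2kE^p`. In the other part the `p`-th power of the profile is `(1 + s + |y|)^(-p)` times a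
function of `s - |y|`, up to `(1 + s + |y|)^(pa)`, which is at most `(1 + 2T + k)^(pa)` on the
support. The 4 is absorbed by the `1/(4π)` in the kernel. -/
theorem abs_retard_source_le (hp : 1 < p) (hp2 : p ≤ 2) (ha : 0 ≤ a) (hb : 0 < b)
    (hab : b = a + 2 * p - 3) (hk : 1 ≤ k) (hJ : 0 ≤ J)
    (hhJ : ∫⁻ β in Icc (-k) T, ENNReal.ofReal ((1 + |β|) ^ (-(p * b))) ≤ ENNReal.ofReal J)
    {E M : ℝ} (hE : 0 ≤ E) (hM : 0 ≤ M)
    (hu₀ : ∀ y s, 0 ≤ s → s ≤ T →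
      |u₀ (y, s)| ≤ (Icc (-k) k).indicator (fun _ => E) (s - ‖y‖) * (1 + s + ‖y‖)⁻¹)
    {v : Space × ℝ → ℝ} (hv : ContDiff ℝ 1 v) (hvs : ConeSupported k T v)
    (hvM : ∀ y s, 0 ≤ s → s ≤ T → |v (y, s) - u₀ (y, s)| ≤ M * decay a b y s)
    (x : Space) {t : ℝ} (ht : 0 ≤ t) (htT : t ≤ T) :
    |retard (source (timeWeight p) (truncPow p) v) (x, t)| ≤
      Real.pi * (2 + k) ^ (p - 1) * (4 + 4 / b)
        * (2 * k * E ^ p + M ^ p * (1 + 2 * T + k) ^ (p * a) * J) * decay a b x t := by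
  have hp0 : p ≠ 0 := by linarith
  have hT : 0 ≤ T := ht.trans htT
  have hadm := admissible_truncPow hp hp2
  set Q := (1 + 2 * T + k) ^ (p * a) with hQ
  have hφ : Measurable fun β : ℝ => (1 + |β|) ^ (-(p * b)) := by fun_prop
  have hsupp : ConeSupported k T (source (timeWeight p) (truncPow p) v) := by
    intro y s hs hsT hy
    rw [source, hvs y s hs hsT hy, hadm.map_zero, mul_zero]
  rw [decay, ← mul_assoc]
  refine abs_retard_radial_le (J := 2 * k * E ^ p + M ^ p * Q * J)
    (h := fun β => (Icc (-k) k).indicator (fun _ => E ^ p) β + M ^ p * Q * (1 + |β|) ^ (-(p * b)))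
    hp ha hb hab hk (by positivity)
    (((measurable_const.indicator measurableSet_Icc)).add (hφ.const_mul _)) ?_
    (lintegral_indicator_add_le (by linarith) (by positivity) (by positivity) hJ hφ hhJ)
    (hadm.contDiff_source hv) ?_ hsupp x ht htT
  · intro β
    have : 0 ≤ (Icc (-k) k).indicator (fun _ => E ^ p) β :=
      indicator_nonneg (fun _ _ => by positivity) _
    positivity
  intro y s hs hsT
  have hpi := Real.pi_gt_three
  have hα : 0 < 1 + s + ‖y‖ := by positivity
  have hind : 0 ≤ (Icc (-k) k).indicator (fun _ => E ^ p) (s - ‖y‖) :=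
    indicator_nonneg (fun _ _ => by positivity) _
  rcases lt_or_ge (s + k) ‖y‖ with hy | hy
  · rw [hsupp y s hs hsT hy, abs_zero]
    positivity
  have h1 : |u₀ (y, s)| ^ p
      ≤ (1 + s + ‖y‖) ^ (-p) * (Icc (-k) k).indicator (fun _ => E ^ p) (s - ‖y‖) := by
    have hnn : 0 ≤ (Icc (-k) k).indicator (fun _ => E) (s - ‖y‖) :=
      indicator_nonneg (fun _ _ => hE) _
    refine (Real.rpow_le_rpow (abs_nonneg _) (hu₀ y s hs hsT) (by linarith)).trans_eq ?_
    rw [Real.mul_rpow hnn (by positivity), Real.inv_rpow hα.le, ← Real.rpow_neg hα.le, mul_comm]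
    by_cases h : s - ‖y‖ ∈ Icc (-k) k <;> simp [h, Real.zero_rpow hp0]
  have h2 : |v (y, s) - u₀ (y, s)| ^ p
      ≤ (1 + s + ‖y‖) ^ (-p) * (M ^ p * Q * (1 + |s - ‖y‖|) ^ (-(p * b))) := by
    refine (Real.rpow_le_rpow (abs_nonneg _) (hvM y s hs hsT) (by linarith)).trans ?_
    have hβ : 0 ≤ 1 + |s - ‖y‖| := by positivity
    rw [Real.mul_rpow hM (decay_nonneg _ _ _ hs), decay,
      Real.mul_rpow (by positivity) (by positivity), ← Real.rpow_mul hα.le, ← Real.rpow_mul hβ,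
      show (a - 1) * p = -p + p * a by ring, Real.rpow_add hα, show -b * p = -(p * b) by ring]
    have : (1 + s + ‖y‖) ^ (p * a) ≤ Q :=
      Real.rpow_le_rpow hα.le (by linarith) (by positivity)
    calc _ ≤ M ^ p * ((1 + s + ‖y‖) ^ (-p) * Q * (1 + |s - ‖y‖|) ^ (-(p * b))) := by gcongr
      _ = _ := by ring
  have h3 : |v (y, s)| ^ p ≤ 4 * (|u₀ (y, s)| ^ p + |v (y, s) - u₀ (y, s)| ^ p) := by
    refine le_trans (Real.rpow_le_rpow (abs_nonneg _) ?_ (by linarith))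
      (add_rpow_le_four_mul (by linarith) hp2 (abs_nonneg _) (abs_nonneg _))
    calc |v (y, s)| = |u₀ (y, s) + (v (y, s) - u₀ (y, s))| := by congr 1; ring
      _ ≤ _ := abs_add_le _ _
  have h0 : 0 ≤ (1 + s) ^ (-(p - 1)) := by positivity
  rw [source, abs_mul, timeWeight_of_nonneg p hs, abs_of_nonneg (by positivity)]
  calc _ ≤ 1 / (4 * Real.pi) * (1 + s) ^ (-(p - 1)) * |v (y, s)| ^ p := by
        gcongr; exact abs_truncPow_le hp hp2 _
    _ ≤ 1 / (4 * Real.pi) * (1 + s) ^ (-(p - 1)) *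
        (4 * ((1 + s + ‖y‖) ^ (-p) * (Icc (-k) k).indicator (fun _ => E ^ p) (s - ‖y‖)
          + (1 + s + ‖y‖) ^ (-p) * (M ^ p * Q * (1 + |s - ‖y‖|) ^ (-(p * b))))) := by
        gcongr; linarith
    _ = 1 / Real.pi * ((1 + s) ^ (-(p - 1)) * (1 + s + ‖y‖) ^ (-p) *
        ((Icc (-k) k).indicator (fun _ => E ^ p) (s - ‖y‖)
          + M ^ p * Q * (1 + |s - ‖y‖|) ^ (-(p * b)))) := by
        field_simp
    _ ≤ _ := by
        refine mul_le_of_le_one_left (by positivity) ?_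
        rw [div_le_one (by positivity)]; linarith

/-- The condition `hEM` says that the ball of radius `M` in the weighted norm about `u₀` is mapped
into itself. Convergence is not at stake here; it comes from the exponential weights. -/
theorem abs_picard_sub_le_decay (hp : 1 < p) (hp2 : p ≤ 2) (ha : 0 ≤ a) (hb : 0 < b)
    (hab : b = a + 2 * p - 3) (hk : 1 ≤ k) (hJ : 0 ≤ J)
    (hhJ : ∫⁻ β in Icc (-k) T, ENNReal.ofReal ((1 + |β|) ^ (-(p * b))) ≤ ENNReal.ofReal J)
    {E M : ℝ} (hE : 0 ≤ E) (hM : 0 ≤ M)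
    (hEM : Real.pi * (2 + k) ^ (p - 1) * (4 + 4 / b)
        * (2 * k * E ^ p + M ^ p * (1 + 2 * T + k) ^ (p * a) * J) ≤ M)
    (hu₀c : ContDiff ℝ 1 u₀)
    (hu₀ : ∀ y s, 0 ≤ s → s ≤ T →
      |u₀ (y, s)| ≤ (Icc (-k) k).indicator (fun _ => E) (s - ‖y‖) * (1 + s + ‖y‖)⁻¹) (n : ℕ) :
    ConeSupported k T (picard (timeWeight p) (truncPow p) u₀ n) ∧
    ∀ y s, 0 ≤ s → s ≤ T →
      |picard (timeWeight p) (truncPow p) u₀ n (y, s) - u₀ (y, s)| ≤ M * decay a b y s := by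
  have hadm := admissible_truncPow hp hp2
  have hsupp₀ : ConeSupported k T u₀ := by
    intro y s hs hsT hy
    have h := hu₀ y s hs hsT
    rw [indicator_of_notMem (fun h => by linarith [h.1]), zero_mul] at h
    exact abs_nonpos_iff.1 h
  induction n with
  | zero =>
    refine ⟨hsupp₀, fun y s hs _ => ?_⟩
    have := decay_nonneg a b y hs
    simp only [picard, sub_self, abs_zero]
    positivity
  | succ n ih =>
    have hsrc : ConeSupported k T
        (source (timeWeight p) (truncPow p) (picard (timeWeight p) (truncPow p) u₀ n)) := by
      intro y s hs hsT hy
      rw [source, ih.1 y s hs hsT hy, hadm.map_zero, mul_zero]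
    refine ⟨fun y s hs hsT hy => ?_, fun y s hs hsT => ?_⟩
    · simp only [picard]
      rw [hsupp₀ y s hs hsT hy, hsrc.retard y s hs hsT hy, add_zero]
    · simp only [picard, add_sub_cancel_left]
      refine (abs_retard_source_le hp hp2 ha hb hab hk hJ hhJ hE hM hu₀
        (hadm.contDiff_picard hu₀c n) ih.1 ih.2 y hs hsT).trans ?_
      exact mul_le_mul_of_nonneg_right hEM (decay_nonneg _ _ _ hs)

end Iteration

/-! ### From the weighted bounds to solvability up to time `T` -/

theorem uniquelySolvable_of_bound {p a b k T J E M ε C : ℝ} {f g : Space → ℝ} (hp : 1 < p)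
    (hp2 : p ≤ 2) (ha : 0 ≤ a) (ha1 : a ≤ 1) (hb : 0 < b)
    (hab : b = a + 2 * p - 3) (hf : ContDiff ℝ 3 f) (hg : ContDiff ℝ 2 g) (hk : 1 ≤ k)
    (hT : 0 < T) (hε : 0 ≤ ε) (hC : 0 ≤ C)
    (hkC : ∀ x t, 0 ≤ t → |kirchhoff f g (x, t)| ≤ C * (1 + t)⁻¹)
    (hks : ∀ x t, k < abs (‖x‖ - |t|) → kirchhoff f g (x, t) = 0) (hJ : 0 ≤ J)
    (hhJ : ∫⁻ β in Icc (-k) T, ENNReal.ofReal ((1 + |β|) ^ (-(p * b))) ≤ ENNReal.ofReal J)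
    (hE : E = C * (2 + k) * ε) (hE1 : E ≤ 1 / 2) (hM : 0 ≤ M) (hM1 : M ≤ 1 / 2)
    (hEM : Real.pi * (2 + k) ^ (p - 1) * (4 + 4 / b)
        * (2 * k * E ^ p + M ^ p * (1 + 2 * T + k) ^ (p * a) * J) ≤ M) :
    UniquelySolvable p f g ε T := by
  have hadm := admissible_truncPow hp hp2
  have hE0 : 0 ≤ E := by rw [hE]; positivity
  have hw : ContDiff ℝ 1 fun z => ε * kirchhoff f g z :=
    contDiff_const.mul ((contDiff_kirchhoff hf hg).of_le (by norm_num))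
  obtain ⟨u₀, hu₀c, hu₀s, hu₀e⟩ := exists_cutoff hw (k := k)
    (fun x t h => by rw [hks x t h, mul_zero]) hT
  obtain ⟨B₁, hB₁⟩ := hu₀c.continuous.bounded_above_of_compact_support hu₀s
  obtain ⟨B₂, hB₂⟩ := (hu₀c.continuous_fderiv one_ne_zero).bounded_above_of_compact_support
    (hu₀s.fderiv (𝕜 := ℝ))
  have hu₀ : ∀ y s, 0 ≤ s → s ≤ T →
      |u₀ (y, s)| ≤ (Icc (-k) k).indicator (fun _ => E) (s - ‖y‖) * (1 + s + ‖y‖)⁻¹ := by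
    intro y s hs hsT
    rw [hu₀e y s (by rwa [abs_of_nonneg hs])]
    by_cases h : s - ‖y‖ ∈ Icc (-k) k
    · rw [indicator_of_mem h, abs_mul, abs_of_nonneg hε]
      -- On the strip `‖y‖ ≤ s + k`; this is the origin of the factor `2 + k` in `E`.
      have h1 : (1 + s)⁻¹ ≤ (2 + k) * (1 + s + ‖y‖)⁻¹ := by
        rw [← div_eq_mul_inv, inv_eq_one_div, div_le_div_iff₀ (by positivity) (by positivity)]
        nlinarith [h.1]
      calc _ ≤ ε * (C * (1 + s)⁻¹) := by gcongr; exact hkC y s hs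
        _ ≤ ε * (C * ((2 + k) * (1 + s + ‖y‖)⁻¹)) := by gcongr
        _ = _ := by rw [hE]; ring
    · rw [indicator_of_notMem h, hks y s, mul_zero, abs_zero, zero_mul]
      rw [abs_of_nonneg hs, abs_sub_comm, lt_abs]
      rw [mem_Icc, not_and_or, not_le, not_le] at h
      rcases h with h | h
      · right; linarith
      · left; exact h
  obtain ⟨u, huc, hue, hul⟩ := hadm.exists_solution (B := max B₁ B₂) hu₀c
    (fun z => (hB₁ z).trans (le_max_left _ _)) (fun z => (hB₂ z).trans (le_max_right _ _))
  -- The free part and the perturbation are each at most `1/2`, so up to time `T` the truncated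
  -- power is the true one.
  have hu1 : ∀ y s, 0 ≤ s → s ≤ T → |u (y, s)| ≤ 1 := by
    intro y s hs hsT
    refine le_of_tendsto' (hul (y, s)).abs fun n => ?_
    have h1 := (abs_picard_sub_le_decay hp hp2 ha hb hab hk hJ hhJ hE0 hM hEM hu₀c hu₀ n).2 y s hs
      hsT
    have h2 : M * decay a b y s ≤ 1 / 2 :=
      (mul_le_of_le_one_right hM (decay_le_one ha1 hb.le y hs)).trans hM1
    have h3 : |u₀ (y, s)| ≤ 1 / 2 := by
      refine (hu₀ y s hs hsT).trans (le_trans ?_ hE1)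
      exact (mul_le_of_le_one_right (indicator_nonneg (fun _ _ => hE0) _)
        (inv_le_one_of_one_le₀ (by linarith [norm_nonneg y]))).trans
        (indicator_le_self' (fun _ _ => hE0) _)
    have h4 := abs_add_le (picard (timeWeight p) (truncPow p) u₀ n (y, s) - u₀ (y, s)) (u₀ (y, s))
    rw [sub_add_cancel] at h4
    linarith
  have hsol : IsSolution p f g ε T fun x t => u (x, t) :=
    { contDiffOn := huc.contDiffOn
      eqn := by
        refine ⟨_, isFreeWave_kirchhoff hf hg ε, fun x t ht htT => ?_⟩
        rw [hue, hu₀e x t (by rw [abs_of_nonneg ht]; exact htT.le)]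
        congr 1
        refine (opL_eq_retard (hadm.contDiff_source huc).continuous ht fun y s hs => ?_).symm
        rw [source, timeWeight_of_nonneg p hs.1,
          truncPow_of_mem hp hp2 (hu1 y s hs.1 (hs.2.trans htT.le)), mul_assoc] }
  exact ⟨_, hsol, fun v hv x t ht htT =>
    hv.eq hp (hf.of_le (by norm_num)) hsol x ht htT⟩

/-- Existence and uniqueness up to time `T` under an explicit smallness condition. -/
theorem exists_uniquelySolvable_of_small {p a b : ℝ} {f g : Space → ℝ} (hp : 1 < p) (hp2 : p ≤ 2)
    (ha : 0 ≤ a) (ha1 : a ≤ 1) (hb : 0 < b) (hab : b = a + 2 * p - 3)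
    (hf : ContDiff ℝ 3 f) (hfs : HasCompactSupport f) (hg : ContDiff ℝ 2 g)
    (hgs : HasCompactSupport g) :
    ∃ k c ε₁ : ℝ, 1 ≤ k ∧ 0 < c ∧ 0 < ε₁ ∧ ∀ ε T J : ℝ, 0 < ε → ε ≤ ε₁ → 0 < T → 0 ≤ J →
      ∫⁻ β in Icc (-k) T, ENNReal.ofReal ((1 + |β|) ^ (-(p * b))) ≤ ENNReal.ofReal J →
      ε ^ (p * (p - 1)) * ((1 + 2 * T + k) ^ (p * a) * J) ≤ c → UniquelySolvable p f g ε T := by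
  obtain ⟨k, C, hk, hC, hkC, hks⟩ := exists_kirchhoff_bound (hf.of_le (by norm_num)) hfs
    hg.continuous hgs
  set S := Real.pi * (2 + k) ^ (p - 1) * (4 + 4 / b) with hS
  have hpi := Real.pi_pos
  have hS0 : 0 < S := by positivity
  set E₀ := C * (2 + k) with hE₀
  have hE₀0 : 0 < E₀ := by positivity
  set D := S * (4 * k) with hD
  have hD0 : 0 < D := by positivity
  -- With `E = E₀ ε` and `M = D E^p`, the value `D = 4kS` is twice what the free wave alone
  -- requires. The constant `c` expresses that the perturbation term is at most `2kE^p` as well. The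
  -- two entries of the minimum ensure `E ≤ 1/2` and `M ≤ 1/2`.
  refine ⟨k, 2 * k / (D ^ p * E₀ ^ (p * (p - 1))), min (1 / (2 * E₀)) ((1 / (2 * D)) ^ p⁻¹ / E₀),
    hk, by positivity, by positivity, fun ε T J hε hε1 hT hJ hhJ hsm => ?_⟩
  have hε2 := (le_div_iff₀ (by positivity)).1 (hε1.trans (min_le_left _ _))
  have hε3 := (le_div_iff₀ (by positivity)).1 (hε1.trans (min_le_right _ _))
  have hEp : (E₀ * ε) ^ p ≤ 1 / (2 * D) := by
    calc (E₀ * ε) ^ p ≤ ((1 / (2 * D)) ^ p⁻¹) ^ p :=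
          Real.rpow_le_rpow (by positivity) (by linarith) (by linarith)
      _ = _ := Real.rpow_inv_rpow (by positivity) (by linarith)
  refine uniquelySolvable_of_bound (M := D * (E₀ * ε) ^ p) hp hp2 ha ha1 hb hab hf hg hk hT hε.le
    hC.le hkC hks hJ hhJ rfl (by linarith) (by positivity) ?_ ?_
  · calc D * (E₀ * ε) ^ p ≤ D * (1 / (2 * D)) := by gcongr
      _ = 1 / 2 := by field_simp
  rw [← hS, ← hE₀]
  -- The exponent `p(p-1)` of the lifespan arises here: `M^p` is of order `E^(p²) = E^(p(p-1)) E^p`,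
  -- to be compared with `E^p`.
  have e1 : (D * (E₀ * ε) ^ p) ^ p
      = D ^ p * E₀ ^ (p * (p - 1)) * ε ^ (p * (p - 1)) * (E₀ * ε) ^ p := by
    rw [Real.mul_rpow hD0.le (by positivity), ← Real.rpow_mul (by positivity),
      show p * p = p * (p - 1) + p by ring, Real.rpow_add (by positivity),
      Real.mul_rpow (z := p * (p - 1)) hE₀0.le hε.le]
    ring
  rw [le_div_iff₀ (by positivity)] at hsm
  have e2 : (D * (E₀ * ε) ^ p) ^ p * (1 + 2 * T + k) ^ (p * a) * J ≤ 2 * k * (E₀ * ε) ^ p := by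
    calc _ = (ε ^ (p * (p - 1)) * ((1 + 2 * T + k) ^ (p * a) * J) * (D ^ p * E₀ ^ (p * (p - 1))))
          * (E₀ * ε) ^ p := by rw [e1]; ring
      _ ≤ _ := by gcongr
  calc _ ≤ S * (2 * k * (E₀ * ε) ^ p + 2 * k * (E₀ * ε) ^ p) := by gcongr
    _ = _ := by rw [hD]; ring

/-! ### Lower bounds for the lifespan -/

theorem lintegral_Icc_rpow_abs_le {k r T I : ℝ} (hk : 0 ≤ k) (hr : 0 ≤ r) (hT : 0 ≤ T)
    (hI : ∫ β in (0 : ℝ)..T, (1 + β) ^ (-r) ≤ I) :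
    ∫⁻ β in Icc (-k) T, ENNReal.ofReal ((1 + |β|) ^ (-r)) ≤ ENNReal.ofReal (k + I) := by
  have hc : ContinuousOn (fun β : ℝ => (1 + β) ^ (-r)) (Icc 0 T) :=
    ContinuousOn.rpow_const (by fun_prop) fun β hβ => Or.inl (by have := hβ.1; positivity)
  have hI0 : 0 ≤ I := le_trans (intervalIntegral.integral_nonneg hT fun β hβ =>
    Real.rpow_nonneg (by linarith [hβ.1]) _) hI
  have hU : Icc (-k) T ⊆ Icc (-k) 0 ∪ Icc 0 T := fun β hβ =>
    (le_total β 0).imp (fun h => ⟨hβ.1, h⟩) fun h => ⟨h, hβ.2⟩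
  calc _ ≤ ∫⁻ β in Icc (-k) 0 ∪ Icc 0 T, ENNReal.ofReal ((1 + |β|) ^ (-r)) :=
        lintegral_mono_set hU
    _ ≤ (∫⁻ β in Icc (-k) 0, ENNReal.ofReal ((1 + |β|) ^ (-r)))
        + ∫⁻ β in Icc 0 T, ENNReal.ofReal ((1 + |β|) ^ (-r)) := lintegral_union_le _ _ _
    _ ≤ (∫⁻ β in Icc (-k) 0, 1) + ∫⁻ β in Icc 0 T, ENNReal.ofReal ((1 + β) ^ (-r)) := by
        refine add_le_add (lintegral_mono fun β => ?_)
          (setLIntegral_mono' measurableSet_Icc fun β hβ => by rw [abs_of_nonneg hβ.1])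
        exact ENNReal.ofReal_le_one.2 (Real.rpow_le_one_of_one_le_of_nonpos
          (by linarith [abs_nonneg β]) (by linarith))
    _ ≤ ENNReal.ofReal k + ENNReal.ofReal I := by
        refine add_le_add ?_ ?_
        · rw [setLIntegral_const, one_mul, Real.volume_Icc, zero_sub, neg_neg]
        · rw [← ofReal_integral_eq_lintegral_ofReal hc.integrableOn_Icc
            ((ae_restrict_iff' measurableSet_Icc).2 (ae_of_all _ fun β hβ =>
              Real.rpow_nonneg (by linarith [hβ.1]) _)),
            integral_Icc_eq_integral_Ioc, ← intervalIntegral.integral_of_le hT]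
          exact ENNReal.ofReal_le_ofReal hI
    _ = _ := (ENNReal.ofReal_add hk hI0).symm

theorem integral_one_add_rpow_le {r : ℝ} (T : ℝ) (hr : r < 1) :
    ∫ β in (0 : ℝ)..T, (1 + β) ^ (-r) ≤ (1 + T) ^ (1 - r) / (1 - r) := by
  rw [intervalIntegral.integral_comp_add_left (fun y : ℝ => y ^ (-r)) 1,
    integral_rpow (Or.inl (by linarith)), show -r + 1 = 1 - r by ring]
  refine div_le_div_of_nonneg_right (sub_le_self _ ?_) (by linarith)
  simp

theorem integral_one_add_inv {T : ℝ} (hT : 0 ≤ T) :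
    ∫ β in (0 : ℝ)..T, (1 + β) ^ (-(1 : ℝ)) = Real.log (1 + T) := by
  simp only [Real.rpow_neg_one]
  rw [intervalIntegral.integral_comp_add_left (fun y : ℝ => y⁻¹) 1,
    integral_inv_of_pos (by norm_num) (by linarith)]
  simp

theorem strauss_five : strauss 5 = (6 + √68) / 8 := by
  unfold strauss; norm_num

theorem lt_two_of_le_strauss {p : ℝ} (hpS : p ≤ strauss 5) : p < 2 := by
  rw [strauss_five] at hpS
  have : √68 < 10 := (Real.sqrt_lt' (by norm_num)).2 (by norm_num)
  linarith

theorem gam_pos_of_lt_strauss {p : ℝ} (hp : 1 < p) (hpS : p < strauss 5) : 0 < gam p 5 := by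
  rw [strauss_five] at hpS
  have h := (Real.lt_sqrt (by linarith : 0 ≤ 8 * p - 6)).1 (by linarith : 8 * p - 6 < √68)
  unfold gam
  nlinarith

theorem gam_strauss : gam (strauss 5) 5 = 0 := by
  rw [strauss_five, gam]
  nlinarith [Real.sq_sqrt (show (0 : ℝ) ≤ 68 by norm_num)]

section Lifespan

variable {p : ℝ} {f g : Space → ℝ}

theorem exists_uniquelySolvable_of_lt (hp : 1 < p) (hpS : p < strauss 5) (hf : ContDiff ℝ 3 f)
    (hfs : HasCompactSupport f) (hg : ContDiff ℝ 2 g) (hgs : HasCompactSupport g) :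
    ∃ A ε₀ : ℝ, 0 < A ∧ 0 < ε₀ ∧ ∀ ε T : ℝ, 0 < ε → ε ≤ ε₀ → 0 < T →
      T ≤ A * ε ^ (-(2 * p * (p - 1) / gam p 5)) → UniquelySolvable p f g ε T := by
  have hγ := gam_pos_of_lt_strauss hp hpS
  have hγ' : gam p 5 = 2 * (1 - p * (2 * p - 3)) := by unfold gam; ring
  have hp0 : 0 < p := by linarith
  -- The lower bounds give `b > 0` and `a > 0`, the upper ones `pb < 1` and `a < 1`. The only
  -- nontrivial compatibility, `2p - 3 < 1/p`, is the positivity of `gam p 5`.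
  obtain ⟨b, hb1, hb2⟩ : ∃ b, max 0 (2 * p - 3) < b ∧ b < min (1 / p) (2 * p - 2) := by
    refine exists_between (max_lt (lt_min (by positivity) (by linarith))
      (lt_min ?_ (by linarith)))
    rw [lt_div_iff₀ hp0]; linarith
  rw [max_lt_iff] at hb1
  rw [lt_min_iff, lt_div_iff₀ hp0] at hb2
  obtain ⟨k, c, ε₁, hk, hc, hε₁, key⟩ := exists_uniquelySolvable_of_small (a := b + 3 - 2 * p) hp
    (lt_two_of_le_strauss hpS.le).le (by linarith) (by linarith) hb1.1 (by ring) hf hfs hg hgs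
  set a := b + 3 - 2 * p with ha
  have ha0 : 0 ≤ a := by linarith
  set δ := 1 - p * b with hδ
  have hδ0 : 0 < δ := by linarith
  set κ := p * (p - 1) with hκ
  have hκ0 : 0 < κ := mul_pos hp0 (by linarith)
  set m := p * a + δ with hm
  have hm0 : 0 < m := by positivity
  -- The total power of `T` does not depend on the choice of `b`, since only `b - a = 2p - 3`
  -- enters.
  have hmγ : gam p 5 = 2 * m := by rw [hγ', hm, hδ, ha]; ring
  set G := (2 + k) ^ (p * a) * (k + 1 / δ) with hG
  have hG0 : 0 < G := by positivity
  -- Solves `G (2A)^m = c`. One `A` is spent on `T`, the other on the `1` in `1 + T`, which the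
  -- second entry of the minimum below controls.
  set A := (c / G) ^ m⁻¹ / 2 with hA
  have hA0 : 0 < A := by positivity
  refine ⟨A, min ε₁ (A ^ (κ / m)⁻¹), hA0, by positivity, fun ε T hε hεle hT hTle => ?_⟩
  refine key ε T ((k + 1 / δ) * (1 + T) ^ δ) hε (hεle.trans (min_le_left _ _)) hT (by positivity)
    ?_ ?_
  · refine (lintegral_Icc_rpow_abs_le (by linarith) (mul_nonneg hp0.le hb1.1.le) hT.le
      (integral_one_add_rpow_le T (by linarith))).trans (ENNReal.ofReal_le_ofReal ?_)
    rw [← hδ, add_mul, one_div_mul_eq_div]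
    gcongr
    exact le_mul_of_one_le_right (by linarith) (Real.one_le_rpow (by linarith) hδ0.le)
  have h1 : (1 + 2 * T + k) ^ (p * a) ≤ (2 + k) ^ (p * a) * (1 + T) ^ (p * a) := by
    rw [← Real.mul_rpow (by positivity) (by positivity)]
    exact Real.rpow_le_rpow (by positivity) (by nlinarith) (by positivity)
  have h2 : ε ^ (κ / m) ≤ A := by
    calc ε ^ (κ / m) ≤ (A ^ (κ / m)⁻¹) ^ (κ / m) :=
          Real.rpow_le_rpow hε.le (hεle.trans (min_le_right _ _)) (by positivity)
      _ = A := Real.rpow_inv_rpow hA0.le (by positivity)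
  have h3 : ε ^ (κ / m) * (1 + T) ≤ 2 * A := by
    have e : ε ^ (κ / m) * T ≤ A := by
      calc ε ^ (κ / m) * T ≤ ε ^ (κ / m) * (A * ε ^ (-(2 * p * (p - 1) / gam p 5))) := by gcongr
        _ = A * (ε ^ (κ / m) * ε ^ (-(κ / m))) := by
          rw [hmγ, show 2 * p * (p - 1) / (2 * m) = κ / m by rw [hκ]; field_simp]; ring
        _ = A := by rw [← Real.rpow_add hε, add_neg_cancel, Real.rpow_zero, mul_one]
    linarith
  calc _ ≤ ε ^ κ * ((2 + k) ^ (p * a) * (1 + T) ^ (p * a) * ((k + 1 / δ) * (1 + T) ^ δ)) := by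
        gcongr
    _ = G * ((ε ^ (κ / m)) ^ m * (1 + T) ^ m) := by
        rw [← Real.rpow_mul hε.le, div_mul_cancel₀ _ hm0.ne', hG, hm,
          Real.rpow_add (by positivity : 0 < 1 + T)]
        ring
    _ = G * (ε ^ (κ / m) * (1 + T)) ^ m := by rw [Real.mul_rpow (by positivity) (by positivity)]
    _ ≤ G * (2 * A) ^ m := by gcongr
    _ = c := by
        rw [hA, mul_div_cancel₀ _ (two_ne_zero), Real.rpow_inv_rpow (by positivity) hm0.ne']
        field_simp

/-- At the critical exponent `p(2p - 3) = 1`, so `a = 0` makes `pb = 1`. The power of `T`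
disappears, and only the logarithm in `J` limits the time. -/
theorem exists_uniquelySolvable_of_eq (hp : 1 < p) (hpS : p = strauss 5) (hf : ContDiff ℝ 3 f)
    (hfs : HasCompactSupport f) (hg : ContDiff ℝ 2 g) (hgs : HasCompactSupport g) :
    ∃ A ε₀ : ℝ, 0 < A ∧ 0 < ε₀ ∧ ∀ ε T : ℝ, 0 < ε → ε ≤ ε₀ → 0 < T →
      T ≤ Real.exp (A * ε ^ (-(p * (p - 1)))) → UniquelySolvable p f g ε T := by
  have hγ : p * (2 * p - 3) = 1 := by
    have := gam_strauss
    rw [← hpS, gam] at this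
    linarith
  have hp0 : 0 < p := by linarith
  have hb0 : 0 < 2 * p - 3 := pos_of_mul_pos_right (by rw [hγ]; norm_num) hp0.le
  obtain ⟨k, c, ε₁, hk, hc, hε₁, key⟩ := exists_uniquelySolvable_of_small (a := 0)
    (b := 2 * p - 3) hp (lt_two_of_le_strauss hpS.le).le le_rfl zero_le_one hb0 (by ring) hf hfs
    hg hgs
  set κ := p * (p - 1) with hκ
  have hκ0 : 0 < κ := mul_pos hp0 (by linarith)
  -- Half of `c` pays for the logarithm of the exponential, the other half for the constant `k + 1`,
  -- in which the `1` dominates `log 2`.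
  refine ⟨c / 2, min ε₁ ((c / (2 * (k + 1))) ^ κ⁻¹), by positivity, by positivity,
    fun ε T hε hεle hT hTle => ?_⟩
  have hX : 0 < c / 2 * ε ^ (-κ) := by positivity
  refine key ε T (k + (1 + c / 2 * ε ^ (-κ))) hε (hεle.trans (min_le_left _ _)) hT (by positivity)
    ?_ ?_
  · rw [hγ]
    refine lintegral_Icc_rpow_abs_le (by linarith) zero_le_one hT.le ?_
    rw [integral_one_add_inv hT.le]
    calc Real.log (1 + T) ≤ Real.log (2 * Real.exp (c / 2 * ε ^ (-κ))) := by
          refine Real.log_le_log (by linarith) ?_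
          linarith [Real.one_le_exp hX.le]
      _ = Real.log 2 + c / 2 * ε ^ (-κ) := by
          rw [Real.log_mul (by norm_num) (Real.exp_ne_zero _), Real.log_exp]
      _ ≤ _ := by
          have := Real.log_two_lt_d9
          linarith
  have h2 : ε ^ κ ≤ c / (2 * (k + 1)) := by
    calc ε ^ κ ≤ ((c / (2 * (k + 1))) ^ κ⁻¹) ^ κ :=
          Real.rpow_le_rpow hε.le (hεle.trans (min_le_right _ _)) hκ0.le
      _ = _ := Real.rpow_inv_rpow (by positivity) hκ0.ne'
  rw [le_div_iff₀ (by positivity)] at h2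
  have h3 : ε ^ κ * ε ^ (-κ) = 1 := by rw [← Real.rpow_add hε, add_neg_cancel, Real.rpow_zero]
  calc _ = ε ^ κ * (k + 1) + c / 2 * (ε ^ κ * ε ^ (-κ)) := by
        rw [mul_zero, Real.rpow_zero]; ring
    _ ≤ c := by rw [h3]; linarith

theorem ofReal_le_lifespan {ε T : ℝ} (hT : 0 ≤ T) (h : UniquelySolvable p f g ε T) :
    ENNReal.ofReal T ≤ lifespan p f g ε :=
  le_sSup ⟨T, ⟨hT, h⟩, rfl⟩

theorem lowerBound_pos {A ε : ℝ} (hA : 0 < A) (hε : 0 < ε) : 0 < lowerBound p A ε := by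
  unfold lowerBound
  split_ifs <;> positivity

theorem exists_uniquelySolvable (hp : 1 < p) (hpS : p ≤ strauss 5) (hf : ContDiff ℝ 3 f)
    (hfs : HasCompactSupport f) (hg : ContDiff ℝ 2 g) (hgs : HasCompactSupport g) :
    ∃ A ε₀ : ℝ, 0 < A ∧ 0 < ε₀ ∧ ∀ ε T : ℝ, 0 < ε → ε ≤ ε₀ → 0 < T →
      T ≤ lowerBound p A ε → UniquelySolvable p f g ε T := by
  unfold lowerBound
  rcases hpS.lt_or_eq with h | h
  · simpa only [if_pos h] using exists_uniquelySolvable_of_lt hp h hf hfs hg hgs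
  · simpa only [if_neg h.not_lt] using exists_uniquelySolvable_of_eq hp h hf hfs hg hgs

end Lifespan

end

end DampedWave

/-! ### The main theorem -/

theorem theorem2 (p : ℝ) (hp : 1 < p) (hpS : p ≤ DampedWave.strauss 5)
    (f g : DampedWave.Space → ℝ)
    (hf : ContDiff ℝ 3 f) (hf_supp : HasCompactSupport f)
    (hg : ContDiff ℝ 2 g) (hg_supp : HasCompactSupport g) :
    ∃ A ε₀ : ℝ, 0 < A ∧ 0 < ε₀ ∧ ∀ ε : ℝ, 0 < ε → ε ≤ ε₀ →
      (∀ T : ℝ, 0 < T → T ≤ DampedWave.lowerBound p A ε →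
        DampedWave.UniquelySolvable p f g ε T) ∧
      ENNReal.ofReal (DampedWave.lowerBound p A ε) ≤ DampedWave.lifespan p f g ε := by
  obtain ⟨A, ε₀, hA, hε₀, h⟩ :=
    DampedWave.exists_uniquelySolvable hp hpS hf hf_supp hg hg_supp
  refine ⟨A, ε₀, hA, hε₀, fun ε hε hεle => ⟨fun T hT hTle => h ε T hε hεle hT hTle, ?_⟩⟩
  have hpos := DampedWave.lowerBound_pos (p := p) hA hε
  exact DampedWave.ofReal_le_lifespan hpos.le (h ε _ hε hεle hpos le_rfl)
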